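/- \textbf{Setting.} An $n$-arm bandit is a vector $q=(q_1,\dots,q_n)$ of probability distributions on $[0,1]$, with expected utilities $u_i=\mathbb E_{x\sim q_i}[x]$. A query $i$ to its oracle returns an independent sample of $q_i$. For $\sigma\in[1/n,1]$, a policy $\pi$ (a probability vector in $\mathbb R^n$) is $\sigma$-smooth if $\pi_i\le\sigma$ for all $i$; it is optimal $\sigma$-smooth for $u$ if in addition $\pi'\cdot u\le\pi\cdot u$ for every $\sigma$-smooth $\pi'$; the \emph{optimal $\sigma$-smooth value} of $u$ is then $\pi\cdot u$. A function of the security parameter $\lambda$ is negligible ($\mathsf{negl}$) if it is $O(\lambda^{-c})$ for every $c$. Adversaries and extractors are non-uniform p.p.t.; the honest algorithms are uniform programs in a bit-cost model. Reals (the parameters $\varepsilon,\sigma$ and the rewards) are read by the honest parties to $\lambda+n+\lceil1/\varepsilon\rceil$ binary digits, and $\lceil1/\varepsilon\rceil$ is part of their input. Let $\mathsf{VC}=(\mathsf{KeyGen},\mathsf{Commit},\mathsf{Open},\mathsf{Verify})$ be p.p.t. algorithms of a vector commitment ($\mathsf{Commit}$ deterministic) and $\Pi=(\mathsf{Setup},\mathsf{Prove},\mathsf{Verify})$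 p.p.t. algorithms of a SNARK for the relations $$\mathcal R_{pp,n,s,\ell}=\{(c,t;v):\ v\in[0,1]^n,\ t=\pi\cdot v\text{ for an optimal }s\text{-smooth }\pi\text{ for }v,\ c=\mathsf{Commit}_{pp}(v)\},$$ where $pp$ is an output of $\mathsf{KeyGen}(1^\lambda,n)$, $s\in[1/n,1]$ is rational and $v$ has fixed-point entries with $\ell$ fractional binary digits. Assume that $\Pi$ is perfectly complete. For $n=n(\lambda)$: \begin{itemize} \item $\mathsf{VC}$ is \emph{correct} if there is a negligible $\nu$ such that, with probability $\ge1-\nu(\lambda)$ over $pp$, for every vector of length $n$ the honest opening of each component is accepted with probability $\ge1-\nu(\lambda)$. \item $\mathsf{VC}$ is \emph{position binding} if every non-uniform p.p.t. adversary, given $pp$, outputs a commitment, a position $i\in[n]$ and accepted openings of position $i$ to two different values only with negligible probability. \item $\Pi$ is \emph{knowledge sound} if, for all $s=s(\lambda)\in[1/n,1]\cap\mathbb Q$ of polynomial bit length and polynomially bounded $\ell=\ell(\lambda)$, and the relation generator that draws $pp\gets\mathsf{KeyGen}(1^\lambda,n)$ and outputs $\mathcal R_{pp,n,s,\ell}$,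 every non-uniform p.p.t. adversary has a non-uniform p.p.t. extractor which, from the adversary's input and coins, outputs a witness whenever the adversary outputs an accepted statement and proof, except with negligible probability. \end{itemize} \textbf{Lemma.} There is a protocol, consisting of a p.p.t. trusted setup (depending only on $\lambda,n,\varepsilon,\sigma$) followed by a three-message interaction between a prover and a verifier, each with input $(1^\lambda,n,\varepsilon,\sigma)$, the output of the setup and oracle access to $q$, in which the verifier rejects or outputs a number $t$, such that the following holds. \emph{Security.} Let $n(\lambda)\ge1$, $\varepsilon(\lambda)\in(0,1)$, $\sigma(\lambda)\in[1/n(\lambda),1]$, and let $q_\lambda$ be an $n(\lambda)$-arm bandit, with $n(\lambda)$ and $1/\varepsilon(\lambda)$ polynomially bounded in $\lambda$ (for instance, all constant). Assume that $\mathsf{VC}$ is correct and position binding and $\Pi$ is knowledge sound for $n(\lambda)$. \begin{itemize} \item \textbf{Completeness:} with the honest prover, the verifier outputs a value $t$ within $\varepsilon$ of the optimal $\sigma$-smooth value of $u$ with probability at least $\frac23-\mathsf{negl}(\lambda)$. \item \textbf{Soundness:} with any non-uniform p.p.t. prover with access to the bandit oracle, the probability that the verifier outputs a value $t$ that is not within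 $\varepsilon$ of the optimal $\sigma$-smooth value of $u$ is at most $\frac13+\mathsf{negl}(\lambda)$. \end{itemize} \emph{Efficiency.} For all $\lambda,n\ge1$, $\varepsilon\in(0,1)$, $\sigma\in[1/n,1]$ and all random choices, where the constants in $O(\cdot)$ are absolute: \begin{itemize} \item If, for some $K$, $\Pi$ has proofs and $\mathsf{VC}$ has commitments and opening proofs of at most $K\lambda$ bits (that is, of size $O(\lambda)$), the honest parties exchange $O\!\left(K\lambda\cdot\frac{\sigma n\log(2n)\log^2(2/\varepsilon)}{\varepsilon}\right)$ bits. \item The honest prover makes $O\!\left(\frac{n\log(2n/\varepsilon)}{\varepsilon^2}\right)$ non-adaptive oracle queries and runs in time $\mathrm{poly}(\lambda,n,1/\varepsilon)$. \item The verifier makes $O\!\left(\frac{n\sigma}{\varepsilon^2}\log\!\left(\frac{2n\sigma}{\varepsilon}\right)\log\!\left(\frac2\varepsilon\right)\right)$ non-adaptive oracle queries and runs in time $\mathrm{poly}(\lambda,n,1/\varepsilon)$ with the honest prover, and, with any prover, in time polynomial in $\lambda,n,1/\varepsilon$ and the length of the messages it receives. \end{itemize} (For $n\ge2$ and $\varepsilon\le\frac12$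 the factors $2$ inside the logarithms may be dropped.) -/

import Mathlib

open scoped BigOperators

namespace SmoothBandit

/-! ## A step-counting model of computation

Programs are point-free LOOP programs over finite binary trees whose leaves are natural numbers
in binary, charged by logarithmic cost: every instruction pays for the bit lengths of what it
reads and writes. A polynomial clock can be computed with `size`, `add` and `mul`, so
the functions with a polynomially bounded `cost` are exactly the polynomial-time functions. -/

/-- The objects that programs compute on. -/
inductive Data : Type
  | nat (a : ℕ) : Data
  | pair (x y : Data) : Data
  deriving DecidableEq

namespace Data

/-- A prefix-free binary encoding: a leaf with binary digits `b₁, …, b_m` is written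
`0 1 b₁ … 1 b_m 0`, a pair is written `1` followed by its two components. -/
def bits : Data → List Bool
  | nat a => false :: ((Nat.bits a).flatMap (fun b => [true, b]) ++ [false])
  | pair x y => true :: (bits x ++ bits y)

/-- The length in bits. -/
def size (x : Data) : ℕ := x.bits.length

def toNat : Data → ℕ
  | nat a => a
  | pair _ _ => 0

def fst : Data → Data
  | nat _ => nat 0
  | pair x _ => x

def snd : Data → Data
  | nat _ => nat 0
  | pair _ y => y

/-- Lists are nested pairs that end in the leaf `0`. -/
def ofList : List Data → Data
  | [] => nat 0
  | x :: xs => pair x (ofList xs)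

def toList : Data → List Data
  | nat _ => []
  | pair x y => x :: toList y

/-- The unary numeral `1^m`. -/
def unary (m : ℕ) : Data := ofList (List.replicate m (nat 0))

/-- A vector of natural numbers (equivalently, of binary strings). -/
def ofVec (v : List ℕ) : Data := ofList (v.map nat)

/-- `x.Denotes t`: the object `x` is a fraction `a / b` with `b ≠ 0`, of value `t`. -/
def Denotes (x : Data) (t : ℝ) : Prop :=
  ∃ a b : ℕ, b ≠ 0 ∧ x = pair (nat a) (nat b) ∧ t = (a : ℝ) / (b : ℝ)

end Data

/-- The programs. Each transforms one object into one object. -/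
inductive Code : Type
  | id : Code
  | const (d : Data) : Code
  | fst : Code
  | snd : Code
  | isNat : Code
  | size : Code
  | eq : Code
  | lt : Code
  | add : Code
  | sub : Code
  | mul : Code
  | div : Code
  | pair (f g : Code) : Code
  | comp (g f : Code) : Code
  | ite (c f g : Code) : Code
  | iter (f : Code) : Code

namespace Code

/-- What a program computes. Arithmetic acts on the two components of the input; `iter f`
applies `f` to the second component as many times as the first component says. -/
def eval : Code → Data → Data
  | id, x => x
  | const d, _ => d
  | fst, x => x.fst
  | snd, x => x.snd
  | isNat, x => match x with
    | .nat _ => .nat 1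
    | .pair _ _ => .nat 0
  | size, x => .nat x.size
  | eq, x => .nat (if x.fst = x.snd then 1 else 0)
  | lt, x => .nat (if x.fst.toNat < x.snd.toNat then 1 else 0)
  | add, x => .nat (x.fst.toNat + x.snd.toNat)
  | sub, x => .nat (x.fst.toNat - x.snd.toNat)
  | mul, x => .nat (x.fst.toNat * x.snd.toNat)
  | div, x => .nat (x.fst.toNat / x.snd.toNat)
  | pair f g, x => .pair (eval f x) (eval g x)
  | comp g f, x => eval g (eval f x)
  | ite c f g, x => if eval c x = .nat 0 then eval g x else eval f x
  | iter f, x => (eval f)^[x.fst.toNat] x.snd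

/-- The number of steps of a program on an input. -/
def cost : Code → Data → ℕ
  | pair f g, x => 1 + cost f x + cost g x
  | comp g f, x => 1 + cost f x + cost g (eval f x)
  | ite c f g, x => 1 + cost c x + (if eval c x = .nat 0 then cost g x else cost f x)
  | iter f, x =>
      1 + x.size + ∑ j ∈ Finset.range x.fst.toNat, cost f ((eval f)^[j] x.snd)
  | c, x => 1 + x.size + (eval c x).size

end Code

/-! ## Randomized algorithms -/

/-- `m` fair coin flips, read as a number below `2 ^ m`. -/
noncomputable def coinFlips (m : ℕ) : PMF ℕ :=
  (PMF.uniformOfFintype (Fin (2 ^ m))).map (fun r => (r : ℕ))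

/-- The probability of a random event. -/
noncomputable def prob (e : PMF Prop) : ℝ := (e True).toReal

/-- Negligible functions of the security parameter. -/
def Negligible (f : ℕ → ℝ) : Prop :=
  ∀ c : ℕ, f =O[Filter.atTop] (fun lam : ℕ => 1 / (lam : ℝ) ^ c)

/-- Polynomially bounded functions of the security parameter. -/
def PolyBounded (f : ℕ → ℕ) : Prop :=
  ∃ p : Polynomial ℕ, ∀ lam, f lam ≤ p.eval lam

/-- A deterministic polynomial-time algorithm. -/
structure PolyTime where
  code : Code
  time : Polynomial ℕ
  time_le : ∀ x, code.cost x ≤ time.eval x.size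

/-- A (uniform) probabilistic polynomial-time algorithm. -/
structure PPT where
  code : Code
  coins : Polynomial ℕ
  time : Polynomial ℕ
  time_le : ∀ x r, r < 2 ^ coins.eval x.size →
    code.cost (.pair x (.nat r)) ≤ time.eval x.size

/-- The output distribution of a p.p.t. algorithm. -/
noncomputable def PPT.run (A : PPT) (x : Data) : PMF Data :=
  (coinFlips (A.coins.eval x.size)).map (fun r => A.code.eval (.pair x (.nat r)))

/-- A non-uniform p.p.t. algorithm: it receives `1^λ`, an advice string of length polynomial
in `λ`, its input and its coins. -/
structure NonuniformPPT where
  code : Code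
  advice : ℕ → Data
  coins : ℕ → ℕ
  bound : Polynomial ℕ
  advice_le : ∀ lam, (advice lam).size ≤ bound.eval lam
  coins_le : ∀ lam, coins lam ≤ bound.eval lam
  time_le : ∀ lam x r, r < 2 ^ coins lam →
    code.cost (.pair (.unary lam) (.pair (advice lam) (.pair x (.nat r))))
      ≤ bound.eval (lam + x.size)

/-- The output on given coins. -/
def NonuniformPPT.runWith (A : NonuniformPPT) (lam : ℕ) (x : Data) (r : ℕ) : Data :=
  A.code.eval (.pair (.unary lam) (.pair (A.advice lam) (.pair x (.nat r))))

/-- The output distribution. -/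
noncomputable def NonuniformPPT.run (A : NonuniformPPT) (lam : ℕ) (x : Data) : PMF Data :=
  (coinFlips (A.coins lam)).map (A.runWith lam x)

/-! ## Vector commitments -/

/-- The algorithms of a vector commitment scheme, for vectors of natural numbers
(binary strings). -/
structure VectorCommitment where
  keyGen : PPT
  commit : PolyTime
  opening : PPT
  verify : PPT

namespace VectorCommitment

variable (VC : VectorCommitment)

/-- `KeyGen(1^λ, n)`. -/
noncomputable def KeyGen (lam n : ℕ) : PMF Data :=
  VC.keyGen.run (.pair (.unary lam) (.unary n))

/-- The commitment `c_v`, where `(c_v, aux) = Commit_pp(v)`. -/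
def Com (pp : Data) (v : List ℕ) : Data :=
  (VC.commit.code.eval (.pair pp (.ofVec v))).fst

/-- The auxiliary information `aux`, where `(c_v, aux) = Commit_pp(v)`. -/
def Aux (pp : Data) (v : List ℕ) : Data :=
  (VC.commit.code.eval (.pair pp (.ofVec v))).snd

/-- `Open_pp(a, i, aux)`. -/
noncomputable def Open (pp : Data) (a i : ℕ) (aux : Data) : PMF Data :=
  VC.opening.run (.pair pp (.pair (.nat a) (.pair (.nat i) aux)))

/-- `Verify_pp(c, a, i, pf)`; the answer `1` means that the verifier accepts. -/
noncomputable def Verify (pp c : Data) (a i : ℕ) (pf : Data) : PMF Data :=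
  VC.verify.run (.pair pp (.pair c (.pair (.nat a) (.pair (.nat i) pf))))

/-- Correctness for vectors of length `n = n(λ)`: with overwhelming probability over the
public parameters, every vector is such that the honest opening of each of its components is
accepted with overwhelming probability. -/
def Correct (n : ℕ → ℕ) : Prop :=
  ∃ ν : ℕ → ℝ, Negligible ν ∧ ∀ lam,
    1 - ν lam ≤ prob (do
      let pp ← VC.KeyGen lam (n lam)
      pure (∀ v : List ℕ, v.length = n lam → ∀ (i : ℕ) (hi : i < v.length),
        1 - ν lam ≤ prob (do
          let pf ← VC.Open pp v[i] i (VC.Aux pp v)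
          let b ← VC.Verify pp (VC.Com pp v) v[i] i pf
          pure (b = .nat 1))))

/-- Position binding for vectors of length `n = n(λ)`: no non-uniform p.p.t. adversary
produces `(c, i, a, a', pf, pf')` with `i < n`, `a ≠ a'` and both openings accepted, except
with negligible probability. -/
def PositionBinding (n : ℕ → ℕ) : Prop :=
  ∀ A : NonuniformPPT, Negligible (fun lam => prob (do
    let pp ← VC.KeyGen lam (n lam)
    let o ← A.run lam (.pair pp (.unary (n lam)))
    let c := o.fst
    let i := o.snd.fst.toNat
    let a := o.snd.snd.fst.toNat
    let a' := o.snd.snd.snd.fst.toNat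
    let pf := o.snd.snd.snd.snd.fst
    let pf' := o.snd.snd.snd.snd.snd
    let b ← VC.Verify pp c a i pf
    let b' ← VC.Verify pp c a' i pf'
    pure (i < n lam ∧ a ≠ a' ∧ b = .nat 1 ∧ b' = .nat 1)))

/-- Commitments and opening proofs have at most `K * λ` bits. -/
def LinearSize (K : ℕ) : Prop :=
  ∀ lam n : ℕ, 1 ≤ lam → 1 ≤ n → ∀ pp ∈ (VC.KeyGen lam n).support,
    ∀ v : List ℕ, v.length = n →
      (VC.Com pp v).size ≤ K * lam ∧
      ∀ (i : ℕ) (hi : i < v.length), ∀ pf ∈ (VC.Open pp v[i] i (VC.Aux pp v)).support,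
        pf.size ≤ K * lam

end VectorCommitment

/-! ## Bandits and smooth policies -/

/-- An `n`-arm bandit: a probability distribution on `[0, 1]` for each arm. -/
abbrev Bandit (n : ℕ) : Type := Fin n → MeasureTheory.ProbabilityMeasure unitInterval

/-- The expected utilities vector. -/
noncomputable def Bandit.utility {n : ℕ} (q : Bandit n) (i : Fin n) : ℝ :=
  ∫ x, (x : ℝ) ∂(q i : MeasureTheory.Measure unitInterval)

/-- `π` is a `σ`-smooth strategy. -/
def IsSmooth {n : ℕ} (σ : ℝ) (π : Fin n → ℝ) : Prop :=
  (∀ i, 0 ≤ π i) ∧ ∑ i, π i = 1 ∧ ∀ i, π i ≤ σ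

/-- `π` is an optimal `σ`-smooth strategy for the expected utilities `u`. -/
def IsOptimalSmooth {n : ℕ} (σ : ℝ) (u π : Fin n → ℝ) : Prop :=
  IsSmooth σ π ∧ ∀ π', IsSmooth σ π' → π' ⬝ᵥ u ≤ π ⬝ᵥ u

/-- `t` is within `ε` of the value of an optimal `σ`-smooth strategy for `u`. -/
def WithinOfOptimal {n : ℕ} (σ ε : ℝ) (u : Fin n → ℝ) (t : ℝ) : Prop :=
  ∃ π, IsOptimalSmooth σ u π ∧ |t - π ⬝ᵥ u| ≤ ε

/-- The first `k` binary digits after the point of a nonnegative real, as an integer. -/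
noncomputable def digits (k : ℕ) (x : ℝ) : ℕ := ⌊x * 2 ^ k⌋₊

theorem measurable_digits (k : ℕ) : Measurable (fun x : unitInterval => digits k (x : ℝ)) :=
  Nat.measurable_floor.comp (measurable_subtype_coe.mul_const _)

/-- One pull of arm `i`, the reward being read to `k` binary digits. -/
noncomputable def Bandit.pull {n : ℕ} (q : Bandit n) (k : ℕ) (i : Fin n) : PMF ℕ :=
  MeasureTheory.Measure.toPMF
    (((q i).map (measurable_digits k).aemeasurable : MeasureTheory.ProbabilityMeasure ℕ) :
      MeasureTheory.Measure ℕ)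

/-- Independent pulls of a list of arms. -/
noncomputable def Bandit.pulls {n : ℕ} (q : Bandit n) (k : ℕ) : List (Fin n) → PMF (List ℕ)
  | [] => pure []
  | i :: l => do
    let x ← q.pull k i
    let xs ← q.pulls k l
    pure (x :: xs)

/-! ## Succinct non-interactive arguments of knowledge -/

/-- The description of the relation with commitment parameters `pp`, vector length `n`,
smoothness `s` and `ell` fractional digits. -/
def relCode (pp : Data) (n : ℕ) (s : ℚ) (ell : ℕ) : Data :=
  .pair pp (.pair (.unary n)
    (.pair (.pair (.nat s.num.toNat) (.nat s.den)) (.unary ell)))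

/-- The relation of the statements `(c, t)` and witnesses `v` such that `v` is a vector in
`[0, 1]^n`, `c` is the commitment to `v`, and `t` is the value of an optimal `s`-smooth policy
for `v`. Numbers are in fixed-point notation: the components of `v` in units of `2^{-ell}`, and
`t` in units of `2^{-ell} / s.den`, of which the optimal value is always a multiple. -/
def Rel (VC : VectorCommitment) (pp : Data) (n : ℕ) (s : ℚ) (ell : ℕ) (φ w : Data) : Prop :=
  ∃ (v : Fin n → ℕ) (T : ℕ) (π : Fin n → ℝ),
    w = .ofVec (List.ofFn v) ∧
    φ = .pair (VC.Com pp (List.ofFn v)) (.nat T) ∧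
    (∀ i, (v i : ℝ) / 2 ^ ell ∈ Set.Icc (0 : ℝ) 1) ∧
    IsOptimalSmooth (s : ℝ) (fun i => (v i : ℝ) / 2 ^ ell) π ∧
    π ⬝ᵥ (fun i => (v i : ℝ) / 2 ^ ell) = (T : ℝ) / ((s.den : ℝ) * 2 ^ ell)

/-- The algorithms of a succinct non-interactive argument. -/
structure Snark where
  setup : PPT
  prove : PPT
  verify : PPT

namespace Snark

variable (SN : Snark) (VC : VectorCommitment)

/-- `Setup(1^λ, R)`, whose output is a pair of public parameters and a trapdoor. -/
noncomputable def Setup (lam : ℕ) (R : Data) : PMF Data :=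
  SN.setup.run (.pair (.unary lam) R)

/-- `Prove(R, crs, φ, w)`. -/
noncomputable def Prove (R crs φ w : Data) : PMF Data :=
  SN.prove.run (.pair R (.pair crs (.pair φ w)))

/-- `Verify(R, crs, φ, pf)`; the answer `1` means that the verifier accepts. -/
noncomputable def Verify (R crs φ pf : Data) : PMF Data :=
  SN.verify.run (.pair R (.pair crs (.pair φ pf)))

/-- Perfect completeness for the relations `Rel VC pp n s ell`. -/
def PerfectlyComplete : Prop :=
  ∀ (lam n : ℕ) (s : ℚ) (ell : ℕ), 1 ≤ n → 1 / (n : ℚ) ≤ s → s ≤ 1 →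
    ∀ pp ∈ (VC.KeyGen lam n).support, ∀ φ w, Rel VC pp n s ell φ w →
      prob (do
        let o ← SN.Setup lam (relCode pp n s ell)
        let pf ← SN.Prove (relCode pp n s ell) o.fst φ w
        let b ← SN.Verify (relCode pp n s ell) o.fst φ pf
        pure (b = .nat 1)) = 1

/-- Computational knowledge soundness for the relation generator that draws the commitment
parameters for vectors of length `n = n(λ)`, for all smoothness parameters and numbers of
digits of polynomial length: every non-uniform p.p.t. adversary has a non-uniform p.p.t.
extractor that, given the input and the coins of the adversary, finds a witness whenever the
adversary outputs an accepted statement and proof, except with negligible probability. -/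
def KnowledgeSound (n : ℕ → ℕ) : Prop :=
  ∀ (s : ℕ → ℚ) (ell : ℕ → ℕ),
    (∀ lam, 1 / (n lam : ℚ) ≤ s lam ∧ s lam ≤ 1) →
    PolyBounded (fun lam => (s lam).den.size) → PolyBounded ell →
    ∀ A : NonuniformPPT, ∃ X : NonuniformPPT, Negligible (fun lam => prob (do
      let pp ← VC.KeyGen lam (n lam)
      let R := relCode pp (n lam) (s lam) (ell lam)
      let o ← SN.Setup lam R
      let r ← coinFlips (A.coins lam)
      let φ := (A.runWith lam (.pair R o.fst) r).fst
      let pf := (A.runWith lam (.pair R o.fst) r).snd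
      let w ← X.run lam (.pair (.pair R o.fst) (.nat r))
      let b ← SN.Verify R o.fst φ pf
      pure (b = .nat 1 ∧ ¬ Rel VC pp (n lam) (s lam) (ell lam) φ w)))

/-- Proofs have at most `K * λ` bits. -/
def LinearSize (K : ℕ) : Prop :=
  ∀ (lam n : ℕ) (s : ℚ) (ell : ℕ), 1 ≤ lam → 1 ≤ n → 1 / (n : ℚ) ≤ s → s ≤ 1 →
    ∀ pp ∈ (VC.KeyGen lam n).support, ∀ o ∈ (SN.Setup lam (relCode pp n s ell)).support,
    ∀ φ w, Rel VC pp n s ell φ w →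
    ∀ pf ∈ (SN.Prove (relCode pp n s ell) o.fst φ w).support, pf.size ≤ K * lam

end Snark

/-! ## Protocols -/

/-- The precision, in binary digits, to which the honest parties read real numbers. -/
noncomputable def precision (lam n : ℕ) (ε : ℝ) : ℕ := lam + n + ⌈1 / ε⌉₊

/-- The common input `(1^λ, n, ε, σ)` of the honest parties and of the setup. -/
noncomputable def params (lam n : ℕ) (ε σ : ℝ) : Data :=
  .pair (.unary lam) (.pair (.unary n) (.pair (.unary ⌈1 / ε⌉₊)
    (.pair (.nat (digits (precision lam n ε) ε)) (.nat (digits (precision lam n ε) σ)))))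

/-- A protocol with trusted setup and three moves (prover, verifier, prover), in which each
party first makes non-adaptive queries to the bandit oracle. Each move is a program that is
applied to all that the party has seen so far. -/
structure Protocol where
  setup : PPT
  proverCoins : Polynomial ℕ
  proverQuery : Code
  proverFirst : Code
  proverSecond : Code
  verifierCoins : Polynomial ℕ
  verifierQuery : Code
  verifierChallenge : Code
  verifierOutput : Code

/-- The list of arms that an object describes. -/
def armsOf (n : ℕ) (x : Data) : List (Fin n) :=
  x.toList.filterMap (fun d => if h : d.toNat < n then some ⟨d.toNat, h⟩ else none)

/-- A prover strategy as the verifier meets it: given the output of the setup, a random first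
message together with the answer to each challenge. -/
abbrev Strategy : Type := Data → PMF (Data × (Data → Data))

namespace Protocol

variable (P : Protocol) (lam n : ℕ) (ε σ : ℝ)

noncomputable def proverCoinCount : ℕ := P.proverCoins.eval (params lam n ε σ).size

noncomputable def verifierCoinCount : ℕ := P.verifierCoins.eval (params lam n ε σ).size

/-- The output distribution of the trusted setup. -/
noncomputable def crs : PMF Data := P.setup.run (params lam n ε σ)

/-- The arms that the honest prover pulls when its coins are `r`. -/
noncomputable def proverArms (r : ℕ) : List (Fin n) :=
  armsOf n (P.proverQuery.eval (.pair (params lam n ε σ) (.nat r)))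

/-- The arms that the verifier pulls when its coins are `r`. -/
noncomputable def verifierArms (r : ℕ) : List (Fin n) :=
  armsOf n (P.verifierQuery.eval (.pair (params lam n ε σ) (.nat r)))

/-- What a party has seen before the first message: its coins, the output of the setup, and
the rewards `xs`. -/
noncomputable def view (crs : Data) (xs : List ℕ) (r : ℕ) : Data :=
  .pair (.pair (params lam n ε σ) (.nat r)) (.pair crs (.ofVec xs))

noncomputable def firstMessage (crs : Data) (xs : List ℕ) (r : ℕ) : Data :=
  P.proverFirst.eval (view lam n ε σ crs xs r)

noncomputable def challenge (crs : Data) (ys : List ℕ) (r : ℕ) (m₁ : Data) : Data :=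
  P.verifierChallenge.eval (.pair (view lam n ε σ crs ys r) m₁)

noncomputable def secondMessage (crs : Data) (xs : List ℕ) (r : ℕ) (m₂ : Data) : Data :=
  P.proverSecond.eval (.pair (view lam n ε σ crs xs r) m₂)

noncomputable def output (crs : Data) (ys : List ℕ) (r : ℕ) (m₁ m₃ : Data) : Data :=
  P.verifierOutput.eval (.pair (view lam n ε σ crs ys r) (.pair m₁ m₃))

/-- The output of the verifier after an interaction with a given prover strategy. The verifier
outputs the value `t` if the result denotes `t`, and it rejects if the result denotes no
number. -/
noncomputable def interact (q : Bandit n) (S : Strategy) : PMF Data := do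
  let crs ← P.crs lam n ε σ
  let m ← S crs
  let r ← coinFlips (P.verifierCoinCount lam n ε σ)
  let ys ← q.pulls (precision lam n ε) (P.verifierArms lam n ε σ r)
  pure (P.output lam n ε σ crs ys r m.1 (m.2 (P.challenge lam n ε σ crs ys r m.1)))

/-- The honest prover. -/
noncomputable def honest (q : Bandit n) : Strategy := fun crs => do
  let r ← coinFlips (P.proverCoinCount lam n ε σ)
  let xs ← q.pulls (precision lam n ε) (P.proverArms lam n ε σ r)
  pure (P.firstMessage lam n ε σ crs xs r, P.secondMessage lam n ε σ crs xs r)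

/-- The steps of the honest prover when it is sent `m₂`. -/
noncomputable def proverTime (crs : Data) (xs : List ℕ) (r : ℕ) (m₂ : Data) : ℕ :=
  P.proverQuery.cost (.pair (params lam n ε σ) (.nat r)) +
  P.proverFirst.cost (view lam n ε σ crs xs r) +
  P.proverSecond.cost (.pair (view lam n ε σ crs xs r) m₂)

/-- The steps of the verifier when it is sent `m₁` and `m₃`. -/
noncomputable def verifierTime (crs : Data) (ys : List ℕ) (r : ℕ) (m₁ m₃ : Data) : ℕ :=
  P.verifierQuery.cost (.pair (params lam n ε σ) (.nat r)) +
  P.verifierChallenge.cost (.pair (view lam n ε σ crs ys r) m₁) +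
  P.verifierOutput.cost (.pair (view lam n ε σ crs ys r) (.pair m₁ m₃))

end Protocol

/-- The random choices in an execution of a protocol: the output of the setup, the coins and
the rewards of the prover, and the coins and the rewards of the verifier. -/
structure Execution (P : Protocol) (lam n : ℕ) (ε σ : ℝ) where
  crs : Data
  crs_mem : crs ∈ (P.crs lam n ε σ).support
  proverCoins : ℕ
  proverCoins_lt : proverCoins < 2 ^ P.proverCoinCount lam n ε σ
  proverRewards : List ℕ
  proverRewards_length : proverRewards.length = (P.proverArms lam n ε σ proverCoins).length
  proverRewards_le : ∀ x ∈ proverRewards, x ≤ 2 ^ precision lam n ε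
  verifierCoins : ℕ
  verifierCoins_lt : verifierCoins < 2 ^ P.verifierCoinCount lam n ε σ
  verifierRewards : List ℕ
  verifierRewards_length :
    verifierRewards.length = (P.verifierArms lam n ε σ verifierCoins).length
  verifierRewards_le : ∀ x ∈ verifierRewards, x ≤ 2 ^ precision lam n ε

namespace Execution

variable {P : Protocol} {lam n : ℕ} {ε σ : ℝ} (e : Execution P lam n ε σ)

/-- The three messages between the honest parties. -/
noncomputable def m₁ : Data := P.firstMessage lam n ε σ e.crs e.proverRewards e.proverCoins

noncomputable def m₂ : Data :=
  P.challenge lam n ε σ e.crs e.verifierRewards e.verifierCoins e.m₁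

noncomputable def m₃ : Data :=
  P.secondMessage lam n ε σ e.crs e.proverRewards e.proverCoins e.m₂

/-- The number of bits sent between the honest parties. -/
noncomputable def communication : ℕ := e.m₁.size + e.m₂.size + e.m₃.size

/-- The number of oracle queries of the honest prover. -/
noncomputable def proverQueries : ℕ := (P.proverArms lam n ε σ e.proverCoins).length

/-- The number of oracle queries of the verifier. -/
noncomputable def verifierQueries : ℕ := (P.verifierArms lam n ε σ e.verifierCoins).length

/-- The number of steps of the honest prover against the honest verifier. -/
noncomputable def proverTime : ℕ :=
  P.proverTime lam n ε σ e.crs e.proverRewards e.proverCoins e.m₂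

/-- The number of steps of the verifier against a prover that sends `a₁` and `a₃`. -/
noncomputable def verifierTime (a₁ a₃ : Data) : ℕ :=
  P.verifierTime lam n ε σ e.crs e.verifierRewards e.verifierCoins a₁ a₃

end Execution

/-- A malicious prover: a non-uniform p.p.t. algorithm whose advice may depend on everything but
the random choices, with access to the bandit oracle. The oracle is provided as a table of
`pulls λ` independent rewards of every arm, to `prec λ` binary digits; a prover that makes at most
`pulls λ` adaptive queries reads its answers from the table. -/
structure CheatingProver where
  first : Code
  second : Code
  advice : ℕ → Data
  coins : ℕ → ℕ
  pulls : ℕ → ℕ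
  prec : ℕ → ℕ
  bound : Polynomial ℕ
  advice_le : ∀ lam, (advice lam).size ≤ bound.eval lam
  coins_le : ∀ lam, coins lam ≤ bound.eval lam
  pulls_le : ∀ lam, pulls lam ≤ bound.eval lam
  prec_le : ∀ lam, prec lam ≤ bound.eval lam
  first_le : ∀ x, first.cost x ≤ bound.eval x.size
  second_le : ∀ x, second.cost x ≤ bound.eval x.size

namespace CheatingProver

/-- What the malicious prover has seen before its first message. -/
def view (A : CheatingProver) (lam : ℕ) (crs : Data) (xs : List ℕ) (r : ℕ) : Data :=
  .pair (.pair (.unary lam) (.pair (A.advice lam) (.nat r))) (.pair crs (.ofVec xs))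

/-- The strategy of the malicious prover. -/
noncomputable def strategy (A : CheatingProver) (lam : ℕ) {n : ℕ} (q : Bandit n) :
    Strategy := fun crs => do
  let r ← coinFlips (A.coins lam)
  let xs ← q.pulls (A.prec lam) ((List.finRange n).flatMap (List.replicate (A.pulls lam)))
  pure (A.first.eval (A.view lam crs xs r),
    fun m₂ => A.second.eval (.pair (A.view lam crs xs r) m₂))

end CheatingProver

end SmoothBandit

open SmoothBandit

/-! The honest prover estimates every mean to within a small multiple of `ε`, commits to the rounded
vector `v`, and proves that `t` is the optimal smooth value of the committed vector. The verifier
opens random positions and compares them with its own pulls. Two things have to be shown: few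
openings suffice, and they all concern one fixed vector, although the prover answers after seeing
the challenge.

Few openings. Let `E = ⌈1 / ε⌉₊`, let `s` be `σ` rounded to a fraction, let `g` be `scale`, slightly
more than `4 * s * n`, and let `G = 4 * E * g` be the number of rounds. If the value of `v` is off
by more than `ε`, comparing optimal policies (`IsOptimalSmooth.exists_abs_sub_le`) gives an
`s`-smooth `w` with `∑ i, w i * |v i - u i| > 3 / (4 * E)`; a quarter of the error budget is
reserved for rounding `σ`. Round `j` has the tolerance `tol j = (j + 1 + g) / G`, so an error of
size `D` is visible in at least `G * D - g - 1` rounds. Averaging this count with `w`, and using `w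
i ≤ s`, yields at least `4 * n` pairs of a round and a position that reveal an error
(`le_sum_card`). A random position hits each arm with probability at least `1 / (2 * n)`, so at
least two hits are expected, and all are missed with probability at most `exp (-2) < 1 / 6`
(`ex_forall_lt_tol_le`). The growing tolerances pay off in the number of pulls: round `j` needs of
the order of `log G / tol j ^ 2` of them, and the sum telescopes to the order of `E ^ 2 * g * log
G`. By Hoeffding's inequality all rounds are accurate except with probability `1 / 12`. A fixed
wrong vector thus survives with probability at most `1 / 4` (`ex_not_far_le`), and the gap to `1 /
3` is slack.

One fixed vector. The extractor is run on the statement and proof in the first message, so its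
vector does not depend on the positions. If a wrong value is accepted, then the extracted vector is
no witness (negligible by knowledge soundness), or some accepted opening differs from it, or it
survives all comparisons (at most `1 / 4`); see `Implements.ex_cheat_le`. In the second case the
wrong opening and an honest opening of the extracted vector break position binding; correctness of
the commitment makes the honest one accepted. No rewinding is needed, and averaging fixes all coins
of the adversaries, which become deterministic with advice.

Completeness. The estimates are accurate except with probability `1 / 6` and the rounds of the
verifier except with probability `1 / 12`; what remains are rejected honest openings, of negligible
probability by correctness (`Implements.ex_honest_le`).

Efficiency. By linear programming duality the optimal value is the minimum over the thresholds `θ =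
v j` of `θ + s * ∑ i, max (v i - θ) 0`, which integer arithmetic evaluates exactly. The predicate
`IsPoly` is closed under composition and bounded loops, so that `fun_prop` turns every algorithm
into a program with a polynomial clock. A polynomial `Q` bounds the coins of every subroutine on
honest messages, and each use of a subroutine gets its own block of `Q` coins. -/

namespace SmoothBandit

/-! ## Polynomial domination -/

/-- `f` is bounded by a polynomial in `g`. -/
def PolyDom {ι : Type*} (f g : ι → ℕ) : Prop :=
  ∃ p : Polynomial ℕ, ∀ i, f i ≤ p.eval (g i)

theorem eval_mono_nat (p : Polynomial ℕ) {a b : ℕ} (h : a ≤ b) : p.eval a ≤ p.eval b := by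
  induction p using Polynomial.induction_on' with
  | add p q hp hq => simpa using add_le_add hp hq
  | monomial n c => simpa using Nat.mul_le_mul_left c (Nat.pow_le_pow_left h n)

namespace PolyDom

variable {ι : Type*} {f g h f₁ f₂ : ι → ℕ}

theorem refl (f : ι → ℕ) : PolyDom f f := ⟨Polynomial.X, by simp⟩

theorem const (c : ℕ) (g : ι → ℕ) : PolyDom (fun _ => c) g := ⟨Polynomial.C c, by simp⟩

theorem mono (hf : PolyDom f₁ g) (h : ∀ i, f i ≤ f₁ i) : PolyDom f g :=
  let ⟨p, hp⟩ := hf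
  ⟨p, fun i => (h i).trans (hp i)⟩

theorem of_le (h : ∀ i, f i ≤ g i) : PolyDom f g := (refl g).mono h

theorem add (h₁ : PolyDom f₁ g) (h₂ : PolyDom f₂ g) : PolyDom (fun i => f₁ i + f₂ i) g :=
  let ⟨p, hp⟩ := h₁
  let ⟨q, hq⟩ := h₂
  ⟨p + q, fun i => by simpa using add_le_add (hp i) (hq i)⟩

theorem mul (h₁ : PolyDom f₁ g) (h₂ : PolyDom f₂ g) : PolyDom (fun i => f₁ i * f₂ i) g :=
  let ⟨p, hp⟩ := h₁
  let ⟨q, hq⟩ := h₂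
  ⟨p * q, fun i => by simpa using Nat.mul_le_mul (hp i) (hq i)⟩

theorem eval (hf : PolyDom f g) (q : Polynomial ℕ) : PolyDom (fun i => q.eval (f i)) g :=
  let ⟨p, hp⟩ := hf
  ⟨q.comp p, fun i => by simpa [Polynomial.eval_comp] using eval_mono_nat q (hp i)⟩

theorem trans (h₁ : PolyDom f g) (h₂ : PolyDom g h) : PolyDom f h :=
  let ⟨p, hp⟩ := h₁
  (h₂.eval p).mono hp

theorem comp {κ : Type*} (hf : PolyDom f g) (φ : κ → ι) :
    PolyDom (fun k => f (φ k)) (fun k => g (φ k)) :=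
  let ⟨p, hp⟩ := hf
  ⟨p, fun k => hp (φ k)⟩

end PolyDom

/-! ## Sizes -/

namespace Data

theorem size_nat (a : ℕ) : (nat a).size = 2 * Nat.size a + 2 := by
  have : ∀ l : List Bool, (l.flatMap (fun b => [true, b])).length = 2 * l.length := by
    intro l
    induction l with
    | nil => rfl
    | cons b l ih => simp [List.flatMap_cons, ih]; ring
  simp only [size, bits, List.length_cons, List.length_append, List.length_nil, this]
  rw [Nat.size_eq_bits_len]

theorem size_pair (x y : Data) : (pair x y).size = 1 + x.size + y.size := by
  simp [size, bits]; ring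

theorem two_le_size (x : Data) : 2 ≤ x.size := by
  cases x with
  | nat a => rw [size_nat]; omega
  | pair x y =>
    rw [size_pair]
    have : 1 ≤ x.size := by cases x <;> simp [size, bits]
    omega

theorem size_fst_le (x : Data) : x.fst.size ≤ x.size := by
  cases x with
  | nat a => simp only [fst, size_nat, Nat.size_zero]; omega
  | pair x y => simp only [fst, size_pair]; omega

theorem size_snd_le (x : Data) : x.snd.size ≤ x.size := by
  cases x with
  | nat a => simp only [snd, size_nat, Nat.size_zero]; omega
  | pair x y => simp only [snd, size_pair]; omega

theorem size_toNat_le (x : Data) : (nat x.toNat).size ≤ x.size := by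
  cases x with
  | nat a => exact le_rfl
  | pair x y =>
    have := two_le_size (pair x y)
    simpa [toNat, size_nat] using this

theorem size_ofList (l : List Data) : (ofList l).size = 2 + (l.map (fun d => 1 + d.size)).sum := by
  induction l with
  | nil => simp [ofList, size_nat]
  | cons d l ih => simp only [ofList, size_pair, ih, List.map_cons, List.sum_cons]; ring

theorem length_le_size_ofList (l : List Data) : l.length ≤ (ofList l).size := by
  rw [size_ofList]
  have : l.length ≤ (l.map (fun d => 1 + d.size)).sum := by
    induction l with
    | nil => simp
    | cons d l ih => simp only [List.map_cons, List.sum_cons, List.length_cons]; omega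
  omega

theorem size_unary (m : ℕ) : (unary m).size = 3 * m + 2 := by
  simp [unary, size_ofList, size_nat]; ring

theorem size_ofList_le {l : List Data} {B : ℕ} (h : ∀ d ∈ l, d.size ≤ B) :
    (ofList l).size ≤ 2 + l.length * (1 + B) := by
  rw [size_ofList]
  refine Nat.add_le_add_left ?_ 2
  have := List.sum_le_card_nsmul (l.map (fun d => 1 + d.size)) (1 + B) (by
    intro a ha
    obtain ⟨d, hd, rfl⟩ := List.mem_map.1 ha
    exact Nat.add_le_add_left (h d hd) 1)
  simpa using this

theorem toList_ofList (l : List Data) : (ofList l).toList = l := by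
  induction l with
  | nil => rfl
  | cons d l ih => simp [ofList, toList, ih]

end Data

theorem natSize_add_le (a b : ℕ) : Nat.size (a + b) ≤ max (Nat.size a) (Nat.size b) + 1 := by
  rw [Nat.size_le, pow_succ]
  have h1 : a < 2 ^ max (Nat.size a) (Nat.size b) := Nat.size_le.1 (le_max_left _ _)
  have h2 : b < 2 ^ max (Nat.size a) (Nat.size b) := Nat.size_le.1 (le_max_right _ _)
  omega

theorem natSize_mul_le (a b : ℕ) : Nat.size (a * b) ≤ Nat.size a + Nat.size b := by
  rw [Nat.size_le, pow_add]
  exact Nat.mul_lt_mul'' (Nat.lt_size_self a) (Nat.lt_size_self b)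

theorem natSize_le_self (a : ℕ) : Nat.size a ≤ a := Nat.size_le.2 Nat.lt_two_pow_self

/-- Every instruction pays for what it writes. A time bound therefore is a bound on the output too,
which makes polynomial time closed under composition. -/
theorem Code.size_eval_le (c : Code) (x : Data) : (c.eval x).size ≤ c.cost x := by
  induction c generalizing x with
  | pair f g hf hg =>
    simp only [Code.eval, Code.cost, Data.size_pair]
    have := hf x; have := hg x; omega
  | comp g f hg hf =>
    simp only [Code.eval, Code.cost]
    have := hg (f.eval x); omega
  | ite c f g hc hf hg =>
    simp only [Code.eval, Code.cost]
    split
    · have := hg x; omega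
    · have := hf x; omega
  | iter f hf =>
    simp only [Code.eval, Code.cost]
    -- Without iterations the output is a part of the input, which is paid for; otherwise it is the
    -- output of the last iteration, whose cost is the last summand.
    rcases Nat.eq_zero_or_pos x.fst.toNat with h | h
    · rw [h]; have := Data.size_snd_le x
      simp only [Function.iterate_zero, _root_.id]; omega
    · obtain ⟨k, hk⟩ := Nat.exists_eq_add_of_lt h
      simp only [zero_add] at hk
      rw [hk, Function.iterate_succ_apply', Finset.sum_range_succ]
      have := hf (f.eval^[k] x.snd); omega
  | _ => simp only [Code.cost]; omega

/-! ## Polynomial-time functions -/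

/-- Types whose elements are represented by objects. -/
class Enc (α : Type) where
  enc : α → Data

open Enc

instance : Enc Data := ⟨fun x => x⟩
instance : Enc ℕ := ⟨Data.nat⟩
instance {α β : Type} [Enc α] [Enc β] : Enc (α × β) := ⟨fun x => .pair (enc x.1) (enc x.2)⟩
instance {α : Type} [Enc α] : Enc (List α) := ⟨fun l => .ofList (l.map enc)⟩
instance {α : Type} [Enc α] {P : α → Prop} : Enc {x // P x} := ⟨fun x => enc x.1⟩

theorem enc_data (x : Data) : enc x = x := rfl
theorem enc_nat (x : ℕ) : enc x = Data.nat x := rfl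
theorem enc_prod {α β : Type} [Enc α] [Enc β] (x : α × β) :
    enc x = .pair (enc x.1) (enc x.2) := rfl

/-- The length of the representation. -/
def esize {α : Type} [Enc α] (x : α) : ℕ := (enc x).size

/-- The functions that a program computes in polynomial time. -/
@[fun_prop]
def IsPoly {α β : Type} [Enc α] [Enc β] (f : α → β) : Prop :=
  ∃ c : Code, (∀ x, c.eval (enc x) = enc (f x)) ∧ PolyDom (fun x : α => c.cost (enc x)) esize

namespace IsPoly

variable {α β γ δ : Type} [Enc α] [Enc β] [Enc γ] [Enc δ]

theorem polyDom_esize {f : α → β} (hf : IsPoly f) : PolyDom (fun x => esize (f x)) esize := by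
  obtain ⟨c, hc, hp⟩ := hf
  exact hp.mono fun x => by rw [esize, ← hc]; exact Code.size_eval_le _ _

@[fun_prop]
theorem id : IsPoly (fun x : α => x) :=
  ⟨.id, fun _ => rfl, (((PolyDom.const 1 _).add (.refl _)).add (.refl _)).mono fun _ => le_rfl⟩

@[fun_prop]
theorem const (b : β) : IsPoly (fun _ : α => b) :=
  ⟨.const (enc b), fun _ => rfl,
    (((PolyDom.const 1 _).add (.refl _)).add (.const (esize b) _)).mono fun _ => le_rfl⟩

-- The second program runs on `f x`, whose length is polynomial in that of `x` by `polyDom_esize`.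
@[fun_prop]
theorem comp {g : β → γ} {f : α → β} (hg : IsPoly g) (hf : IsPoly f) :
    IsPoly (fun x => g (f x)) := by
  obtain ⟨d, hd, hq⟩ := hg
  have hs := hf.polyDom_esize
  obtain ⟨c, hc, hp⟩ := hf
  refine ⟨.comp d c, fun x => by simp only [Code.eval, hc, hd], ?_⟩
  refine (((PolyDom.const 1 _).add hp).add ((hq.comp f).trans hs)).mono fun x => ?_
  simp only [Code.cost, hc]
  exact le_rfl

@[fun_prop]
theorem prodMk {f : α → β} {g : α → γ} (hf : IsPoly f) (hg : IsPoly g) :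
    IsPoly (fun x => (f x, g x)) := by
  obtain ⟨c, hc, hp⟩ := hf
  obtain ⟨d, hd, hq⟩ := hg
  refine ⟨.pair c d, fun x => by simp only [Code.eval, hc, hd, enc_prod], ?_⟩
  exact (((PolyDom.const 1 _).add hp).add hq).mono fun x => le_rfl

-- A pair of objects is represented by the object `Data.pair`, so the program for `prodMk` serves
-- unchanged.
@[fun_prop]
theorem data_pair {f g : α → Data} (hf : IsPoly f) (hg : IsPoly g) :
    IsPoly (fun x => Data.pair (f x) (g x)) :=
  let ⟨c, h⟩ := prodMk hf hg
  ⟨c, h⟩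

/-- A single instruction whose output is polynomially bounded. -/
theorem of_basic {f : α → β} (c : Code)
    (hcost : ∀ x : α, c.cost (enc x) = 1 + (enc x).size + (c.eval (enc x)).size)
    (heval : ∀ x, c.eval (enc x) = enc (f x)) (hs : PolyDom (fun x => esize (f x)) esize) :
    IsPoly f :=
  ⟨c, heval, (((PolyDom.const 1 _).add (.refl _)).add hs).mono fun x => by
    rw [hcost, heval]; exact le_rfl⟩

theorem fst' : IsPoly (Prod.fst : α × β → α) :=
  of_basic .fst (fun _ => rfl) (fun _ => rfl) (.of_le fun x => Data.size_fst_le (enc x))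

theorem snd' : IsPoly (Prod.snd : α × β → β) :=
  of_basic .snd (fun _ => rfl) (fun _ => rfl) (.of_le fun x => Data.size_snd_le (enc x))

@[fun_prop]
theorem fst {f : α → β × γ} (hf : IsPoly f) : IsPoly (fun x => (f x).1) := comp fst' hf

@[fun_prop]
theorem snd {f : α → β × γ} (hf : IsPoly f) : IsPoly (fun x => (f x).2) := comp snd' hf

@[fun_prop]
theorem data_fst {f : α → Data} (hf : IsPoly f) : IsPoly (fun x => (f x).fst) :=
  comp (g := Data.fst)
    (of_basic .fst (fun _ => rfl) (fun _ => rfl) (.of_le fun x => Data.size_fst_le x)) hf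

@[fun_prop]
theorem data_snd {f : α → Data} (hf : IsPoly f) : IsPoly (fun x => (f x).snd) :=
  comp (g := Data.snd)
    (of_basic .snd (fun _ => rfl) (fun _ => rfl) (.of_le fun x => Data.size_snd_le x)) hf

@[fun_prop]
theorem data_nat {f : α → ℕ} (hf : IsPoly f) : IsPoly (fun x => Data.nat (f x)) :=
  let ⟨c, h⟩ := hf
  ⟨c, h⟩

@[fun_prop]
theorem data_size {f : α → Data} (hf : IsPoly f) : IsPoly (fun x => (f x).size) :=
  comp (g := Data.size) (of_basic .size (fun _ => rfl) (fun _ => rfl)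
    (((PolyDom.const 2 _).mul (.refl _)).add (.const 2 _) |>.mono fun x => by
      show (Data.nat _).size ≤ _
      rw [Data.size_nat]
      have := natSize_le_self x.size
      simp only [esize, enc_data]; omega)) hf

theorem add' : IsPoly (fun x : ℕ × ℕ => x.1 + x.2) :=
  of_basic .add (fun _ => rfl) (fun _ => rfl)
    ((PolyDom.refl _).add (.const 2 _) |>.mono fun x => by
      simp only [esize, enc_prod, enc_nat, Data.size_nat, Data.size_pair]
      have := natSize_add_le x.1 x.2
      omega)

theorem mul' : IsPoly (fun x : ℕ × ℕ => x.1 * x.2) :=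
  of_basic .mul (fun _ => rfl) (fun _ => rfl)
    ((PolyDom.refl _).mono fun x => by
      simp only [esize, enc_prod, enc_nat, Data.size_nat, Data.size_pair]
      have := natSize_mul_le x.1 x.2
      omega)

theorem sub' : IsPoly (fun x : ℕ × ℕ => x.1 - x.2) :=
  of_basic .sub (fun _ => rfl) (fun _ => rfl)
    ((PolyDom.refl _).mono fun x => by
      simp only [esize, enc_prod, enc_nat, Data.size_nat, Data.size_pair]
      have := Nat.size_le_size (Nat.sub_le x.1 x.2)
      omega)

theorem div' : IsPoly (fun x : ℕ × ℕ => x.1 / x.2) :=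
  of_basic .div (fun _ => rfl) (fun _ => rfl)
    ((PolyDom.refl _).mono fun x => by
      simp only [esize, enc_prod, enc_nat, Data.size_nat, Data.size_pair]
      have := Nat.size_le_size (Nat.div_le_self x.1 x.2)
      omega)

variable {f g : α → ℕ}

@[fun_prop]
theorem add (hf : IsPoly f) (hg : IsPoly g) : IsPoly (fun x => f x + g x) :=
  comp add' (prodMk hf hg)

@[fun_prop]
theorem mul (hf : IsPoly f) (hg : IsPoly g) : IsPoly (fun x => f x * g x) :=
  comp mul' (prodMk hf hg)

@[fun_prop]
theorem sub (hf : IsPoly f) (hg : IsPoly g) : IsPoly (fun x => f x - g x) :=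
  comp sub' (prodMk hf hg)

@[fun_prop]
theorem div (hf : IsPoly f) (hg : IsPoly g) : IsPoly (fun x => f x / g x) :=
  comp div' (prodMk hf hg)

theorem mod (hf : IsPoly f) (hg : IsPoly g) : IsPoly (fun x => f x % g x) := by
  have : (fun x => f x % g x) = fun x => f x - g x * (f x / g x) := by
    funext x; rw [Nat.mod_eq_sub_mul_div]
  rw [this]; fun_prop

theorem ite_ne_zero {c : α → ℕ} {a b : α → β} (hc : IsPoly c) (ha : IsPoly a) (hb : IsPoly b) :
    IsPoly (fun x => if c x = 0 then b x else a x) := by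
  obtain ⟨cc, hcc, hpc⟩ := hc
  obtain ⟨ca, hca, hpa⟩ := ha
  obtain ⟨cb, hcb, hpb⟩ := hb
  refine ⟨.ite cc ca cb, fun x => ?_,
    ((((PolyDom.const 1 _).add hpc).add hpa).add hpb).mono fun x => ?_⟩
  · simp only [Code.eval, hcc, hca, hcb, enc_nat, Data.nat.injEq]
    split <;> rfl
  · simp only [Code.cost, hcc]
    split <;> omega

theorem ite_lt {a b : α → β} (hf : IsPoly f) (hg : IsPoly g) (ha : IsPoly a) (hb : IsPoly b) :
    IsPoly (fun x => if f x < g x then a x else b x) := by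
  have : (fun x => if f x < g x then a x else b x)
      = fun x => if g x - f x = 0 then b x else a x := by
    funext x
    by_cases h : f x < g x
    · rw [if_pos h, if_neg (by omega)]
    · rw [if_neg h, if_pos (by omega)]
  rw [this]
  exact ite_ne_zero (hg.sub hf) ha hb

theorem ite_le {a b : α → β} (hf : IsPoly f) (hg : IsPoly g) (ha : IsPoly a) (hb : IsPoly b) :
    IsPoly (fun x => if f x ≤ g x then a x else b x) := by
  have : (fun x => if f x ≤ g x then a x else b x)
      = fun x => if f x - g x = 0 then a x else b x := by
    funext x
    by_cases h : f x ≤ g x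
    · rw [if_pos h, if_pos (by omega)]
    · rw [if_neg h, if_neg (by omega)]
  rw [this]
  exact ite_ne_zero (hf.sub hg) hb ha

theorem ite_data_eq {u v : α → Data} {a b : α → β} (hu : IsPoly u) (hv : IsPoly v)
    (ha : IsPoly a) (hb : IsPoly b) : IsPoly (fun x => if u x = v x then a x else b x) := by
  have he : IsPoly (fun z : Data × Data => if z.1 = z.2 then 1 else 0) :=
    of_basic .eq (fun _ => rfl) (fun z => rfl) ((PolyDom.const 4 _).mono fun z => by
      simp only [esize, enc_nat, Data.size_nat]
      split <;> simp)
  have := ite_ne_zero (comp he (prodMk hu hv)) ha hb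
  convert this using 2 with x
  by_cases h : u x = v x <;> simp [h]

theorem ite_eq {a b : α → β} (hf : IsPoly f) (hg : IsPoly g) (ha : IsPoly a) (hb : IsPoly b) :
    IsPoly (fun x => if f x = g x then a x else b x) := by
  have := ite_data_eq (data_nat hf) (data_nat hg) ha hb
  simpa using this

@[fun_prop]
theorem toNat {f : α → Data} (hf : IsPoly f) : IsPoly (fun x => (f x).toNat) := by
  have : IsPoly Data.toNat := by
    -- No instruction extracts the number in a leaf, but adding the leaf `0` does, because `add`
    -- reads its operands through `toNat`.
    have h1 : IsPoly (fun x : Data => (Data.pair x (.nat 0))) := by fun_prop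
    have h2 : IsPoly (fun z : Data => z.fst.toNat + z.snd.toNat) :=
      of_basic .add (fun _ => rfl) (fun _ => rfl)
        (((PolyDom.refl _).add (.const 2 _)).mono fun x => by
          simp only [esize, enc_nat, enc_data]
          have ha := Data.size_toNat_le x.fst
          have hb := Data.size_toNat_le x.snd
          have hc := Data.size_fst_le x
          have hd := Data.size_snd_le x
          have := natSize_add_le x.fst.toNat x.snd.toNat
          rw [Data.size_nat] at *
          omega)
    have := comp h2 h1
    simpa [Data.fst, Data.snd, show (Data.nat 0).toNat = 0 from rfl] using this
  exact comp this hf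

@[fun_prop]
theorem max (hf : IsPoly f) (hg : IsPoly g) : IsPoly (fun x => max (f x) (g x)) := by
  simpa [max_def] using ite_le hf hg hg hf

@[fun_prop]
theorem min (hf : IsPoly f) (hg : IsPoly g) : IsPoly (fun x => min (f x) (g x)) := by
  simpa [min_def] using ite_le hf hg hf hg

@[fun_prop]
theorem poly_eval (p : Polynomial ℕ) (hf : IsPoly f) : IsPoly (fun x => p.eval (f x)) := by
  induction p using Polynomial.induction_on with
  | C a => simpa using const a
  | add p q hp hq => simpa using hp.add hq
  | monomial n a h =>
    have := h.mul hf
    simpa [pow_succ, mul_assoc] using this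

/-! ### Bounded loops -/

/-- Polynomial time of `K` and `step` is not enough: a number in binary can be exponentially large,
and iteration can let the state explode. Hence the two extra bounds, on the value of `K` and on the
length of all intermediate states. -/
theorem iterate {step : β → β} {K : α → ℕ} {s : α → β} (hstep : IsPoly step) (hK : IsPoly K)
    (hKd : PolyDom K esize) (hs : IsPoly s)
    (hq : ∃ q : Polynomial ℕ, ∀ x, ∀ j ≤ K x, esize (step^[j] (s x)) ≤ q.eval (esize x)) :
    IsPoly (fun x => step^[K x] (s x)) := by
  obtain ⟨q, hq⟩ := hq
  have hKs := hK.polyDom_esize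
  have hss := hs.polyDom_esize
  obtain ⟨cf, hcf, pf, hpf⟩ := hstep
  obtain ⟨cK, hcK, hpK⟩ := hK
  obtain ⟨cs, hcs, hps⟩ := hs
  have hiter : ∀ j y, (cf.eval)^[j] (enc y) = enc (step^[j] y) := by
    intro j
    induction j with
    | zero => intro y; rfl
    | succ j ih => intro y; rw [Function.iterate_succ_apply, Function.iterate_succ_apply, hcf, ih]
  refine ⟨.comp (.iter cf) (.pair cK cs), fun x => ?_, ?_⟩
  · simp only [Code.eval, hcK, hcs, Data.fst, Data.snd, enc_nat, Data.toNat, hiter]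
  · have hd : PolyDom (fun x : α => (pf.comp q).eval (esize x)) esize := ⟨pf.comp q, fun _ => le_rfl⟩
    refine (((((PolyDom.const 4 _).add hpK).add hps).add (hKs.add hss)).add (hKd.mul hd)).mono
      fun x => ?_
    simp only [Code.cost, Code.eval, hcK, hcs, Data.fst, Data.snd, enc_nat, Data.toNat, hiter,
      Data.size_pair, esize]
    have : ∑ j ∈ Finset.range (K x), cf.cost (enc (step^[j] (s x)))
        ≤ K x * (pf.comp q).eval (enc x).size := by
      refine (Finset.sum_le_card_nsmul _ _ ((pf.comp q).eval (enc x).size) fun j hj => ?_).trans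
        (by simp)
      refine (hpf _).trans ?_
      rw [Polynomial.eval_comp]
      exact eval_mono_nat _ (hq x j (Finset.mem_range.1 hj).le)
    omega

end IsPoly

/-- The state after `j` rounds of a loop. -/
def loop {β : Type*} (F : ℕ → β → β) (s : β) : ℕ → β
  | 0 => s
  | j + 1 => F j (loop F s j)

namespace IsPoly

variable {α β γ δ : Type} [Enc α] [Enc β] [Enc γ] [Enc δ]

/-- This is `iterate` for a state that carries the input and the round counter along. -/
theorem loop {F : α → ℕ → β → β} {K : α → ℕ} {s : α → β}
    (hF : IsPoly (fun z : (α × ℕ) × β => F z.1.1 z.1.2 z.2)) (hK : IsPoly K)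
    (hKd : PolyDom K esize) (hs : IsPoly s)
    (hq : ∃ q : Polynomial ℕ, ∀ x, ∀ j ≤ K x, esize (loop (F x) (s x) j) ≤ q.eval (esize x)) :
    IsPoly (fun x => SmoothBandit.loop (F x) (s x) (K x)) := by
  let step : (α × ℕ) × β → (α × ℕ) × β := fun z => ((z.1.1, z.1.2 + 1), F z.1.1 z.1.2 z.2)
  have hstep : IsPoly step := prodMk (by fun_prop) hF
  have hit : ∀ x j, step^[j] ((x, 0), s x) = ((x, j), SmoothBandit.loop (F x) (s x) j) := by
    intro x j
    induction j with
    | zero => rfl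
    | succ j ih => rw [Function.iterate_succ_apply', ih]; rfl
  have := iterate (s := fun x : α => ((x, 0), s x)) hstep hK hKd (by fun_prop) (by
    obtain ⟨q, hq⟩ := hq
    obtain ⟨p, hp⟩ := hKd
    refine ⟨q + 2 * p + Polynomial.X + Polynomial.C 4, fun x j hj => ?_⟩
    rw [hit]
    have h1 := hq x j hj
    have h2 : Nat.size j ≤ j := natSize_le_self j
    have h3 := hp x
    simp only [esize, enc_prod, enc_nat, Data.size_nat, Data.size_pair, Polynomial.eval_add,
      Polynomial.eval_mul, Polynomial.eval_X, Polynomial.eval_C] at *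
    have h4 : Polynomial.eval (enc x).size (2 : Polynomial ℕ) = 2 := by simp
    rw [h4]
    omega)
  simp only [hit] at this
  exact snd this

/-- Tabulation of a list. -/
theorem tabulate {F : α → ℕ → β} {K : α → ℕ}
    (hF : IsPoly (fun z : α × ℕ => F z.1 z.2)) (hK : IsPoly K) (hKd : PolyDom K esize) :
    IsPoly (fun x => (List.range (K x)).map (F x)) := by
  let s : α → List β := fun _ => []
  -- New entries go to the front of a list, so it is built from its last entry backwards.
  let G : α → ℕ → List β → List β := fun x j l => F x (K x - 1 - j) :: l
  -- A pair of head and tail and the list itself have the same representation.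
  have hcons : IsPoly (fun z : β × List β => z.1 :: z.2) := by
    obtain ⟨c, hc, hp⟩ : IsPoly (fun z : β × List β => z) := by fun_prop
    exact ⟨c, hc, hp⟩
  have hG : IsPoly (fun z : (α × ℕ) × List β => G z.1.1 z.1.2 z.2) := by
    have h1 : IsPoly (fun z : (α × ℕ) × List β => F z.1.1 (K z.1.1 - 1 - z.1.2)) :=
      comp (g := fun z : α × ℕ => F z.1 z.2)
        (f := fun z : (α × ℕ) × List β => (z.1.1, K z.1.1 - 1 - z.1.2)) hF (by fun_prop)
    exact comp (f := fun z : (α × ℕ) × List β => (F z.1.1 (K z.1.1 - 1 - z.1.2), z.2)) hcons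
      (by fun_prop)
  have hl : ∀ x, ∀ j ≤ K x, SmoothBandit.loop (G x) (s x) j
      = (List.range' (K x - j) j).map (F x) := by
    intro x j
    induction j with
    | zero => intro _; rfl
    | succ j ih =>
      intro hj
      rw [SmoothBandit.loop, ih (by omega)]
      simp only [G, List.range'_succ, List.map_cons]
      congr 2
      · omega
      · congr 1; omega
  have hFs := hF.polyDom_esize
  have := loop hG hK hKd (s := s) (by fun_prop) (by
    obtain ⟨p, hp⟩ := hFs
    obtain ⟨r, hr⟩ := hKd
    obtain ⟨t, ht⟩ : PolyDom (fun x : α => 2 + r.eval (esize x) *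
        (1 + p.eval (1 + esize x + (2 * r.eval (esize x) + 2)))) esize :=
      (PolyDom.const 2 _).add (((PolyDom.refl _).eval r).mul ((PolyDom.const 1 _).add
        ((((PolyDom.const 1 _).add (.refl _)).add
          (((PolyDom.const 2 _).mul ((PolyDom.refl _).eval r)).add (.const 2 _))).eval p)))
    refine ⟨t, fun x j hj => le_trans ?_ (ht x)⟩
    rw [hl x j hj]
    refine (Data.size_ofList_le (B := p.eval (1 + esize x + (2 * r.eval (esize x) + 2))) ?_).trans ?_
    · intro d hd
      simp only [List.map_map, List.mem_map, List.mem_range'_1] at hd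
      obtain ⟨i, hi, rfl⟩ := hd
      refine (hp (x, i)).trans (eval_mono_nat _ ?_)
      have h2 : Nat.size i ≤ i := natSize_le_self i
      have h3 := hr x
      simp only [esize, enc_prod, enc_nat, Data.size_nat, Data.size_pair] at *
      omega
    · simp only [List.length_map, List.length_range']
      have := hr x
      gcongr
      omega)
  convert this using 2 with x
  rw [hl x (K x) le_rfl, Nat.sub_self, List.range_eq_range']

theorem natSize_sum_le (f : ℕ → ℕ) (K B : ℕ) (h : ∀ j < K, Nat.size (f j) ≤ B) :
    Nat.size (∑ j ∈ Finset.range K, f j) ≤ B + K := by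
  induction K with
  | zero => simp
  | succ K ih =>
    rw [Finset.sum_range_succ]
    have h1 := ih fun j hj => h j (by omega)
    have h2 := h K (by omega)
    have := natSize_add_le (∑ j ∈ Finset.range K, f j) (f K)
    omega

theorem sum_range {F : α → ℕ → ℕ} {K : α → ℕ}
    (hF : IsPoly (fun z : α × ℕ => F z.1 z.2)) (hK : IsPoly K) (hKd : PolyDom K esize) :
    IsPoly (fun x => ∑ j ∈ Finset.range (K x), F x j) := by
  have hl : ∀ x j, SmoothBandit.loop (fun i t => t + F x i) 0 j = ∑ i ∈ Finset.range j, F x i := by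
    intro x j
    induction j with
    | zero => rfl
    | succ j ih => rw [SmoothBandit.loop, ih, Finset.sum_range_succ]
  have hFs := hF.polyDom_esize
  have := loop (F := fun (x : α) i t => t + F x i) (s := fun _ => 0) (K := K)
    ((IsPoly.snd id).add (comp hF (IsPoly.fst id))) hK hKd (by fun_prop) (by
    obtain ⟨p, hp⟩ := hFs
    obtain ⟨r, hr⟩ := hKd
    obtain ⟨t, ht⟩ : PolyDom (fun x : α => 2 * (p.eval (1 + esize x + (2 * r.eval (esize x) + 2)) +
        r.eval (esize x)) + 2) esize :=
      (((PolyDom.const 2 _).mul (((((PolyDom.const 1 _).add (.refl _)).add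
          (((PolyDom.const 2 _).mul ((PolyDom.refl _).eval r)).add (.const 2 _))).eval p).add
          ((PolyDom.refl _).eval r)))).add (.const 2 _)
    refine ⟨t, fun x j hj => le_trans ?_ (ht x)⟩
    beta_reduce
    rw [hl x j, esize, enc_nat, Data.size_nat]
    have h3 := hr x
    have := natSize_sum_le (F x) j (p.eval (1 + esize x + (2 * r.eval (esize x) + 2))) (by
      intro i hi
      have h1 := hp (x, i)
      refine le_trans ?_ (h1.trans (eval_mono_nat _ ?_))
      · simp only [esize, enc_nat, Data.size_nat]; omega
      · have h2 : Nat.size i ≤ i := natSize_le_self i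
        simp only [esize, enc_prod, enc_nat, Data.size_nat, Data.size_pair] at *
        omega)
    omega)
  simpa only [hl] using this

end IsPoly

end SmoothBandit

/-! ### List entries, digits of coins, and subroutines in polynomial time -/

namespace SmoothBandit
open Enc

/-- The entry `j` of a list. -/
def Data.nth (l : Data) (j : ℕ) : Data := (Data.snd^[min j l.size] l).fst

/-- The cap `l.size` in `nth` keeps its loop short for every index. It is harmless: a list is no
longer than its representation, and past the end every tail is the leaf `0`. -/
theorem Data.nth_ofList (l : List Data) (j : ℕ) :
    (Data.ofList l).nth j = l.getD j (.nat 0) := by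
  have hd : ∀ (i : ℕ) (l : List Data), Data.snd^[i] (Data.ofList l) = Data.ofList (l.drop i) := by
    intro i
    induction i with
    | zero => intro l; rfl
    | succ i ih =>
      intro l
      rw [Function.iterate_succ_apply]
      cases l with
      | nil => simpa [Data.ofList, Data.snd] using ih []
      | cons d l => simpa [Data.ofList, Data.snd] using ih l
  rw [Data.nth, hd]
  have h1 : l.drop (min j (Data.ofList l).size) = l.drop j := by
    rcases le_total j (Data.ofList l).size with h | h
    · rw [min_eq_left h]
    · have := Data.length_le_size_ofList l
      rw [min_eq_right h, List.drop_eq_nil_of_le this, List.drop_eq_nil_of_le (this.trans h)]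
  rw [h1]
  have h2 : ∀ l : List Data, (Data.ofList l).fst = l.getD 0 (.nat 0) := by
    intro l; cases l <;> rfl
  rw [h2]
  simp [List.getD_eq_getElem?_getD, List.getElem?_drop]

theorem Data.nth_ofVec (v : List ℕ) (j : ℕ) : ((Data.ofVec v).nth j) = .nat (v.getD j 0) := by
  rw [Data.ofVec, Data.nth_ofList]
  simp only [List.getD_eq_getElem?_getD, List.getElem?_map]
  cases v[j]? <;> rfl

/-- The number `m` from a unary numeral `1^m`. -/
def ulen (x : Data) : ℕ := (x.size - 2) / 3

theorem ulen_unary (m : ℕ) : ulen (.unary m) = m := by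
  rw [ulen, Data.size_unary]; omega

/-- The digit `j` of `r` in base `2 ^ W`. -/
def dig (W j r : ℕ) : ℕ := r / 2 ^ (W * j) % 2 ^ W

/-- The output of a p.p.t. algorithm whose coins are the low-order bits of `r`. -/
def PPT.runNat (A : PPT) (x : Data) (r : ℕ) : Data :=
  A.code.eval (.pair x (.nat (r % 2 ^ A.coins.eval x.size)))

theorem PPT.size_runNat_le (A : PPT) (x : Data) (r : ℕ) :
    (A.runNat x r).size ≤ A.time.eval x.size :=
  (Code.size_eval_le _ _).trans (A.time_le x _ (Nat.mod_lt _ (by positivity)))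

namespace IsPoly

variable {α β γ δ : Type} [Enc α] [Enc β] [Enc γ] [Enc δ] {f g : α → ℕ}

theorem two_pow (hf : IsPoly f) (hd : PolyDom f esize) : IsPoly (fun x => 2 ^ f x) := by
  have hit : ∀ j, (fun t : ℕ => 2 * t)^[j] 1 = 2 ^ j := by
    intro j
    induction j with
    | zero => rfl
    | succ j ih => rw [Function.iterate_succ_apply', ih, pow_succ, mul_comm]
  have := iterate (step := fun t : ℕ => 2 * t) (s := fun _ : α => 1) (by fun_prop) hf hd
    (by fun_prop) (by
      obtain ⟨p, hp⟩ := hd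
      refine ⟨2 * p + 4, fun x j hj => ?_⟩
      rw [hit, esize, enc_nat, Data.size_nat, Nat.size_pow]
      have h2 : Polynomial.eval (esize x) (2 : Polynomial ℕ) = 2 := by simp
      have h4 : Polynomial.eval (esize x) (4 : Polynomial ℕ) = 4 := by simp
      rw [Polynomial.eval_add, Polynomial.eval_mul, h2, h4]
      have := hp x
      omega)
  simpa only [hit] using this

/-- For quotient and remainder by `2 ^ g x`, an exponent beyond the length of the dividend can be
replaced by that length. This removes the need for a bound on `g`. -/
theorem two_pow_min (hf : IsPoly f) (hg : IsPoly g) :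
    IsPoly (fun x => 2 ^ Min.min (g x) (Data.nat (f x)).size) :=
  two_pow (by fun_prop) (hf.polyDom_esize.mono fun x => min_le_right _ _)

theorem lt_two_pow_size (r : ℕ) : r < 2 ^ (Data.nat r).size :=
  (Nat.lt_size_self r).trans_le (Nat.pow_le_pow_right (by norm_num) (by
    rw [Data.size_nat]; omega))

theorem div_two_pow (hf : IsPoly f) (hg : IsPoly g) : IsPoly (fun x => f x / 2 ^ g x) := by
  have : (fun x => f x / 2 ^ g x) = fun x => f x / 2 ^ Min.min (g x) (Data.nat (f x)).size := by
    funext x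
    rcases le_total (g x) (Data.nat (f x)).size with h | h
    · rw [min_eq_left h]
    · have := lt_two_pow_size (f x)
      rw [min_eq_right h, Nat.div_eq_of_lt this, Nat.div_eq_of_lt (this.trans_le
        (Nat.pow_le_pow_right (by norm_num) h))]
  rw [this]
  exact hf.div (two_pow_min hf hg)

theorem mod_two_pow (hf : IsPoly f) (hg : IsPoly g) : IsPoly (fun x => f x % 2 ^ g x) := by
  have : (fun x => f x % 2 ^ g x) = fun x => f x % 2 ^ Min.min (g x) (Data.nat (f x)).size := by
    funext x
    rcases le_total (g x) (Data.nat (f x)).size with h | h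
    · rw [min_eq_left h]
    · have := lt_two_pow_size (f x)
      rw [min_eq_right h, Nat.mod_eq_of_lt this, Nat.mod_eq_of_lt (this.trans_le
        (Nat.pow_le_pow_right (by norm_num) h))]
  rw [this]
  exact hf.mod (two_pow_min hf hg)

@[fun_prop]
theorem dig {W j r : α → ℕ} (hW : IsPoly W) (hj : IsPoly j) (hr : IsPoly r) :
    IsPoly (fun x => dig (W x) (j x) (r x)) :=
  mod_two_pow (div_two_pow hr (hW.mul hj)) hW

@[fun_prop]
theorem ulen {f : α → Data} (hf : IsPoly f) : IsPoly (fun x => ulen (f x)) := by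
  unfold SmoothBandit.ulen; fun_prop

@[fun_prop]
theorem nth {l : α → Data} {j : α → ℕ} (hl : IsPoly l) (hj : IsPoly j) :
    IsPoly (fun x => (l x).nth (j x)) := by
  have hle : ∀ i (y : Data), (Data.snd^[i] y).size ≤ y.size := by
    intro i
    induction i with
    | zero => intro y; exact le_rfl
    | succ i ih => intro y; rw [Function.iterate_succ_apply]; exact (ih _).trans (Data.size_snd_le y)
  have hls := hl.polyDom_esize
  refine data_fst (iterate (step := Data.snd) (K := fun x => Min.min (j x) (l x).size)
    (s := l) ?_ (by fun_prop) (hls.mono fun x => min_le_right _ _) hl ?_)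
  · exact data_snd id
  · obtain ⟨p, hp⟩ := hls
    exact ⟨p, fun x i _ => (hle i (l x)).trans (hp x)⟩

theorem subtype_mk {P : β → Prop} {f : α → β} (hf : IsPoly f) (h : ∀ x, P (f x)) :
    IsPoly (fun x => (⟨f x, h x⟩ : {y // P y})) :=
  let ⟨c, hc⟩ := hf
  ⟨c, hc⟩

-- The clock of `A` is guaranteed only for coins in range. The program is therefore polynomial on
-- the subtype of such inputs, into which the reduction modulo `2 ^ coins` in `runNat` leads.
@[fun_prop]
theorem ppt (A : PPT) {x : α → Data} {r : α → ℕ} (hx : IsPoly x) (hr : IsPoly r) :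
    IsPoly (fun a => A.runNat (x a) (r a)) := by
  have h : IsPoly (fun z : {z : Data × ℕ // z.2 < 2 ^ A.coins.eval z.1.size} =>
      A.code.eval (enc z)) :=
    ⟨A.code, fun _ => rfl, ⟨A.time, fun z => (A.time_le _ _ z.2).trans (eval_mono_nat _ (by
      simp only [esize]
      change z.1.1.size ≤ (Data.pair z.1.1 _).size
      rw [Data.size_pair]; omega))⟩⟩
  exact comp (g := fun z : {z : Data × ℕ // z.2 < 2 ^ A.coins.eval z.1.size} =>
    A.code.eval (enc z)) h (subtype_mk (P := fun z : Data × ℕ => z.2 < 2 ^ A.coins.eval z.1.size)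
    (f := fun a => (x a, r a % 2 ^ A.coins.eval (x a).size))
    (prodMk hx (mod_two_pow hr (by fun_prop)))
    (fun a => Nat.mod_lt _ (by positivity)))

@[fun_prop]
theorem polyTime (A : PolyTime) {x : α → Data} (hx : IsPoly x) :
    IsPoly (fun a => A.code.eval (x a)) :=
  comp (g := fun y : Data => A.code.eval y)
    ⟨A.code, fun _ => rfl, ⟨A.time, fun y => A.time_le y⟩⟩ hx

/-- A program with a polynomial time bound on all inputs. -/
theorem of_code (c : Code) (p : Polynomial ℕ) (h : ∀ x, c.cost x ≤ p.eval x.size) {x : α → Data}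
    (hx : IsPoly x) : IsPoly (fun a => c.eval (x a)) :=
  polyTime ⟨c, p, h⟩ hx

@[fun_prop]
theorem ofList {f : α → List Data} (hf : IsPoly f) : IsPoly (fun x => Data.ofList (f x)) := by
  obtain ⟨c, hc, hp⟩ := hf
  refine ⟨c, fun x => ?_, hp⟩
  rw [hc]
  show Data.ofList ((f x).map (fun d => d)) = _
  simp; rfl

@[fun_prop]
theorem ofVec {f : α → List ℕ} (hf : IsPoly f) : IsPoly (fun x => Data.ofVec (f x)) :=
  let ⟨c, h⟩ := hf
  ⟨c, h⟩

theorem unary (hf : IsPoly f) (hd : PolyDom f esize) : IsPoly (fun x => Data.unary (f x)) := by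
  have := ofList (tabulate (F := fun (_ : α) _ => Data.nat 0) (by fun_prop) hf hd)
  simpa [Data.unary, List.map_const'] using this

theorem loop_min_succ (F : ℕ → ℕ) (j : ℕ) :
    SmoothBandit.loop (fun i t => Min.min t (F (i + 1))) (F 0) j
      = (Finset.range (j + 1)).inf' (by simp) F := by
  induction j with
  | zero => simp [SmoothBandit.loop]
  | succ j ih =>
    rw [SmoothBandit.loop, ih]
    conv_rhs =>
      simp only [Finset.range_add_one (n := j + 1)]
    rw [Finset.inf'_insert, min_comm]

/-- The minimum of `F 0, …, F k`. -/
theorem inf_range {F : α → ℕ → ℕ} {K : α → ℕ}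
    (hF : IsPoly (fun z : α × ℕ => F z.1 z.2)) (hK : IsPoly K) (hKd : PolyDom K esize) :
    IsPoly (fun x => (Finset.range (K x + 1)).inf' (by simp) (F x)) := by
  simp only [← loop_min_succ]
  have h0 : IsPoly (fun x : α => F x 0) := comp (f := fun x : α => (x, 0)) hF (by fun_prop)
  refine loop (F := fun x i t => Min.min t (F x (i + 1))) (s := fun x => F x 0) ?_ hK hKd h0 ?_
  · exact min (by fun_prop) (comp (f := fun z : (α × ℕ) × ℕ => (z.1.1, z.1.2 + 1)) hF (by fun_prop))
  · obtain ⟨p, hp⟩ := h0.polyDom_esize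
    refine ⟨p, fun x j _ => le_trans ?_ (hp x)⟩
    rw [loop_min_succ]
    simp only [esize, enc_nat, Data.size_nat]
    have := Nat.size_le_size (Finset.inf'_le (F x) (show 0 ∈ Finset.range (j + 1) by simp))
    omega

end IsPoly
end SmoothBandit

namespace SmoothBandit
open scoped ENNReal

/-! ## Expectations -/

/-- The expectation of `f` under `p`. -/
noncomputable def ex {α : Type*} (p : PMF α) (f : α → ℝ≥0∞) : ℝ≥0∞ := ∑' x, p x * f x

open Classical in
/-- The indicator of a proposition. -/
noncomputable def ind (P : Prop) : ℝ≥0∞ := if P then 1 else 0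

theorem ind_le_one (P : Prop) : ind P ≤ 1 := by unfold ind; split <;> simp

theorem ind_mono {P Q : Prop} (h : P → Q) : ind P ≤ ind Q := by
  unfold ind
  by_cases hP : P
  · rw [if_pos hP, if_pos (h hP)]
  · rw [if_neg hP]; exact zero_le

theorem ind_true {P : Prop} (h : P) : ind P = 1 := if_pos h

theorem ind_false {P : Prop} (h : ¬ P) : ind P = 0 := if_neg h

theorem ind_or_le (P Q : Prop) : ind (P ∨ Q) ≤ ind P + ind Q := by
  by_cases hP : P
  · rw [ind_true (Or.inl hP), ind_true hP]; exact le_self_add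
  · rw [show (P ∨ Q) = Q by simp [hP]]; exact le_add_self

theorem ind_exists_le (G : ℕ) (P : ℕ → Prop) :
    ind (∃ j < G, P j) ≤ ∑ j ∈ Finset.range G, ind (P j) := by
  by_cases h : ∃ j < G, P j
  · obtain ⟨j, hj, hP⟩ := h
    rw [ind_true ⟨j, hj, hP⟩, ← ind_true hP]
    exact Finset.single_le_sum (f := fun j => ind (P j)) (fun _ _ => zero_le)
      (Finset.mem_range.2 hj)
  · rw [ind_false h]; exact zero_le

theorem ind_forall_eq_prod (G : ℕ) (P : ℕ → Prop) :
    ind (∀ j < G, P j) = ∏ j ∈ Finset.range G, ind (P j) := by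
  by_cases h : ∀ j < G, P j
  · rw [ind_true h, Finset.prod_eq_one fun j hj => ind_true (h j (Finset.mem_range.1 hj))]
  · rw [ind_false h]
    push Not at h
    obtain ⟨j, hj, hP⟩ := h
    exact (Finset.prod_eq_zero (Finset.mem_range.2 hj) (ind_false hP)).symm

theorem ind_not (P : Prop) : ind (¬ P) + ind P = 1 := by
  by_cases h : P
  · rw [ind_true h, ind_false (by simpa using h), zero_add]
  · rw [ind_false h, ind_true h, add_zero]

theorem mem_support_pure_iff' {α : Type} {a b : α} : b ∈ (pure a : PMF α).support ↔ b = a :=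
  PMF.mem_support_pure_iff a b

theorem mem_support_bind_iff' {α β : Type} {p : PMF α} {g : α → PMF β} {b : β} :
    b ∈ (p >>= g).support ↔ ∃ a ∈ p.support, b ∈ (g a).support :=
  PMF.mem_support_bind_iff p g b

section ex

variable {α β : Type*} (p : PMF α)

theorem ex_pure (a : α) (f : α → ℝ≥0∞) : ex (pure a) f = f a := by
  classical
  change ex (PMF.pure a) f = f a
  unfold ex
  rw [tsum_eq_single a (fun b hb => by simp [PMF.pure_apply, hb])]
  simp [PMF.pure_apply]

theorem ex_bind {α β : Type} (p : PMF α) (g : α → PMF β) (f : β → ℝ≥0∞) :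
    ex (p >>= g) f = ex p (fun x => ex (g x) f) := by
  change ex (p.bind g) f = _
  unfold ex
  simp only [PMF.bind_apply, ← ENNReal.tsum_mul_right, ← ENNReal.tsum_mul_left]
  rw [ENNReal.tsum_comm]
  simp only [mul_assoc]

theorem ex_map {α β : Type} (p : PMF α) (g : α → β) (f : β → ℝ≥0∞) :
    ex (p.map g) f = ex p (fun x => f (g x)) := by
  have : p.map g = p >>= fun x => pure (g x) := rfl
  rw [this, ex_bind]
  simp only [ex_pure]

theorem ex_mono_support {f g : α → ℝ≥0∞} (h : ∀ x ∈ p.support, f x ≤ g x) : ex p f ≤ ex p g := by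
  refine ENNReal.tsum_le_tsum fun x => ?_
  by_cases hx : p x = 0
  · simp [hx]
  · exact mul_le_mul_right (h x ((p.mem_support_iff x).2 hx)) _

theorem ex_congr_support {f g : α → ℝ≥0∞} (h : ∀ x ∈ p.support, f x = g x) : ex p f = ex p g :=
  le_antisymm (ex_mono_support p fun x hx => (h x hx).le)
    (ex_mono_support p fun x hx => (h x hx).ge)

theorem ex_mono {f g : α → ℝ≥0∞} (h : ∀ x, f x ≤ g x) : ex p f ≤ ex p g :=
  ex_mono_support p fun x _ => h x

theorem ex_add (f g : α → ℝ≥0∞) : ex p (fun x => f x + g x) = ex p f + ex p g := by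
  simp only [ex, mul_add, ENNReal.tsum_add]

theorem ex_sum {ι : Type*} (s : Finset ι) (f : ι → α → ℝ≥0∞) :
    ex p (fun x => ∑ i ∈ s, f i x) = ∑ i ∈ s, ex p (f i) := by
  classical
  induction s using Finset.induction_on with
  | empty => simp [ex]
  | insert i s hi ih => simp only [Finset.sum_insert hi, ex_add, ih]

theorem ex_const (c : ℝ≥0∞) : ex p (fun _ => c) = c := by
  simp [ex, ENNReal.tsum_mul_right, p.tsum_coe]

theorem ex_const_mul (c : ℝ≥0∞) (f : α → ℝ≥0∞) : ex p (fun x => c * f x) = c * ex p f := by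
  simp only [ex, ← ENNReal.tsum_mul_left]
  exact tsum_congr fun x => by ring

theorem ex_mul_const (c : ℝ≥0∞) (f : α → ℝ≥0∞) : ex p (fun x => f x * c) = ex p f * c := by
  simp only [mul_comm _ c, ex_const_mul]

theorem ex_comm (q : PMF β) (F : α → β → ℝ≥0∞) :
    ex p (fun x => ex q (fun y => F x y)) = ex q (fun y => ex p (fun x => F x y)) := by
  simp only [ex, ← ENNReal.tsum_mul_left]
  rw [ENNReal.tsum_comm]
  exact tsum_congr fun y => tsum_congr fun x => by ring

theorem ex_le {f : α → ℝ≥0∞} {c : ℝ≥0∞} (h : ∀ x ∈ p.support, f x ≤ c) : ex p f ≤ c :=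
  (ex_mono_support p h).trans (ex_const p c).le

theorem ex_le_one {f : α → ℝ≥0∞} (h : ∀ x, f x ≤ 1) : ex p f ≤ 1 := ex_le p fun x _ => h x

/-- The averaging argument: if all values on the support were below the mean, so would be the mean.
It serves to fix the random choices of adversaries without loss. -/
theorem exists_ex_le {f : α → ℝ≥0∞} (h : ∀ x, f x ≤ 1) : ∃ x ∈ p.support, ex p f ≤ f x := by
  by_contra! hlt
  obtain ⟨a, ha⟩ := p.support_nonempty
  have hfin : ex p f ≠ ⊤ := ne_top_of_le_ne_top ENNReal.one_ne_top (ex_le_one p h)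
  have : ex p f < ex p (fun _ => ex p f) := by
    refine ENNReal.tsum_lt_tsum (i := a) hfin (fun x => ?_) ?_
    · by_cases hx : p x = 0
      · simp [hx]
      · exact mul_le_mul_right (hlt x ((p.mem_support_iff x).2 hx)).le _
    · exact ENNReal.mul_lt_mul_right ((p.mem_support_iff a).1 ha) (p.apply_ne_top a) (hlt a ha)
  rw [ex_const] at this
  exact lt_irrefl _ this

theorem ex_add_ex_not (P : α → Prop) : ex p (fun x => ind (¬ P x)) + ex p (fun x => ind (P x)) = 1 := by
  rw [← ex_add]
  simp only [ind_not, ex_const]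

end ex

theorem prob_eq (e : PMF Prop) : prob e = (ex e ind).toReal := by
  unfold prob ex
  congr 1
  rw [tsum_eq_single True (fun P hP => by
    rw [ind_false, mul_zero]
    intro h
    exact hP (by simpa using h))]
  simp [ind]

theorem ex_prop_le_one (e : PMF Prop) : ex e ind ≤ 1 := ex_le_one e ind_le_one

theorem ofReal_prob (e : PMF Prop) : ENNReal.ofReal (prob e) = ex e ind := by
  rw [prob_eq, ENNReal.ofReal_toReal (ne_top_of_le_ne_top ENNReal.one_ne_top (ex_prop_le_one e))]

theorem prob_le_one (e : PMF Prop) : prob e ≤ 1 := by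
  rw [prob_eq]
  exact ENNReal.toReal_le_of_le_ofReal zero_le_one (by simpa using ex_prop_le_one e)

theorem prob_nonneg (e : PMF Prop) : 0 ≤ prob e := ENNReal.toReal_nonneg

/-! ## Coin flips -/

theorem coinFlips_eq_map (m : ℕ) :
    coinFlips m = (PMF.uniformOfFintype (Fin (2 ^ m))).map Fin.val :=
  PMF.map_id _

theorem ex_coinFlips (m : ℕ) (f : ℕ → ℝ≥0∞) :
    ex (coinFlips m) f = (2 ^ m : ℝ≥0∞)⁻¹ * ∑ r ∈ Finset.range (2 ^ m), f r := by
  rw [coinFlips_eq_map, ex_map, ex, tsum_fintype, Finset.mul_sum,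
    ← Fin.sum_univ_eq_sum_range (fun r => (2 ^ m : ℝ≥0∞)⁻¹ * f r) (2 ^ m)]
  simp [PMF.uniformOfFintype_apply]

theorem lt_of_mem_coinFlips {m r : ℕ} (h : r ∈ (coinFlips m).support) : r < 2 ^ m := by
  rw [coinFlips_eq_map, PMF.support_map] at h
  obtain ⟨x, -, rfl⟩ := h
  exact x.2

theorem mem_coinFlips {m r : ℕ} (h : r < 2 ^ m) : r ∈ (coinFlips m).support := by
  rw [coinFlips_eq_map, PMF.support_map]
  exact ⟨⟨r, h⟩, by simp, rfl⟩

/-- Each number below `2 ^ (a + b)` is `x + 2 ^ a * y` for exactly one `x` below `2 ^ a` and `y`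
below `2 ^ b`. So one string of coins splits into independent parts. -/
theorem ex_coinFlips_add (a b : ℕ) (f : ℕ → ℝ≥0∞) :
    ex (coinFlips (a + b)) f
      = ex (coinFlips a) (fun x => ex (coinFlips b) (fun y => f (x + 2 ^ a * y))) := by
  simp only [ex_coinFlips]
  simp only [Finset.mul_sum]
  rw [Finset.sum_comm]
  have hsum : ∀ g : ℕ → ℝ≥0∞, ∀ B, ∑ r ∈ Finset.range (2 ^ a * B), g r
      = ∑ y ∈ Finset.range B, ∑ x ∈ Finset.range (2 ^ a), g (x + 2 ^ a * y) := by
    intro g B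
    induction B with
    | zero => simp
    | succ B ih =>
      rw [Nat.mul_succ, Finset.sum_range_add, ih, Finset.sum_range_succ]
      simp only [add_comm]
  rw [pow_add, hsum]
  refine Finset.sum_congr rfl fun y _ => Finset.sum_congr rfl fun x _ => ?_
  rw [← mul_assoc, ← ENNReal.mul_inv (by simp) (by simp), ← pow_add]

theorem ex_coinFlips_zero (f : ℕ → ℝ≥0∞) : ex (coinFlips 0) f = f 0 := by
  simp [ex_coinFlips]

theorem ex_coinFlips_mod {a m : ℕ} (h : a ≤ m) (f : ℕ → ℝ≥0∞) :
    ex (coinFlips m) (fun r => f (r % 2 ^ a)) = ex (coinFlips a) f := by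
  obtain ⟨b, rfl⟩ := Nat.exists_eq_add_of_le h
  rw [ex_coinFlips_add]
  refine ex_congr_support _ fun x hx => ?_
  simp only [Nat.add_mul_mod_self_left, Nat.mod_eq_of_lt (lt_of_mem_coinFlips hx), ex_const]

theorem dig_add_low {W i j x y : ℕ} (hij : i < j) :
    dig W i (x + 2 ^ (W * j) * y) = dig W i x := by
  unfold dig
  obtain ⟨d, rfl⟩ := Nat.exists_eq_add_of_lt hij
  have : 2 ^ (W * (i + d + 1)) * y = 2 ^ (W * i) * (2 ^ W * (2 ^ (W * d) * y)) := by
    rw [← mul_assoc, ← mul_assoc, ← pow_add, ← pow_add]; ring_nf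
  rw [this, Nat.add_mul_div_left _ _ (by positivity), Nat.add_mul_mod_self_left]

theorem dig_add_high {W j x y : ℕ} (hx : x < 2 ^ (W * j)) (i : ℕ) :
    dig W (j + i) (x + 2 ^ (W * j) * y) = dig W i y := by
  unfold dig
  rw [mul_add, pow_add, ← Nat.div_div_eq_div_mul, Nat.add_mul_div_left _ _ (by positivity),
    Nat.div_eq_of_lt hx, zero_add]

theorem dig_zero_of_lt {W y : ℕ} (hy : y < 2 ^ W) : dig W 0 y = y := by
  simp [dig, Nat.mod_eq_of_lt hy]

/-- The blocks of `W` coins are independent and uniform. Products suffice as test functions, since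
the only joint event of several blocks that matters is an intersection over the rounds. -/
theorem ex_coinFlips_prod_dig (W : ℕ) (f : ℕ → ℕ → ℝ≥0∞) {G J : ℕ} (h : G ≤ J) :
    ex (coinFlips (W * J)) (fun r => ∏ j ∈ Finset.range G, f j (dig W j r))
      = ∏ j ∈ Finset.range G, ex (coinFlips W) (f j) := by
  obtain ⟨d, rfl⟩ := Nat.exists_eq_add_of_le h
  have hlow : ex (coinFlips (W * (G + d))) (fun r => ∏ j ∈ Finset.range G, f j (dig W j r))
      = ex (coinFlips (W * G)) (fun r => ∏ j ∈ Finset.range G, f j (dig W j r)) := by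
    rw [mul_add, ex_coinFlips_add]
    congr 1; funext x
    rw [← ex_const (coinFlips (W * d)) (∏ j ∈ Finset.range G, f j (dig W j x))]
    congr 1; funext y
    exact Finset.prod_congr rfl fun j hj => by rw [dig_add_low (Finset.mem_range.1 hj)]
  rw [hlow]
  clear hlow h
  induction G with
  | zero => simp [ex_const]
  | succ G ih =>
    rw [mul_add, mul_one, ex_coinFlips_add, Finset.prod_range_succ, ← ih, ← ex_mul_const]
    refine ex_congr_support _ fun x hx => ?_
    rw [← ex_const_mul]
    refine ex_congr_support _ fun y hy => ?_
    rw [Finset.prod_range_succ]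
    congr 1
    · exact Finset.prod_congr rfl fun j hj => by rw [dig_add_low (Finset.mem_range.1 hj)]
    · have := dig_add_high (y := y) (lt_of_mem_coinFlips hx) 0
      rw [add_zero] at this
      rw [this, dig_zero_of_lt (lt_of_mem_coinFlips hy)]

theorem ex_coinFlips_dig (W : ℕ) (f : ℕ → ℝ≥0∞) {j J : ℕ} (h : j < J) :
    ex (coinFlips (W * J)) (fun r => f (dig W j r)) = ex (coinFlips W) f := by
  -- All factors but the one of block `j` are `1`.
  have := ex_coinFlips_prod_dig W (fun i x => if i = j then f x else 1) (G := J) le_rfl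
  simp only [Finset.prod_ite_eq', Finset.mem_range, h, if_true] at this
  rw [this, Finset.prod_eq_single j]
  · simp
  · intro i _ hi; simp [hi, ex_const]
  · simp [h]

theorem ex_run (A : PPT) (x : Data) (f : Data → ℝ≥0∞) :
    ex (A.run x) f = ex (coinFlips (A.coins.eval x.size)) (fun r => f (A.runNat x r)) := by
  rw [PPT.run, ex_map]
  refine ex_congr_support _ fun r hr => ?_
  rw [PPT.runNat, Nat.mod_eq_of_lt (lt_of_mem_coinFlips hr)]

/-- Running a p.p.t. algorithm on some digit of a long string of coins. -/
theorem ex_runNat_dig (A : PPT) (x : Data) (f : Data → ℝ≥0∞) {W j J : ℕ} (hj : j < J)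
    (hW : A.coins.eval x.size ≤ W) :
    ex (coinFlips (W * J)) (fun r => f (A.runNat x (dig W j r))) = ex (A.run x) f := by
  rw [ex_coinFlips_dig W (fun r => f (A.runNat x r)) hj, ex_run,
    ← ex_coinFlips_mod hW (fun r => f (A.runNat x r))]
  simp [PPT.runNat]

theorem runNat_mem_support (A : PPT) (x : Data) (r : ℕ) : A.runNat x r ∈ (A.run x).support := by
  rw [PPT.run, PMF.support_map]
  exact ⟨_, mem_coinFlips (Nat.mod_lt r (by positivity)), rfl⟩

/-! ## Negligible functions -/

theorem Negligible.add {f g : ℕ → ℝ} (hf : Negligible f) (hg : Negligible g) :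
    Negligible (fun n => f n + g n) := fun c => (hf c).add (hg c)

theorem Negligible.mono {f g : ℕ → ℝ} (hg : Negligible g)
    (h : ∀ᶠ n in Filter.atTop, |f n| ≤ |g n|) : Negligible f := fun c =>
  (Asymptotics.IsBigO.of_bound 1 (by simpa using h)).trans (hg c)

/-- If the factor is `O(λ ^ d)`, the decay of `f` at exponent `c + d` gives decay of the product at
exponent `c`. -/
theorem Negligible.poly_mul {f : ℕ → ℝ} (hf : Negligible f) {g : ℕ → ℕ} (hg : PolyBounded g) :
    Negligible (fun n => (g n : ℝ) * f n) := by
  obtain ⟨p, hp⟩ := hg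
  have hpow : ∃ d : ℕ, (fun n => (g n : ℝ)) =O[Filter.atTop] (fun n : ℕ => (n : ℝ) ^ d) := by
    have key : ∀ p : Polynomial ℕ, ∃ d : ℕ, ∃ C : ℕ, ∀ n ≥ 1, p.eval n ≤ C * n ^ d := by
      intro p
      induction p using Polynomial.induction_on' with
      | add p q hp hq =>
        obtain ⟨d, C, h⟩ := hp
        obtain ⟨d', C', h'⟩ := hq
        refine ⟨max d d', C + C', fun n hn => ?_⟩
        rw [Polynomial.eval_add, add_mul]
        exact add_le_add
          ((h n hn).trans (Nat.mul_le_mul_left _ (Nat.pow_le_pow_right hn (le_max_left _ _))))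
          ((h' n hn).trans (Nat.mul_le_mul_left _ (Nat.pow_le_pow_right hn (le_max_right _ _))))
      | monomial d a => exact ⟨d, a, fun n _ => by simp⟩
    obtain ⟨d, C, h⟩ := key p
    refine ⟨d, Asymptotics.IsBigO.of_bound C ?_⟩
    filter_upwards [Filter.eventually_ge_atTop 1] with n hn
    have := (hp n).trans (h n hn)
    rw [Real.norm_of_nonneg (by positivity), Real.norm_of_nonneg (by positivity)]
    exact_mod_cast this
  obtain ⟨d, hd⟩ := hpow
  intro c
  refine (hd.mul (hf (c + d))).trans (Asymptotics.IsBigO.of_bound 1 ?_)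
  filter_upwards [Filter.eventually_ge_atTop 1] with n hn
  have : (0 : ℝ) < n := by exact_mod_cast hn
  rw [one_mul]
  apply le_of_eq
  congr 1
  rw [pow_add]
  field_simp

theorem negligible_of_eventually_zero {f : ℕ → ℝ} (h : ∀ᶠ n in Filter.atTop, f n = 0) :
    Negligible f := fun c =>
  Asymptotics.IsBigO.of_bound 0 (h.mono fun n hn => by simp [hn])

end SmoothBandit

namespace SmoothBandit

/-! ## Smooth policies -/

theorem isSmooth_uniform {n : ℕ} (hn : 1 ≤ n) {σ : ℝ} (hσ : 1 / (n : ℝ) ≤ σ) :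
    IsSmooth σ (fun _ : Fin n => 1 / (n : ℝ)) := by
  have : (0 : ℝ) < n := by exact_mod_cast hn
  refine ⟨fun _ => by positivity, ?_, fun _ => hσ⟩
  simp [this.ne']

theorem IsSmooth.le_one {n : ℕ} {σ : ℝ} {π : Fin n → ℝ} (h : IsSmooth σ π) (i : Fin n) :
    π i ≤ 1 := by
  rw [← h.2.1]
  exact Finset.single_le_sum (f := π) (fun j _ => h.1 j) (Finset.mem_univ i)

/-- A linear function attains its maximum on the compact set of smooth policies, which contains the
uniform policy. -/
theorem exists_isOptimalSmooth {n : ℕ} (hn : 1 ≤ n) {σ : ℝ} (hσ : 1 / (n : ℝ) ≤ σ)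
    (u : Fin n → ℝ) : ∃ π, IsOptimalSmooth σ u π := by
  have hcl : IsClosed {π : Fin n → ℝ | IsSmooth σ π} := by
    have : {π : Fin n → ℝ | IsSmooth σ π}
        = (⋂ i, {π | 0 ≤ π i}) ∩ ({π | ∑ i, π i = 1} ∩ ⋂ i, {π | π i ≤ σ}) := by
      ext π; simp [IsSmooth]
    rw [this]
    refine (isClosed_iInter fun i => isClosed_le continuous_const (continuous_apply i)).inter
      ((isClosed_eq (by fun_prop) continuous_const).inter
        (isClosed_iInter fun i => isClosed_le (continuous_apply i) continuous_const))
  have hco : IsCompact {π : Fin n → ℝ | IsSmooth σ π} :=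
    (isCompact_univ_pi fun _ => isCompact_Icc (a := (0 : ℝ)) (b := 1)).of_isClosed_subset hcl
      fun π hπ i _ => ⟨hπ.1 i, hπ.le_one i⟩
  obtain ⟨π, hπ, hmax⟩ := hco.exists_isMaxOn ⟨_, isSmooth_uniform hn hσ⟩
    (f := fun π => π ⬝ᵥ u) (by unfold dotProduct; fun_prop)
  exact ⟨π, hπ, fun π' h => hmax h⟩

/-- Changing the smoothness parameter. -/
theorem IsSmooth.exists_transfer {n : ℕ} (hn : 1 ≤ n) {s σ : ℝ} (hσ : 1 / (n : ℝ) ≤ σ)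
    {π : Fin n → ℝ} (h : IsSmooth s π) {u : Fin n → ℝ} (hu : ∀ i, 0 ≤ u i ∧ u i ≤ 1) :
    ∃ ρ, IsSmooth σ ρ ∧ π ⬝ᵥ u - n * |s - σ| ≤ ρ ⬝ᵥ u := by
  have hn0 : (0 : ℝ) < n := by exact_mod_cast hn
  have hσ0 : 0 < σ := lt_of_lt_of_le (by positivity) hσ
  rcases le_or_gt s σ with hs | hs
  · exact ⟨π, ⟨h.1, h.2.1, fun i => (h.2.2 i).trans hs⟩, by
      have : 0 ≤ (n : ℝ) * |s - σ| := by positivity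
      linarith⟩
  have hs0 : 0 < s := hσ0.trans hs
  have hnσ : 1 ≤ n * σ := by rw [div_le_iff₀ hn0] at hσ; linarith
  have hr1 : σ / s < 1 := by rw [div_lt_one hs0]; exact hs
  have hr0 : 0 < σ / s := by positivity
  have hden : 0 < n * σ - σ / s := by linarith
  -- Scaling `π` by `r` brings it below the new cap. The missing mass `1 - r` is spread in
  -- proportion to the room `σ - r * π i` that is left; the total room is `n * σ - r`, at least `1 -
  -- r`, so that `c ≤ 1`.
  set r := σ / s with hr
  set c := (1 - r) / (n * σ - r) with hc
  have hc0 : 0 ≤ c := div_nonneg (by linarith) hden.le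
  have hc1 : c ≤ 1 := by rw [hc, div_le_one hden]; linarith
  have hrπ : ∀ i, r * π i ≤ σ := fun i => by
    have := mul_le_mul_of_nonneg_left (h.2.2 i) hr0.le
    have e : r * s = σ := by rw [hr]; field_simp
    linarith
  refine ⟨fun i => r * π i + c * (σ - r * π i), ⟨fun i => ?_, ?_, fun i => ?_⟩, ?_⟩
  · have := mul_nonneg hr0.le (h.1 i)
    have := mul_nonneg hc0 (sub_nonneg.2 (hrπ i))
    linarith
  · rw [Finset.sum_add_distrib, ← Finset.mul_sum, ← Finset.mul_sum, Finset.sum_sub_distrib,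
      ← Finset.mul_sum, h.2.1]
    simp only [Finset.sum_const, Finset.card_univ, Fintype.card_fin, nsmul_eq_mul, mul_one]
    rw [hc, div_mul_cancel₀ _ hden.ne']; ring
  · have := mul_le_mul_of_nonneg_right hc1 (sub_nonneg.2 (hrπ i))
    linarith
  · have h1 : r * (π ⬝ᵥ u) ≤ (fun i => r * π i + c * (σ - r * π i)) ⬝ᵥ u := by
      unfold dotProduct
      rw [Finset.mul_sum]
      refine Finset.sum_le_sum fun i _ => ?_
      have := mul_nonneg (mul_nonneg hc0 (sub_nonneg.2 (hrπ i))) (hu i).1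
      nlinarith
    have h2 : π ⬝ᵥ u ≤ 1 := by
      rw [← h.2.1]
      exact Finset.sum_le_sum fun i _ => mul_le_of_le_one_right (h.1 i) (hu i).2
    -- At most the mass `1 - r = (s - σ) / s` is lost, and `1 ≤ n * s`.
    have h3 : 1 - r ≤ n * |s - σ| := by
      rw [abs_of_pos (by linarith), hr, one_sub_div hs0.ne', div_le_iff₀ hs0]
      have : 1 ≤ n * s := hnσ.trans (mul_le_mul_of_nonneg_left hs.le hn0.le)
      nlinarith
    nlinarith

/-- The difference of two optimal values is controlled by a smooth average of the differences of
the utilities. -/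
theorem IsOptimalSmooth.exists_abs_sub_le {n : ℕ} (hn : 1 ≤ n) {s σ : ℝ} (hs : 1 / (n : ℝ) ≤ s)
    (hσ : 1 / (n : ℝ) ≤ σ) {u v π π' : Fin n → ℝ} (hu : ∀ i, 0 ≤ u i ∧ u i ≤ 1)
    (h : IsOptimalSmooth s v π) (h' : IsOptimalSmooth σ u π') :
    ∃ w, IsSmooth s w ∧ |π ⬝ᵥ v - π' ⬝ᵥ u| ≤ ∑ i, w i * |v i - u i| + n * |s - σ| := by
  have key : ∀ w : Fin n → ℝ, (∀ i, 0 ≤ w i) →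
      |w ⬝ᵥ v - w ⬝ᵥ u| ≤ ∑ i, w i * |v i - u i| := by
    intro w hw
    rw [← dotProduct_sub]
    refine (Finset.abs_sum_le_sum_abs _ _).trans (Finset.sum_le_sum fun i _ => ?_)
    rw [abs_mul, abs_of_nonneg (hw i), Pi.sub_apply]
  -- The policy with the larger value is transferred to the smoothness of the other and compared
  -- with the optimum there. In both cases the `s`-smooth one of the original and the transferred
  -- policy serves as `w`.
  rcases le_total (π' ⬝ᵥ u) (π ⬝ᵥ v) with hle | hle
  · obtain ⟨ρ, hρ, hρu⟩ := h.1.exists_transfer hn hσ hu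
    refine ⟨π, h.1, ?_⟩
    have h1 := h'.2 ρ hρ
    have h2 := le_abs_self (π ⬝ᵥ v - π ⬝ᵥ u)
    have h3 := key π h.1.1
    rw [abs_of_nonneg (by linarith)]
    linarith
  · obtain ⟨ρ, hρ, hρu⟩ := h'.1.exists_transfer hn hs hu
    refine ⟨ρ, hρ, ?_⟩
    have h1 := h.2 ρ hρ
    have h2 := neg_abs_le (ρ ⬝ᵥ v - ρ ⬝ᵥ u)
    have h3 := key ρ hρ.1
    rw [abs_sub_comm σ s] at hρu
    rw [abs_of_nonpos (by linarith)]
    linarith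

/-- Weak duality for the optimal smooth value. -/
theorem IsSmooth.dotProduct_le {n : ℕ} {s : ℝ} {π : Fin n → ℝ} (h : IsSmooth s π)
    (v : Fin n → ℝ) (θ : ℝ) : π ⬝ᵥ v ≤ θ + s * ∑ i, max (v i - θ) 0 := by
  have : π ⬝ᵥ v = θ + ∑ i, π i * (v i - θ) := by
    simp only [mul_sub, Finset.sum_sub_distrib, ← Finset.sum_mul, h.2.1, dotProduct]
    ring
  rw [this, Finset.mul_sum]
  refine add_le_add_right (Finset.sum_le_sum fun i _ => ?_) θ
  calc π i * (v i - θ) ≤ π i * max (v i - θ) 0 :=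
        mul_le_mul_of_nonneg_left (le_max_left _ _) (h.1 i)
    _ ≤ s * max (v i - θ) 0 := mul_le_mul_of_nonneg_right (h.2.2 i) (le_max_right _ _)

/-- Strong duality: the bound is attained for some policy and some threshold `v j`. -/
theorem exists_isSmooth_dotProduct_eq {n : ℕ} (hn : 1 ≤ n) {s : ℝ} (hs : 1 / (n : ℝ) ≤ s)
    (v : Fin n → ℝ) : ∃ (π : Fin n → ℝ) (j : Fin n), IsSmooth s π ∧
      π ⬝ᵥ v = v j + s * ∑ i, max (v i - v j) 0 := by
  classical
  have hn0 : (0 : ℝ) < n := by exact_mod_cast hn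
  have hs0 : 0 < s := lt_of_lt_of_le (by positivity) hs
  have : NeZero n := ⟨by omega⟩
  -- the largest threshold above which there are enough arms
  let S : Finset (Fin n) := Finset.univ.filter fun j =>
    1 ≤ s * (Finset.univ.filter fun i => v j ≤ v i).card
  obtain ⟨j₀, -, hj₀⟩ := Finset.exists_min_image Finset.univ v ⟨0, Finset.mem_univ _⟩
  have hS : S.Nonempty := by
    refine ⟨j₀, Finset.mem_filter.2 ⟨Finset.mem_univ _, ?_⟩⟩
    rw [Finset.filter_true_of_mem fun i hi => hj₀ i hi, Finset.card_univ, Fintype.card_fin]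
    rw [div_le_iff₀ hn0] at hs; exact hs
  obtain ⟨j, hjS, hj⟩ := Finset.exists_max_image S v hS
  let A := Finset.univ.filter fun i => v j < v i
  let E := Finset.univ.filter fun i => v i = v j
  have hcard : (Finset.univ.filter fun i => v j ≤ v i).card = A.card + E.card := by
    rw [← Finset.card_union_of_disjoint]
    · congr 1; ext i
      simp only [A, E, Finset.mem_filter, Finset.mem_univ, true_and, Finset.mem_union, le_iff_lt_or_eq,
        eq_comm]
    · refine Finset.disjoint_left.2 fun i hi hi' => ?_
      have h1 := (Finset.mem_filter.1 hi).2
      have h2 := (Finset.mem_filter.1 hi').2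
      linarith
  have hE0 : (0 : ℝ) < E.card := by
    exact_mod_cast Finset.card_pos.2 ⟨j, by simp [E]⟩
  have hge : 1 ≤ s * (A.card + E.card) := by
    have := (Finset.mem_filter.1 hjS).2
    rw [hcard] at this; push_cast at this; exact this
  have hA : s * A.card ≤ 1 := by
    -- Otherwise the lowest arm above the threshold would be in `S`, against the maximality of `v
    -- j`.
    by_contra! hlt
    have hAne : A.Nonempty := by
      rw [Finset.nonempty_iff_ne_empty]
      intro h0; rw [h0] at hlt; simp at hlt; linarith
    obtain ⟨k, hkA, hk⟩ := Finset.exists_min_image A v hAne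
    have hkS : k ∈ S := by
      refine Finset.mem_filter.2 ⟨Finset.mem_univ _, hlt.le.trans ?_⟩
      gcongr
      intro i hi
      exact Finset.mem_filter.2 ⟨Finset.mem_univ _, hk i hi⟩
    have := hj k hkS
    have := (Finset.mem_filter.1 hkA).2
    linarith
  -- Arms above the threshold get the full weight `s`, and those at the threshold share the rest
  -- equally. The share is nonnegative by maximality of the threshold and at most `s` because `j ∈
  -- S`.
  set c := (1 - s * A.card) / E.card with hc
  have hc0 : 0 ≤ c := div_nonneg (by linarith) hE0.le
  have hcs : c ≤ s := by rw [hc, div_le_iff₀ hE0]; linarith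
  have hcE : E.card * c = 1 - s * A.card := by rw [hc]; field_simp
  let π : Fin n → ℝ := fun i => (if v j < v i then s else 0) + (if v i = v j then c else 0)
  have hπ1 : ∑ i, π i = 1 := by
    simp only [π, Finset.sum_add_distrib]
    rw [← Finset.sum_filter, ← Finset.sum_filter, Finset.sum_const, Finset.sum_const, nsmul_eq_mul,
      nsmul_eq_mul]
    change A.card * s + E.card * c = 1
    rw [hcE]; ring
  refine ⟨π, j, ⟨fun i => ?_, hπ1, fun i => ?_⟩, ?_⟩
  · simp only [π]; positivity
  · simp only [π]
    split_ifs with h1 h2 h2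
    · linarith
    · linarith
    · linarith
    · linarith
  · have : π ⬝ᵥ v = v j + ∑ i, π i * (v i - v j) := by
      simp only [mul_sub, Finset.sum_sub_distrib, ← Finset.sum_mul, hπ1, dotProduct]
      ring
    rw [this, Finset.mul_sum]
    congr 1
    refine Finset.sum_congr rfl fun i _ => ?_
    simp only [π]
    split_ifs with h1 h2 h2
    · linarith
    · rw [max_eq_left (by linarith), add_zero]
    · rw [h2]; simp
    · rw [max_eq_right (by linarith)]; simp

/-- The optimal value for utilities in fixed-point notation. -/
theorem exists_isOptimalSmooth_value {n : ℕ} (hn : 1 ≤ n) {a b : ℕ} (hb : 0 < b)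
    (hab : b ≤ n * a) (D : ℕ) (hD : 0 < D) (v : Fin n → ℕ) (T : ℕ)
    (hT : ∀ j, T ≤ b * v j + a * ∑ i, (v i - v j))
    (hT' : ∃ j, T = b * v j + a * ∑ i, (v i - v j)) :
    ∃ π, IsOptimalSmooth ((a : ℝ) / b) (fun i => (v i : ℝ) / D) π ∧
      π ⬝ᵥ (fun i => (v i : ℝ) / D) = (T : ℝ) / (b * D) := by
  have hn0 : (0 : ℝ) < n := by exact_mod_cast hn
  have hb0 : (0 : ℝ) < b := by exact_mod_cast hb
  have hD0 : (0 : ℝ) < D := by exact_mod_cast hD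
  have hs : 1 / (n : ℝ) ≤ (a : ℝ) / b := by
    rw [div_le_div_iff₀ hn0 hb0, one_mul, mul_comm]; exact_mod_cast hab
  have hF : ∀ j, (v j : ℝ) / D + (a : ℝ) / b * ∑ i, max ((v i : ℝ) / D - (v j : ℝ) / D) 0
      = ((b * v j + a * ∑ i, (v i - v j) : ℕ) : ℝ) / (b * D) := by
    intro j
    -- Truncated subtraction of natural numbers is the positive part in the dual objective.
    have : ∀ i, max ((v i : ℝ) / D - (v j : ℝ) / D) 0 = ((v i - v j : ℕ) : ℝ) / D := by
      intro i
      rw [← sub_div]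
      rcases le_total (v j) (v i) with h | h
      · rw [Nat.cast_sub h, max_eq_left]
        exact div_nonneg (sub_nonneg.2 (by exact_mod_cast h)) hD0.le
      · rw [Nat.sub_eq_zero_of_le h, max_eq_right]
        · simp
        · exact div_nonpos_of_nonpos_of_nonneg (sub_nonpos.2 (by exact_mod_cast h)) hD0.le
    simp only [this, ← Finset.sum_div]
    push_cast
    field_simp
  obtain ⟨π, j, hπ, hval⟩ := exists_isSmooth_dotProduct_eq hn hs (fun i => (v i : ℝ) / D)
  obtain ⟨j', hj'⟩ := hT'
  have hle : ∀ ρ, IsSmooth ((a : ℝ) / b) ρ → ρ ⬝ᵥ (fun i => (v i : ℝ) / D) ≤ (T : ℝ) / (b * D) := by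
    intro ρ hρ
    have := hρ.dotProduct_le (fun i => (v i : ℝ) / D) ((v j' : ℝ) / D)
    rw [hF, ← hj'] at this
    exact this
  have hge : (T : ℝ) / (b * D) ≤ π ⬝ᵥ (fun i => (v i : ℝ) / D) := by
    rw [hval, hF]
    gcongr
    exact_mod_cast hT j
  exact ⟨π, ⟨hπ, fun ρ hρ => (hle ρ hρ).trans hge⟩, le_antisymm (hle π hπ) hge⟩

end SmoothBandit

namespace SmoothBandit
open scoped ENNReal
open MeasureTheory

/-! ## Pulls of arms -/

namespace Bandit

variable {n : ℕ} (q : Bandit n) (k : ℕ)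

/-- The expected reward of an arm when rewards are truncated to `k` binary digits. -/
noncomputable def truncMean (i : Fin n) : ℝ :=
  ∫ x, (digits k (x : ℝ) : ℝ) / 2 ^ k ∂(q i : Measure unitInterval)

theorem digits_div_mem (x : unitInterval) :
    (digits k (x : ℝ) : ℝ) / 2 ^ k ∈ Set.Icc (0 : ℝ) 1 ∧
    (digits k (x : ℝ) : ℝ) / 2 ^ k ≤ x ∧ (x : ℝ) - 1 / 2 ^ k ≤ (digits k (x : ℝ) : ℝ) / 2 ^ k := by
  have hp : (0 : ℝ) < 2 ^ k := by positivity
  have h1 : (digits k (x : ℝ) : ℝ) ≤ x * 2 ^ k := Nat.floor_le (mul_nonneg x.2.1 hp.le)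
  have h2 : (x : ℝ) * 2 ^ k < digits k (x : ℝ) + 1 := Nat.lt_floor_add_one _
  have h3 : (digits k (x : ℝ) : ℝ) / 2 ^ k ≤ x := by rw [div_le_iff₀ hp]; exact h1
  refine ⟨⟨by positivity, h3.trans x.2.2⟩, h3, ?_⟩
  rw [sub_le_iff_le_add, ← add_div, le_div_iff₀ hp]
  exact h2.le

theorem measurable_trunc :
    Measurable (fun x : unitInterval => (digits k (x : ℝ) : ℝ) / 2 ^ k) :=
  (measurable_from_top.comp (measurable_digits k)).div_const _

theorem abs_truncMean_sub_le (i : Fin n) : |q.truncMean k i - q.utility i| ≤ 1 / 2 ^ k := by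
  unfold truncMean utility
  have hi1 : Integrable (fun x : unitInterval => (digits k (x : ℝ) : ℝ) / 2 ^ k)
      (q i : Measure unitInterval) :=
    Integrable.of_mem_Icc 0 1 (measurable_trunc k).aemeasurable
      (Filter.Eventually.of_forall fun x => (digits_div_mem k x).1)
  have hi2 : Integrable (fun x : unitInterval => (x : ℝ)) (q i : Measure unitInterval) :=
    Integrable.of_mem_Icc 0 1 measurable_subtype_coe.aemeasurable
      (Filter.Eventually.of_forall fun x => x.2)
  rw [← integral_sub hi1 hi2]
  have := norm_integral_le_of_norm_le_const (μ := (q i : Measure unitInterval)) (C := 1 / 2 ^ k)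
    (f := fun x : unitInterval => (digits k (x : ℝ) : ℝ) / 2 ^ k - (x : ℝ))
    (Filter.Eventually.of_forall fun x => by
      obtain ⟨-, h1, h2⟩ := digits_div_mem k x
      rw [Real.norm_eq_abs, abs_le]
      have : (0 : ℝ) ≤ 1 / 2 ^ k := by positivity
      constructor <;> linarith)
  simpa using this

theorem utility_mem (i : Fin n) : 0 ≤ q.utility i ∧ q.utility i ≤ 1 := by
  unfold utility
  refine ⟨integral_nonneg fun x => x.2.1, ?_⟩
  have := integral_mono_of_nonneg (μ := (q i : Measure unitInterval))
    (f := fun x : unitInterval => (x : ℝ)) (g := fun _ => (1 : ℝ))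
    (Filter.Eventually.of_forall fun x => x.2.1) (integrable_const _)
    (Filter.Eventually.of_forall fun x => x.2.2)
  simpa using this

theorem ex_pull (i : Fin n) (f : ℕ → ℝ≥0∞) :
    ex (q.pull k i) f = ∫⁻ x, f (digits k (x : ℝ)) ∂(q i : Measure unitInterval) := by
  unfold ex pull
  simp only [Measure.toPMF_apply]
  rw [← lintegral_map (μ := (q i : Measure unitInterval)) (f := f)
    (g := fun x : unitInterval => digits k (x : ℝ)) measurable_from_top (measurable_digits k),
    lintegral_countable']
  exact tsum_congr fun a => mul_comm _ _

theorem pull_le {i : Fin n} {x : ℕ} (hx : x ∈ (q.pull k i).support) : x ≤ 2 ^ k := by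
  by_contra! hlt
  have h0 : ex (q.pull k i) (fun y => ind (2 ^ k < y)) = 0 := by
    rw [ex_pull]
    refine (lintegral_congr fun y => ?_).trans lintegral_zero
    refine ind_false ?_
    have := (digits_div_mem k y).1.2
    rw [div_le_one (by positivity)] at this
    have : digits k (y : ℝ) ≤ 2 ^ k := by exact_mod_cast this
    omega
  unfold ex at h0
  have := ENNReal.tsum_eq_zero.1 h0 x
  beta_reduce at this
  rw [ind_true hlt, mul_one] at this
  exact (PMF.mem_support_iff _ _).1 hx this

theorem length_pulls {l : List (Fin n)} {xs : List ℕ} (h : xs ∈ (q.pulls k l).support) :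
    xs.length = l.length := by
  induction l generalizing xs with
  | nil =>
    have : xs = [] := mem_support_pure_iff'.1 h
    simp [this]
  | cons i l ih =>
    simp only [pulls, mem_support_bind_iff', mem_support_pure_iff'] at h
    obtain ⟨x, -, ys, hys, rfl⟩ := h
    simp [ih hys]

theorem pulls_le {l : List (Fin n)} {xs : List ℕ} (h : xs ∈ (q.pulls k l).support) :
    ∀ x ∈ xs, x ≤ 2 ^ k := by
  induction l generalizing xs with
  | nil =>
    have : xs = [] := mem_support_pure_iff'.1 h
    simp [this]
  | cons i l ih =>
    simp only [pulls, mem_support_bind_iff', mem_support_pure_iff'] at h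
    obtain ⟨x, hx, ys, hys, rfl⟩ := h
    intro y hy
    rcases List.mem_cons.1 hy with rfl | hy
    · exact q.pull_le k hx
    · exact ih hys y hy

theorem ex_pulls_cons (i : Fin n) (l : List (Fin n)) (f : List ℕ → ℝ≥0∞) :
    ex (q.pulls k (i :: l)) f
      = ex (q.pull k i) (fun x => ex (q.pulls k l) (fun xs => f (x :: xs))) := by
  simp only [pulls, ex_bind, ex_pure]

theorem ex_pulls_append (l₁ l₂ : List (Fin n)) (f : List ℕ → ℝ≥0∞) :
    ex (q.pulls k (l₁ ++ l₂)) f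
      = ex (q.pulls k l₁) (fun xs => ex (q.pulls k l₂) (fun ys => f (xs ++ ys))) := by
  induction l₁ generalizing f with
  | nil => simp [pulls, ex_pure]
  | cons i l ih => simp only [List.cons_append, ex_pulls_cons, ih]

/-- The distribution of a block of rewards. -/
theorem ex_pulls_block (l₁ l₂ l₃ : List (Fin n)) (f : List ℕ → ℝ≥0∞) :
    ex (q.pulls k (l₁ ++ (l₂ ++ l₃))) (fun xs => f ((xs.drop l₁.length).take l₂.length))
      = ex (q.pulls k l₂) f := by
  rw [ex_pulls_append, ← ex_const (q.pulls k l₁) (ex (q.pulls k l₂) f)]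
  refine ex_congr_support _ fun xs hxs => ?_
  rw [ex_pulls_append]
  refine ex_congr_support _ fun ys hys => ?_
  rw [← ex_const (q.pulls k l₃) (f ys)]
  congr 1; funext zs
  rw [← q.length_pulls k hxs, ← q.length_pulls k hys, List.drop_left, List.take_left]

/-! ### Hoeffding's inequality -/

/-- Hoeffding's lemma: a centred variable with values in an interval of length `1` is sub-Gaussian
with parameter `1 / 4`. -/
theorem ex_pull_exp_le (i : Fin n) (t : ℝ) :
    ex (q.pull k i) (fun x => ENNReal.ofReal (Real.exp (t * ((x : ℝ) / 2 ^ k - q.truncMean k i))))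
      ≤ ENNReal.ofReal (Real.exp (t ^ 2 / 8)) := by
  have h := ProbabilityTheory.hasSubgaussianMGF_of_mem_Icc (μ := (q i : Measure unitInterval))
    (a := 0) (b := 1) (measurable_trunc k).aemeasurable
    (Filter.Eventually.of_forall fun x => (digits_div_mem k x).1)
  change ProbabilityTheory.HasSubgaussianMGF
    (fun x : unitInterval => (digits k (x : ℝ) : ℝ) / 2 ^ k - q.truncMean k i) _ _ at h
  rw [ex_pull, ← ofReal_integral_eq_lintegral_ofReal (h.integrable_exp_mul t)
    (Filter.Eventually.of_forall fun x => (Real.exp_pos _).le)]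
  refine ENNReal.ofReal_le_ofReal ((h.mgf_le t).trans (le_of_eq ?_))
  congr 1
  simp
  ring

theorem ex_pulls_exp_le (i : Fin n) (t : ℝ) (m : ℕ) :
    ex (q.pulls k (List.replicate m i)) (fun xs =>
        ENNReal.ofReal (Real.exp (t * ((xs.sum : ℝ) / 2 ^ k - m * q.truncMean k i))))
      ≤ ENNReal.ofReal (Real.exp (m * (t ^ 2 / 8))) := by
  induction m with
  | zero => simp [pulls, ex_pure]
  | succ m ih =>
    rw [List.replicate_succ, ex_pulls_cons]
    have : ∀ (x : ℕ) (xs : List ℕ), ENNReal.ofReal (Real.exp (t * ((((x :: xs).sum : ℕ) : ℝ) / 2 ^ k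
          - ((m + 1 : ℕ) : ℝ) * q.truncMean k i)))
        = ENNReal.ofReal (Real.exp (t * ((x : ℝ) / 2 ^ k - q.truncMean k i))) *
          ENNReal.ofReal (Real.exp (t * ((xs.sum : ℝ) / 2 ^ k - m * q.truncMean k i))) := by
      intro x xs
      rw [← ENNReal.ofReal_mul (Real.exp_pos _).le, ← Real.exp_add]
      congr 2
      rw [List.sum_cons]; push_cast; ring
    simp only [this, ex_const_mul]
    rw [ex_mul_const]
    refine (mul_le_mul' (q.ex_pull_exp_le k i t) ih).trans (le_of_eq ?_)
    rw [← ENNReal.ofReal_mul (Real.exp_pos _).le, ← Real.exp_add]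
    congr 2; push_cast; ring

theorem hoeffding (i : Fin n) (m : ℕ) {δ : ℝ} (hδ : 0 ≤ δ) :
    ex (q.pulls k (List.replicate m i)) (fun xs =>
        ind (m * δ < |(xs.sum : ℝ) / 2 ^ k - m * q.truncMean k i|))
      ≤ ENNReal.ofReal (2 * Real.exp (-(2 * m * δ ^ 2))) := by
  -- Chernoff's bound with the optimal parameter `4 * δ`: the exponent is `m * (4 * δ) ^ 2 / 8 - 4 *
  -- δ * (m * δ) = -(2 * m * δ ^ 2)`. The two summands treat the two tails.
  set c := Real.exp (-(4 * δ * (m * δ))) with hc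
  set Y : List ℕ → ℝ := fun xs => (xs.sum : ℝ) / 2 ^ k - m * q.truncMean k i with hY
  have hle : ∀ xs, ind (m * δ < |Y xs|) ≤
      ENNReal.ofReal c * ENNReal.ofReal (Real.exp (4 * δ * Y xs)) +
      ENNReal.ofReal c * ENNReal.ofReal (Real.exp (-(4 * δ) * Y xs)) := by
    intro xs
    rw [← ENNReal.ofReal_mul (Real.exp_pos _).le, ← ENNReal.ofReal_mul (Real.exp_pos _).le,
      ← Real.exp_add, ← Real.exp_add]
    by_cases h : m * δ < |Y xs|
    · rw [ind_true h]
      rcases lt_abs.1 h with h | h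
      · refine le_add_right ?_
        rw [ENNReal.one_le_ofReal, Real.one_le_exp_iff]
        nlinarith
      · refine le_add_left ?_
        rw [ENNReal.one_le_ofReal, Real.one_le_exp_iff]
        nlinarith
    · rw [ind_false h]; exact zero_le
  refine (ex_mono _ hle).trans ?_
  rw [ex_add, ex_const_mul, ex_const_mul]
  refine (add_le_add (mul_le_mul_right (q.ex_pulls_exp_le k i (4 * δ) m) _)
    (mul_le_mul_right (q.ex_pulls_exp_le k i (-(4 * δ)) m) _)).trans (le_of_eq ?_)
  rw [← ENNReal.ofReal_mul (Real.exp_pos _).le, ← ENNReal.ofReal_mul (Real.exp_pos _).le,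
    ← Real.exp_add, ← Real.exp_add, ← ENNReal.ofReal_add (Real.exp_pos _).le (Real.exp_pos _).le]
  congr 1
  rw [two_mul]
  congr 2 <;> ring

end Bandit

/-! ### Blocks of pulls -/

/-- The list that repeats `p j` exactly `m j` times, for `j = 0, …, G - 1`. -/
def blocks {α : Type*} (G : ℕ) (m : ℕ → ℕ) (p : ℕ → α) : List α :=
  (List.range G).flatMap fun j => List.replicate (m j) (p j)

theorem blocks_succ {α : Type*} (G : ℕ) (m : ℕ → ℕ) (p : ℕ → α) :
    blocks (G + 1) m p = blocks G m p ++ List.replicate (m G) (p G) := by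
  simp [blocks, List.range_succ, List.flatMap_append]

theorem length_blocks {α : Type*} (G : ℕ) (m : ℕ → ℕ) (p : ℕ → α) :
    (blocks G m p).length = ∑ j ∈ Finset.range G, m j := by
  induction G with
  | zero => rfl
  | succ G ih => rw [blocks_succ, List.length_append, ih, List.length_replicate,
      Finset.sum_range_succ]

theorem exists_blocks_eq {α : Type*} {G j : ℕ} (hj : j < G) (m : ℕ → ℕ) (p : ℕ → α) :
    ∃ l, blocks G m p = blocks j m p ++ (List.replicate (m j) (p j) ++ l) := by
  induction G with
  | zero => omega
  | succ G ih =>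
    rw [blocks_succ]
    rcases Nat.lt_succ_iff_lt_or_eq.1 hj with h | rfl
    · obtain ⟨l, hl⟩ := ih h
      exact ⟨l ++ List.replicate (m G) (p G), by rw [hl]; simp⟩
    · exact ⟨[], by simp⟩

/-- The sum of the `j`-th block of `xs`. -/
def blockSum (m : ℕ → ℕ) (xs : List ℕ) (j : ℕ) : ℕ :=
  ∑ l ∈ Finset.range (m j), xs.getD (∑ i ∈ Finset.range j, m i + l) 0

theorem sum_getD_eq (xs : List ℕ) (o m : ℕ) :
    ∑ l ∈ Finset.range m, xs.getD (o + l) 0 = ((xs.drop o).take m).sum := by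
  induction m with
  | zero => simp
  | succ m ih =>
    rw [Finset.sum_range_succ, ih, List.take_add_one, List.sum_append, List.getElem?_drop,
      List.getD_eq_getElem?_getD]
    cases xs[o + m]? <;> simp

theorem Bandit.ex_blockSum {n : ℕ} (q : Bandit n) (k : ℕ) {G j : ℕ} (hj : j < G) (m : ℕ → ℕ)
    (p : ℕ → Fin n) (f : ℕ → ℝ≥0∞) :
    ex (q.pulls k (blocks G m p)) (fun xs => f (blockSum m xs j))
      = ex (q.pulls k (List.replicate (m j) (p j))) (fun xs => f xs.sum) := by
  obtain ⟨l, hl⟩ := exists_blocks_eq hj m p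
  rw [hl, ← q.ex_pulls_block k (blocks j m p) (List.replicate (m j) (p j)) l]
  congr 1; funext xs
  rw [blockSum, sum_getD_eq, length_blocks, List.length_replicate]

/-- A table whose entries below `n` are `blocks G m p`. -/
def armTable (n G M : ℕ) (m p : ℕ → ℕ) : List Data :=
  (List.range (G * M)).map fun t => .nat (if t % M < m (t / M) then p (t / M) else n)

/-- The filler `n` is not an arm, so `armsOf` drops it. Padding all rows to the same length `M` lets
the table be computed entry by entry, without locating the blocks. -/
theorem armsOf_armTable {n G M : ℕ} (hM : 0 < M) {m : ℕ → ℕ} (hm : ∀ j < G, m j ≤ M) {p : ℕ → ℕ}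
    (hp : ∀ j, p j < n) :
    armsOf n (.ofList (armTable n G M m p)) = blocks G m fun j => ⟨p j, hp j⟩ := by
  unfold armsOf
  rw [Data.toList_ofList]
  induction G with
  | zero => simp [armTable, blocks]
  | succ G ih =>
    have hsplit : armTable n (G + 1) M m p = armTable n G M m p ++
        (List.range M).map (fun l => Data.nat (if l < m G then p G else n)) := by
      unfold armTable
      rw [Nat.succ_mul, List.range_add, List.map_append, List.map_map]
      congr 1
      refine List.map_congr_left fun l hl => ?_
      have hl := List.mem_range.1 hl
      have h1 : (G * M + l) % M = l := by
        rw [mul_comm, Nat.mul_add_mod, Nat.mod_eq_of_lt hl]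
      have h2 : (G * M + l) / M = G := by
        rw [mul_comm, Nat.mul_add_div hM, Nat.div_eq_of_lt hl, add_zero]
      simp only [Function.comp, h1, h2]
    rw [hsplit, List.filterMap_append, ih fun j hj => hm j (by omega), blocks_succ]
    congr 1
    obtain ⟨d, hd⟩ := Nat.exists_eq_add_of_le (hm G (by omega))
    rw [hd, List.range_add, List.map_append, List.filterMap_append, List.map_map,
      List.filterMap_map, List.filterMap_map]
    have h1 : ∀ K ≤ m G, List.filterMap ((fun d : Data => if h : d.toNat < n then
        some (⟨d.toNat, h⟩ : Fin n) else none) ∘ fun l => Data.nat (if l < m G then p G else n))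
        (List.range K) = List.replicate K ⟨p G, hp G⟩ := by
      intro K
      induction K with
      | zero => intro _; rfl
      | succ K ihK =>
        intro hK
        have hK' : K < m G := hK
        rw [List.range_succ, List.filterMap_append, ihK (by omega), List.replicate_succ']
        simp [hK', Data.toNat, hp G]
    rw [h1 _ le_rfl]
    conv_rhs => rw [← List.append_nil (List.replicate (m G) _)]
    congr 1
    rw [List.filterMap_eq_nil_iff]
    intro l _
    simp [Data.toNat]

end SmoothBandit

namespace SmoothBandit
open Enc

/-! ## The parameters of the protocol

All are functions of the common input `x = params lam n ε σ`. -/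

def parLam (x : Data) : ℕ := ulen x.fst

def parN (x : Data) : ℕ := ulen x.snd.fst

/-- The number `⌈1 / ε⌉`. -/
def parE (x : Data) : ℕ := ulen x.snd.snd.fst

/-- The number of digits to which rewards are read. -/
def parK (x : Data) : ℕ := parLam x + parN x + parE x

def parSig (x : Data) : ℕ := x.snd.snd.snd.snd.toNat

/-- The number of fractional digits of the committed vector. -/
def fracBits (x : Data) : ℕ := (Data.nat (16 * parN x * parE x)).size

/-- The smoothness parameter is rounded to `numer / denom`, a fraction in lowest terms. -/
def numer (x : Data) : ℕ :=
  if parN x = 1 then 1 else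
    2 * min (max (parSig x * 2 ^ (fracBits x - 1) / 2 ^ parK x + 1)
      (2 ^ (fracBits x - 1) / parN x + 1)) (2 ^ (fracBits x - 1) - 1) + 1

def denom (x : Data) : ℕ := if parN x = 1 then 1 else 2 ^ fracBits x

/-- Slightly more than `4 * s * n` for the rounded parameter `s`. As the offset of the tolerances it
ensures `4 * n` revealing pairs in `le_sum_card`. -/
def scale (x : Data) : ℕ := 4 * numer x * parN x / denom x + 1

/-- The number of positions that the verifier opens. -/
def rounds (x : Data) : ℕ := 4 * parE x * scale x

/-- The number of times that the verifier pulls the arm of round `j`. -/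
def pullCount (x : Data) (j : ℕ) : ℕ :=
  128 * (Data.nat (24 * rounds x)).size *
    (rounds x * rounds x / ((j + 1 + scale x) * (j + 1 + scale x)) + 1)

/-- The number of times that the prover pulls each arm. -/
def proverPulls (x : Data) : ℕ :=
  2048 * (parE x * parE x) * (Data.nat (12 * parN x)).size

/-! ### Elementary properties of the parameters -/

section facts

variable (x : Data)

theorem two_le_fracBits : 2 ≤ fracBits x := Data.two_le_size _

theorem numer_le_denom : numer x ≤ denom x := by
  unfold numer denom
  split
  · exact le_rfl
  · obtain ⟨h, hh⟩ := Nat.exists_eq_add_of_le (two_le_fracBits x)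
    have h1 : 2 ^ fracBits x = 2 * 2 ^ (fracBits x - 1) := by
      rw [hh, ← pow_succ']; congr 1; omega
    have h2 : 0 < 2 ^ (fracBits x - 1) := by positivity
    have h3 := min_le_right (max (parSig x * 2 ^ (fracBits x - 1) / 2 ^ parK x + 1)
      (2 ^ (fracBits x - 1) / parN x + 1)) (2 ^ (fracBits x - 1) - 1)
    omega

theorem numer_pos : 0 < numer x := by
  unfold numer; split <;> omega

theorem denom_pos : 0 < denom x := by
  unfold denom; split
  · norm_num
  · positivity

theorem scale_pos : 0 < scale x := Nat.succ_pos _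

theorem scale_le : scale x ≤ 4 * parN x + 1 := by
  unfold scale
  refine Nat.add_le_add_right (Nat.div_le_of_le_mul ?_) 1
  have := Nat.mul_le_mul_right (4 * parN x) (numer_le_denom x)
  linarith

theorem pullCount_le (j : ℕ) : pullCount x j ≤ pullCount x 0 := by
  unfold pullCount
  gcongr <;> exact Nat.zero_le j

theorem pullCount_pos (j : ℕ) : 0 < pullCount x j := by
  unfold pullCount
  have := Data.two_le_size (Data.nat (24 * rounds x))
  positivity

/-- The numerator is odd and the denominator a power of two, unless both are `1`. So the numerator
and denominator of the rational number are known without computing a gcd. -/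
theorem coprime_numer_denom : (numer x).Coprime (denom x) := by
  unfold numer denom
  split
  · simp
  · exact Nat.Coprime.pow_right _ (by simp)

/-- The rounded smoothness parameter. -/
def smoothRat : ℚ := (numer x : ℚ) / (denom x : ℚ)

theorem smoothRat_num : (smoothRat x).num.toNat = numer x := by
  have := Rat.num_div_eq_of_coprime (a := (numer x : ℤ)) (b := (denom x : ℤ))
    (by exact_mod_cast denom_pos x) (by simpa using coprime_numer_denom x)
  unfold smoothRat
  push_cast at this
  rw [this]; simp

theorem smoothRat_den : (smoothRat x).den = denom x := by
  have := Rat.den_div_eq_of_coprime (a := (numer x : ℤ)) (b := (denom x : ℤ))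
    (by exact_mod_cast denom_pos x) (by simpa using coprime_numer_denom x)
  unfold smoothRat
  push_cast at this
  exact_mod_cast this

theorem smoothRat_cast : ((smoothRat x : ℚ) : ℝ) = (numer x : ℝ) / denom x := by
  simp [smoothRat]

theorem lt_two_pow_size_nat (m : ℕ) : m < 2 ^ ((Data.nat m).size - 1) := by
  refine (Nat.lt_size_self m).trans_le (Nat.pow_le_pow_right (by norm_num) ?_)
  rw [Data.size_nat]; omega

variable {x} (hn : 1 ≤ parN x)
include hn

/-- The prefix-free encoding doubles the number of digits and adds two, so the power exceeds `4 *
(16 * parN x * parE x) ^ 2`. -/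
theorem two_pow_fracBits (he : 1 ≤ parE x) : 1024 * parN x * parE x ≤ 2 ^ fracBits x := by
  have h1 := Nat.lt_size_self (16 * parN x * parE x)
  have h2 : 2 ^ fracBits x
      = 4 * (2 ^ Nat.size (16 * parN x * parE x) * 2 ^ Nat.size (16 * parN x * parE x)) := by
    rw [fracBits, Data.size_nat, ← pow_add]
    rw [show (4 : ℕ) = 2 ^ 2 by norm_num, ← pow_add]; congr 1; ring
  rw [h2]
  have h3 : 16 * parN x * parE x * 16 ≤
      2 ^ Nat.size (16 * parN x * parE x) * 2 ^ Nat.size (16 * parN x * parE x) := by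
    refine Nat.mul_le_mul h1.le (le_trans ?_ h1.le)
    nlinarith [Nat.mul_le_mul hn he]
  linarith

/-- This bound is the purpose of the second argument of the maximum in `numer`. When the minimum
takes effect the fraction is `1 - 1 / denom x`, which is at least `1 / parN x` only if there are two
arms; hence the separate treatment of a single arm. -/
theorem denom_le_mul : denom x ≤ parN x * numer x := by
  unfold numer denom
  split
  · rename_i h; omega
  · have hn2 : 2 ≤ parN x := by omega
    obtain ⟨h, hh⟩ := Nat.exists_eq_add_of_le (two_le_fracBits x)
    have h1 : 2 ^ fracBits x = 2 * 2 ^ (fracBits x - 1) := by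
      rw [hh, ← pow_succ']; congr 1; omega
    have h2 : 0 < 2 ^ (fracBits x - 1) := by positivity
    rw [h1]
    set M := 2 ^ (fracBits x - 1)
    rcases le_total (max (parSig x * M / 2 ^ parK x + 1) (M / parN x + 1)) (M - 1) with h | h
    · rw [min_eq_left h]
      have h3 := le_max_right (parSig x * M / 2 ^ parK x + 1) (M / parN x + 1)
      have h4 : M < parN x * (M / parN x + 1) := by
        have := Nat.lt_div_mul_add (a := M) (b := parN x) hn
        linarith
      calc 2 * M ≤ parN x * (2 * (M / parN x + 1)) := by linarith
        _ ≤ _ := Nat.mul_le_mul_left _ (by omega)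
    · rw [min_eq_right h]
      calc 2 * M ≤ 2 * (2 * (M - 1) + 1) := by omega
        _ ≤ _ := Nat.mul_le_mul_right _ hn2

theorem one_div_le_smooth : 1 / (parN x : ℝ) ≤ (numer x : ℝ) / denom x := by
  have h1 : (0 : ℝ) < parN x := by exact_mod_cast hn
  have h2 : (0 : ℝ) < denom x := by exact_mod_cast denom_pos x
  rw [div_le_div_iff₀ h1 h2, one_mul, mul_comm]
  exact_mod_cast denom_le_mul hn

theorem smoothRat_mem : 1 / (parN x : ℚ) ≤ smoothRat x ∧ smoothRat x ≤ 1 := by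
  constructor
  · unfold smoothRat
    rw [div_le_div_iff₀ (by exact_mod_cast hn) (by exact_mod_cast denom_pos x), one_mul, mul_comm]
    exact_mod_cast denom_le_mul hn
  · unfold smoothRat
    rw [div_le_one (by exact_mod_cast denom_pos x)]
    exact_mod_cast numer_le_denom x

omit hn in
theorem mul_smooth_le_scale : 4 * ((numer x : ℝ) / denom x * parN x) ≤ scale x := by
  have h2 : (0 : ℝ) < denom x := by exact_mod_cast denom_pos x
  have h3 : 4 * numer x * parN x < denom x * scale x := by
    unfold scale
    have := Nat.lt_div_mul_add (a := 4 * numer x * parN x) (b := denom x) (denom_pos x)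
    linarith
  have h3' : (4 * numer x * parN x : ℝ) < denom x * scale x := by exact_mod_cast h3
  rw [div_mul_eq_mul_div, ← mul_div_assoc, div_le_iff₀ h2]
  linarith

omit hn in
theorem scale_le_mul_smooth : (scale x : ℝ) ≤ 4 * ((numer x : ℝ) / denom x * parN x) + 1 := by
  unfold scale
  push_cast
  gcongr
  refine (Nat.cast_div_le).trans (le_of_eq ?_)
  push_cast; ring

end facts

/-! ### The parameters and the real numbers that they approximate -/

section params

variable (lam n : ℕ) (ε σ : ℝ)

@[simp] theorem parLam_params : parLam (params lam n ε σ) = lam := ulen_unary _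
@[simp] theorem parN_params : parN (params lam n ε σ) = n := ulen_unary _
@[simp] theorem parE_params : parE (params lam n ε σ) = ⌈1 / ε⌉₊ := ulen_unary _
@[simp] theorem parK_params : parK (params lam n ε σ) = precision lam n ε := by
  simp [parK, precision]
@[simp] theorem parSig_params :
    parSig (params lam n ε σ) = digits (precision lam n ε) σ := rfl

variable {lam n ε σ}

theorem two_le_ceil (hε : 0 < ε) (hε1 : ε < 1) : 2 ≤ ⌈1 / ε⌉₊ := by
  have : 1 < ⌈1 / ε⌉₊ := by
    rw [Nat.lt_ceil, Nat.cast_one, lt_div_iff₀ hε]; linarith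
  exact this

theorem one_div_ceil_le (hε : 0 < ε) : 1 / (⌈1 / ε⌉₊ : ℝ) ≤ ε := by
  have h := Nat.le_ceil (1 / ε)
  have h0 : 0 < 1 / ε := by positivity
  rw [div_le_iff₀ (h0.trans_le h)]
  rw [div_le_iff₀ hε] at h
  linarith

theorem ceil_le_two_div (hε : 0 < ε) (hε1 : ε < 1) : (⌈1 / ε⌉₊ : ℝ) ≤ 2 / ε := by
  have h := (Nat.ceil_lt_add_one (by positivity : 0 ≤ 1 / ε)).le
  have : 1 ≤ 1 / ε := by rw [le_div_iff₀ hε]; linarith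
  calc (⌈1 / ε⌉₊ : ℝ) ≤ 1 / ε + 1 / ε := by linarith
    _ = 2 / ε := by ring

/-- The rounding of the smoothness parameter. -/
theorem smooth_le_add (hn : 1 ≤ n) (hσ : 1 / (n : ℝ) ≤ σ) :
    (numer (params lam n ε σ) : ℝ) / denom (params lam n ε σ)
      ≤ σ + 3 / 2 ^ fracBits (params lam n ε σ) := by
  set x := params lam n ε σ with hx
  have hn0 : (0 : ℝ) < n := by exact_mod_cast hn
  have hσ0 : 0 < σ := lt_of_lt_of_le (by positivity) hσ
  have hp : (0 : ℝ) < 2 ^ fracBits x := by positivity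
  unfold numer denom
  rw [hx, parN_params, ← hx]
  split
  · rename_i h
    rw [h] at hσ
    have : (0 : ℝ) < 3 / 2 ^ fracBits x := by positivity
    norm_num at hσ ⊢
    linarith
  · obtain ⟨h, hh⟩ := Nat.exists_eq_add_of_le (two_le_fracBits x)
    have h1 : (2 : ℝ) ^ fracBits x = 2 * 2 ^ (fracBits x - 1) := by
      rw [hh, ← pow_succ']; congr 1; omega
    push_cast
    rw [div_le_iff₀ hp, add_mul, div_mul_cancel₀ _ hp.ne', h1]
    have key : ((max (parSig x * 2 ^ (fracBits x - 1) / 2 ^ parK x + 1)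
        (2 ^ (fracBits x - 1) / n + 1) : ℕ) : ℝ) ≤ σ * 2 ^ (fracBits x - 1) + 1 := by
      push_cast
      refine max_le ?_ ?_
      · gcongr
        refine Nat.cast_div_le.trans ?_
        have hd : (parSig x : ℝ) ≤ σ * 2 ^ parK x := by
          rw [hx, parSig_params, parK_params]
          exact Nat.floor_le (by positivity)
        push_cast
        rw [div_le_iff₀ (by positivity)]
        calc (parSig x : ℝ) * 2 ^ (fracBits x - 1) ≤ (σ * 2 ^ parK x) * 2 ^ (fracBits x - 1) := by
              gcongr
          _ = _ := by ring
      · gcongr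
        refine Nat.cast_div_le.trans ?_
        push_cast
        rw [div_eq_mul_one_div, mul_comm]
        gcongr
    have hmin : ((min (max (parSig x * 2 ^ (fracBits x - 1) / 2 ^ parK x + 1)
        (2 ^ (fracBits x - 1) / n + 1)) (2 ^ (fracBits x - 1) - 1) : ℕ) : ℝ)
        ≤ σ * 2 ^ (fracBits x - 1) + 1 :=
      le_trans (by exact_mod_cast min_le_left _ _) key
    push_cast at hmin
    linarith

/-- Reading the digits of `σ` loses at most `1 / 2 ^ precision`. The rounding goes upwards and loses
only when it is capped, at `1 - 1 / 2 ^ fracBits`. -/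
theorem sub_le_smooth (hn : 1 ≤ n) (hσ : 1 / (n : ℝ) ≤ σ) (hσ1 : σ ≤ 1) :
    σ - (1 / 2 ^ precision lam n ε + 1 / 2 ^ fracBits (params lam n ε σ))
      ≤ (numer (params lam n ε σ) : ℝ) / denom (params lam n ε σ) := by
  set x := params lam n ε σ with hx
  have hn0 : (0 : ℝ) < n := by exact_mod_cast hn
  have hσ0 : 0 < σ := lt_of_lt_of_le (by positivity) hσ
  have hp : (0 : ℝ) < 2 ^ fracBits x := by positivity
  have hq : (0 : ℝ) < 2 ^ precision lam n ε := by positivity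
  have hp' : (0 : ℝ) < 1 / 2 ^ fracBits x := by positivity
  have hq' : (0 : ℝ) < 1 / 2 ^ precision lam n ε := by positivity
  unfold numer denom
  rw [hx, parN_params, ← hx]
  split
  · rw [Nat.cast_one, div_one]
    linarith
  · obtain ⟨h, hh⟩ := Nat.exists_eq_add_of_le (two_le_fracBits x)
    have h1 : 2 ^ fracBits x = 2 * 2 ^ (fracBits x - 1) := by
      rw [hh, ← pow_succ']; congr 1; omega
    have h1' : (2 : ℝ) ^ fracBits x = 2 * 2 ^ (fracBits x - 1) := by exact_mod_cast h1
    have h2 : 0 < 2 ^ (fracBits x - 1) := by positivity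
    rcases le_total (max (parSig x * 2 ^ (fracBits x - 1) / 2 ^ parK x + 1)
      (2 ^ (fracBits x - 1) / n + 1)) (2 ^ (fracBits x - 1) - 1) with hm | hm
    · rw [min_eq_left hm]
      have h3 : parSig x * 2 ^ (fracBits x - 1) < 2 ^ parK x *
          max (parSig x * 2 ^ (fracBits x - 1) / 2 ^ parK x + 1) (2 ^ (fracBits x - 1) / n + 1) := by
        refine lt_of_lt_of_le ?_ (Nat.mul_le_mul_left _ (le_max_left _ _))
        have := Nat.lt_div_mul_add (a := parSig x * 2 ^ (fracBits x - 1)) (b := 2 ^ parK x)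
          (by positivity)
        linarith
      set Z := max (parSig x * 2 ^ (fracBits x - 1) / 2 ^ parK x + 1) (2 ^ (fracBits x - 1) / n + 1)
      have h3' : (parSig x : ℝ) * 2 ^ (fracBits x - 1) < 2 ^ parK x * Z := by exact_mod_cast h3
      have h4 : σ * 2 ^ precision lam n ε < parSig x + 1 := by
        rw [hx, parSig_params]; exact Nat.lt_floor_add_one _
      have h5 : σ - 1 / 2 ^ precision lam n ε ≤ (parSig x : ℝ) / 2 ^ precision lam n ε := by
        rw [le_div_iff₀ hq, sub_mul, div_mul_cancel₀ _ hq.ne']; linarith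
      have h6 : (parSig x : ℝ) / 2 ^ precision lam n ε ≤ ((2 * Z + 1 : ℕ) : ℝ) / (2 ^ fracBits x : ℕ) := by
        push_cast
        rw [div_le_div_iff₀ hq hp, h1', ← parK_params lam n ε σ, ← hx]
        have : (0 : ℝ) < 2 ^ parK x := by positivity
        nlinarith
      linarith
    · rw [min_eq_right hm]
      have : 2 * (2 ^ (fracBits x - 1) - 1) + 1 = 2 ^ fracBits x - 1 := by omega
      rw [this, Nat.cast_sub (by omega)]
      push_cast
      rw [sub_div, div_self hp.ne']
      linarith

end params

/-- The representation of a positive number has logarithmic size. -/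
theorem size_nat_le_log {m : ℕ} (hm : 1 ≤ m) {y : ℝ} (hy : (m : ℝ) ≤ y) :
    ((Data.nat m).size : ℝ) ≤ 3 * Real.log y + 4 := by
  have h0 : (0 : ℝ) < m := by exact_mod_cast hm
  have h1 : Nat.size m ≠ 0 := by
    intro h; rw [Nat.size_eq_zero] at h; omega
  have h2 : 2 ^ (Nat.size m - 1) ≤ m := Nat.lt_size.1 (by omega)
  have h3 : ((Nat.size m - 1 : ℕ) : ℝ) * Real.log 2 ≤ Real.log y := by
    rw [← Real.log_pow]
    exact Real.log_le_log (by positivity) (le_trans (by exact_mod_cast h2) hy)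
  rw [Nat.cast_sub (by omega)] at h3
  have h4 := Real.log_two_gt_d9
  have h5 : (1 : ℝ) ≤ Nat.size m := by exact_mod_cast Nat.one_le_iff_ne_zero.2 h1
  rw [Data.size_nat]
  push_cast at h3 ⊢
  nlinarith

end SmoothBandit

namespace SmoothBandit
open Enc

/-! ## Bounds for the parameters -/

theorem log_two_le {y : ℝ} (hy : 2 ≤ y) : (69 / 100 : ℝ) ≤ Real.log y := by
  have h1 := Real.log_two_gt_d9
  have h2 := Real.log_le_log (by norm_num) hy
  linarith

theorem log_mul_le {y : ℝ} (hy : 0 < y) {c : ℝ} (hc : 0 < c) {k : ℕ} (hk : c ≤ 2 ^ k) :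
    Real.log (c * y) ≤ 7 / 10 * k + Real.log y := by
  rw [Real.log_mul hc.ne' hy.ne']
  have h1 := Real.log_two_lt_d9
  have h2 := Real.log_le_log hc hk
  rw [Real.log_pow] at h2
  have : (0 : ℝ) ≤ k := Nat.cast_nonneg k
  nlinarith

section bounds

variable {lam n : ℕ} {ε σ : ℝ}

/-- The rounding error is at most `1 / n`, hence at most `σ`. -/
theorem smooth_le_two_mul (hn : 1 ≤ n) (hε : 0 < ε) (hε1 : ε < 1) (hσ : 1 / (n : ℝ) ≤ σ) :
    (numer (params lam n ε σ) : ℝ) / denom (params lam n ε σ) ≤ 2 * σ := by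
  have h1 := smooth_le_add (lam := lam) (ε := ε) hn hσ
  have h2 := two_pow_fracBits (x := params lam n ε σ) (by simpa using hn)
    (by simpa using (two_le_ceil hε hε1).trans' one_le_two)
  simp only [parN_params, parE_params] at h2
  have h3 := two_le_ceil hε hε1
  have hn0 : (0 : ℝ) < n := by exact_mod_cast hn
  have h4 : (3 * n : ℝ) ≤ 2 ^ fracBits (params lam n ε σ) := by
    have : 3 * n ≤ 2 ^ fracBits (params lam n ε σ) := by nlinarith
    exact_mod_cast this
  have h5 : (3 : ℝ) / 2 ^ fracBits (params lam n ε σ) ≤ 1 / n := by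
    rw [div_le_div_iff₀ (by positivity) hn0]; linarith
  linarith

theorem scale_le_real (hn : 1 ≤ n) (hε : 0 < ε) (hε1 : ε < 1) (hσ : 1 / (n : ℝ) ≤ σ) :
    (scale (params lam n ε σ) : ℝ) ≤ 9 * (n * σ) := by
  have h1 := smooth_le_two_mul (lam := lam) hn hε hε1 hσ
  have h2 := scale_le_mul_smooth (x := params lam n ε σ)
  have hn0 : (0 : ℝ) < n := by exact_mod_cast hn
  have h3 : 1 ≤ n * σ := by rw [div_le_iff₀ hn0] at hσ; linarith
  rw [parN_params] at h2
  nlinarith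

theorem rounds_le_real (hn : 1 ≤ n) (hε : 0 < ε) (hε1 : ε < 1) (hσ : 1 / (n : ℝ) ≤ σ) :
    (rounds (params lam n ε σ) : ℝ) ≤ 72 * (n * σ / ε) := by
  have h1 := scale_le_real (lam := lam) hn hε hε1 hσ
  have h2 := ceil_le_two_div hε hε1
  have h3 : (0 : ℝ) ≤ scale (params lam n ε σ) := Nat.cast_nonneg _
  unfold rounds
  rw [parE_params]
  push_cast
  calc 4 * (⌈1 / ε⌉₊ : ℝ) * scale (params lam n ε σ) ≤ 4 * (2 / ε) * (9 * (n * σ)) := by gcongr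
    _ = _ := by ring

/-- Telescoping, since `1 / (a + 1) ^ 2 ≤ 1 / a - 1 / (a + 1)`. -/
theorem sum_div_sq_le (g G : ℕ) (hg : 0 < g) :
    ∑ j ∈ Finset.range G, (1 : ℝ) / ((j + 1 + g) * (j + 1 + g)) ≤ 1 / g - 1 / (G + g) := by
  induction G with
  | zero => simp
  | succ G ih =>
    rw [Finset.sum_range_succ]
    have h0 : (0 : ℝ) < g := by exact_mod_cast hg
    have h1 : (0 : ℝ) < G + g := by positivity
    have h2 : (0 : ℝ) < G + 1 + g := by positivity
    have h3 : (1 : ℝ) / ((G + 1 + g) * (G + 1 + g)) ≤ 1 / (G + g) - 1 / (G + 1 + g) := by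
      rw [div_sub_div _ _ h1.ne' h2.ne', div_le_div_iff₀ (by positivity) (by positivity)]
      nlinarith
    push_cast
    linarith

theorem rounds_pos (hn : 1 ≤ parE x) : 0 < rounds x := by
  have := scale_pos x
  unfold rounds; positivity

/-- Here the growing tolerances pay off: the inverse squares of the tolerances sum to at most
`rounds ^ 2 / scale = 16 * parE ^ 2 * scale`, whereas the tolerance `1 / (4 * parE)` in every round
would cost another factor of order `parE`. The `+ 1` in `pullCount` contributes at most `rounds ≤ 4
* parE ^ 2 * scale`, and `2560 = 128 * (16 + 4)`. -/
theorem sum_pullCount_le (x : Data) (he : 1 ≤ parE x) :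
    (∑ j ∈ Finset.range (rounds x), (pullCount x j : ℝ))
      ≤ 2560 * (Data.nat (24 * rounds x)).size * ((parE x : ℝ) ^ 2 * scale x) := by
  have hg := scale_pos x
  have hg0 : (0 : ℝ) < scale x := by exact_mod_cast hg
  have he0 : (1 : ℝ) ≤ parE x := by exact_mod_cast he
  set Λ : ℝ := ((Data.nat (24 * rounds x)).size : ℝ) with hΛ
  have hterm : ∀ j : ℕ, (pullCount x j : ℝ) ≤ 128 * Λ *
      ((rounds x : ℝ) ^ 2 * (1 / ((j + 1 + scale x) * (j + 1 + scale x))) + 1) := by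
    intro j
    unfold pullCount
    push_cast
    gcongr
    refine Nat.cast_div_le.trans (le_of_eq ?_)
    push_cast; ring
  refine (Finset.sum_le_sum fun j _ => hterm j).trans ?_
  rw [← Finset.mul_sum, Finset.sum_add_distrib, ← Finset.mul_sum]
  have h1 := sum_div_sq_le (scale x) (rounds x) hg
  have h2 : (0 : ℝ) ≤ 1 / ((rounds x : ℝ) + scale x) := by positivity
  have h3 : (rounds x : ℝ) = 4 * parE x * scale x := by unfold rounds; push_cast; ring
  have h4 : (rounds x : ℝ) ^ 2 * ∑ j ∈ Finset.range (rounds x),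
      (1 : ℝ) / ((j + 1 + scale x) * (j + 1 + scale x)) ≤ 16 * ((parE x : ℝ) ^ 2 * scale x) := by
    calc _ ≤ (rounds x : ℝ) ^ 2 * (1 / scale x) := by gcongr; linarith
      _ = _ := by rw [h3]; field_simp; ring
  have h5 : (rounds x : ℝ) ≤ 4 * ((parE x : ℝ) ^ 2 * scale x) := by
    rw [h3]
    have : (parE x : ℝ) * scale x ≤ (parE x : ℝ) ^ 2 * scale x := by gcongr; nlinarith
    linarith
  have hΛ0 : 0 ≤ Λ := Nat.cast_nonneg _
  simp only [Finset.sum_const, Finset.card_range, nsmul_eq_mul, mul_one]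
  calc 128 * Λ * _ ≤ 128 * Λ * (16 * ((parE x : ℝ) ^ 2 * scale x) + 4 * ((parE x : ℝ) ^ 2 * scale x)) := by
        gcongr
    _ = _ := by ring

theorem size_rounds_le (hn : 1 ≤ n) (hε : 0 < ε) (hε1 : ε < 1) (hσ : 1 / (n : ℝ) ≤ σ) :
    ((Data.nat (24 * rounds (params lam n ε σ))).size : ℝ) ≤ 40 * Real.log (2 * n * σ / ε) := by
  have hn0 : (0 : ℝ) < n := by exact_mod_cast hn
  have h3 : 1 ≤ n * σ := by rw [div_le_iff₀ hn0] at hσ; linarith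
  have hy : 2 ≤ 2 * n * σ / ε := by rw [le_div_iff₀ hε]; nlinarith
  have h1 := rounds_le_real (lam := lam) hn hε hε1 hσ
  have h2 : 1 ≤ 24 * rounds (params lam n ε σ) := by
    have := rounds_pos (x := params lam n ε σ) (by simpa using (two_le_ceil hε hε1).trans' one_le_two)
    omega
  have h4 := size_nat_le_log h2 (y := 864 * (2 * n * σ / ε)) (by
    push_cast
    calc 24 * (rounds (params lam n ε σ) : ℝ) ≤ 24 * (72 * (n * σ / ε)) := by gcongr
      _ = _ := by ring)
  have h5 := log_mul_le (y := 2 * n * σ / ε) (by linarith) (c := 864) (by norm_num) (k := 10)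
    (by norm_num)
  have h6 := log_two_le hy
  push_cast at h5
  linarith

theorem verifier_queries_le (hn : 1 ≤ n) (hε : 0 < ε) (hε1 : ε < 1) (hσ : 1 / (n : ℝ) ≤ σ) :
    (∑ j ∈ Finset.range (rounds (params lam n ε σ)), (pullCount (params lam n ε σ) j : ℝ))
      ≤ 10000000 * (n * σ / ε ^ 2 * Real.log (2 * n * σ / ε) * Real.log (2 / ε)) := by
  have h1 := sum_pullCount_le (params lam n ε σ)
    (by simpa using (two_le_ceil hε hε1).trans' one_le_two)
  have h2 := size_rounds_le (lam := lam) hn hε hε1 hσ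
  have h3 := scale_le_real (lam := lam) hn hε hε1 hσ
  have h4 := ceil_le_two_div hε hε1
  have hn0 : (0 : ℝ) < n := by exact_mod_cast hn
  have hσ0 : 0 < σ := lt_of_lt_of_le (by positivity) hσ
  have h5 : (69 / 100 : ℝ) ≤ Real.log (2 / ε) := log_two_le (by rw [le_div_iff₀ hε]; linarith)
  have h6 : 0 ≤ Real.log (2 * n * σ / ε) := by
    have : (0 : ℝ) ≤ ((Data.nat (24 * rounds (params lam n ε σ))).size : ℝ) := Nat.cast_nonneg _
    linarith
  refine h1.trans ?_
  rw [parE_params]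
  set L := Real.log (2 * n * σ / ε)
  calc _ ≤ 2560 * (40 * L) * ((2 / ε) ^ 2 * (9 * (n * σ))) := by gcongr
    _ = 3686400 * (n * σ / ε ^ 2 * L) := by ring
    -- The factor `log (2 / ε)` is not needed; being at least `69 / 100`, it can be inserted.
    _ ≤ 3686400 * (n * σ / ε ^ 2 * L) * (100 / 69 * Real.log (2 / ε)) := by
        refine le_mul_of_one_le_right (by positivity) (by linarith)
    _ = (3686400 * (100 / 69)) * (n * σ / ε ^ 2 * L * Real.log (2 / ε)) := by ring
    _ ≤ 10000000 * (n * σ / ε ^ 2 * L * Real.log (2 / ε)) := by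
        have : 0 ≤ Real.log (2 / ε) := by linarith
        gcongr; norm_num

theorem prover_queries_le (hn : 1 ≤ n) (hε : 0 < ε) (hε1 : ε < 1) :
    (n * proverPulls (params lam n ε σ) : ℝ)
      ≤ 10000000 * (n * Real.log (2 * n / ε) / ε ^ 2) := by
  have hn0 : (1 : ℝ) ≤ n := by exact_mod_cast hn
  have hy : 2 ≤ 2 * n / ε := by rw [le_div_iff₀ hε]; nlinarith
  have h4 := ceil_le_two_div hε hε1
  have h1 := size_nat_le_log (m := 12 * n) (by omega) (y := 6 * (2 * n / ε)) (by
    push_cast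
    rw [mul_div_assoc', le_div_iff₀ hε]; nlinarith)
  have h5 := log_mul_le (y := 2 * n / ε) (by linarith) (c := 6) (by norm_num) (k := 3)
    (by norm_num)
  have h6 := log_two_le hy
  push_cast at h5
  set L := Real.log (2 * n / ε)
  have h7 : ((Data.nat (12 * n)).size : ℝ) ≤ 20 * L := by linarith
  unfold proverPulls
  rw [parE_params, parN_params]
  push_cast
  calc (n : ℝ) * (2048 * ((⌈1 / ε⌉₊ : ℝ) * ⌈1 / ε⌉₊) * (Data.nat (12 * n)).size)
      ≤ n * (2048 * ((2 / ε) * (2 / ε)) * (20 * L)) := by gcongr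
    _ = 163840 * (n * L / ε ^ 2) := by ring
    _ ≤ _ := by
      have : 0 ≤ L := by linarith
      gcongr; norm_num

/-- The length is at most a constant plus multiples of `log (2 * n)` and `log (2 / ε)`. Both
logarithms are at least `log 2`, so each summand is dominated by the product. -/
theorem fracBits_le (hn : 1 ≤ n) (hε : 0 < ε) (hε1 : ε < 1) :
    (fracBits (params lam n ε σ) : ℝ) ≤ 50 * (Real.log (2 * n) * Real.log (2 / ε) ^ 2) := by
  have hn0 : (1 : ℝ) ≤ n := by exact_mod_cast hn
  have h2 := two_le_ceil hε hε1
  have h4 := ceil_le_two_div hε hε1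
  unfold fracBits
  rw [parE_params, parN_params]
  have h1 := size_nat_le_log (m := 16 * n * ⌈1 / ε⌉₊) (by nlinarith)
    (y := 8 * (2 * n * (2 / ε))) (by
      push_cast
      calc (16 * n * ⌈1 / ε⌉₊ : ℝ) ≤ 16 * n * (2 / ε) := by gcongr
        _ = _ := by ring)
  have hb : (69 / 100 : ℝ) ≤ Real.log (2 / ε) := log_two_le (by rw [le_div_iff₀ hε]; linarith)
  have ha : (69 / 100 : ℝ) ≤ Real.log (2 * n) := log_two_le (by linarith)
  have h5 := log_mul_le (y := 2 * n * (2 / ε)) (by positivity) (c := 8) (by norm_num) (k := 3)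
    (by norm_num)
  rw [Real.log_mul (x := 2 * n) (by positivity) (by positivity)] at h5
  push_cast at h5
  set a := Real.log (2 * n)
  set b := Real.log (2 / ε)
  have hab : 47 / 100 ≤ a * b := by nlinarith
  have hbb : 47 / 100 ≤ b ^ 2 := by nlinarith
  have h6 : 69 / 100 * (47 / 100) ≤ a * b ^ 2 := by nlinarith
  have h7 : a * (47 / 100) ≤ a * b ^ 2 := by gcongr
  have h8 : 47 / 100 * b ≤ a * b ^ 2 := by nlinarith
  linarith

end bounds

/-! ## Poly-time computability of the parameters -/

namespace IsPoly

variable {α : Type} [Enc α] {f : α → Data} {g : α → ℕ}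

@[fun_prop]
theorem parLam (hf : IsPoly f) : IsPoly (fun x => parLam (f x)) := by
  unfold SmoothBandit.parLam; fun_prop

@[fun_prop]
theorem parN (hf : IsPoly f) : IsPoly (fun x => parN (f x)) := by
  unfold SmoothBandit.parN; fun_prop

@[fun_prop]
theorem parE (hf : IsPoly f) : IsPoly (fun x => parE (f x)) := by
  unfold SmoothBandit.parE; fun_prop

@[fun_prop]
theorem parK (hf : IsPoly f) : IsPoly (fun x => parK (f x)) := by
  unfold SmoothBandit.parK; fun_prop

@[fun_prop]
theorem parSig (hf : IsPoly f) : IsPoly (fun x => parSig (f x)) := by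
  unfold SmoothBandit.parSig; fun_prop

@[fun_prop]
theorem fracBits (hf : IsPoly f) : IsPoly (fun x => fracBits (f x)) := by
  unfold SmoothBandit.fracBits; fun_prop

end IsPoly

theorem ulen_le (x : Data) : ulen x ≤ x.size := by unfold ulen; omega

/-- The parameters that serve as loop lengths must be small in value. The bounds here hold for
arbitrary objects and not only for those of the form `params`, because a clock has to hold on all
inputs. -/
theorem polyDom_parN : PolyDom parN Data.size :=
  .of_le fun _ => (ulen_le _).trans ((Data.size_fst_le _).trans (Data.size_snd_le _))

theorem polyDom_parE : PolyDom parE Data.size :=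
  .of_le fun _ => (ulen_le _).trans
    ((Data.size_fst_le _).trans ((Data.size_snd_le _).trans (Data.size_snd_le _)))

theorem polyDom_parLam : PolyDom parLam Data.size :=
  .of_le fun _ => (ulen_le _).trans (Data.size_fst_le _)

theorem polyDom_parK : PolyDom parK Data.size :=
  (polyDom_parLam.add polyDom_parN).add polyDom_parE

theorem size_nat_le (m : ℕ) : (Data.nat m).size ≤ 2 * m + 2 := by
  rw [Data.size_nat]
  have := natSize_le_self m
  omega

theorem polyDom_fracBits : PolyDom fracBits Data.size :=
  ((((PolyDom.const 32 _).mul polyDom_parN).mul polyDom_parE).add (.const 2 _)).mono fun x => by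
    have := size_nat_le (16 * parN x * parE x)
    unfold fracBits
    linarith

theorem polyDom_scale : PolyDom scale Data.size :=
  (((PolyDom.const 4 _).mul polyDom_parN).add (.const 1 _)).mono scale_le

theorem polyDom_rounds : PolyDom rounds Data.size :=
  ((PolyDom.const 4 _).mul polyDom_parE).mul polyDom_scale

theorem polyDom_pullCount : PolyDom (fun x => pullCount x 0) Data.size :=
  (((PolyDom.const 128 _).mul (((PolyDom.const 48 _).mul polyDom_rounds).add (.const 2 _))).mul
    ((polyDom_rounds.mul polyDom_rounds).add (.const 1 _))).mono fun x => by
    unfold pullCount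
    have := size_nat_le (24 * rounds x)
    gcongr
    · linarith
    · exact Nat.div_le_self _ _

theorem polyDom_proverPulls : PolyDom proverPulls Data.size :=
  (((PolyDom.const 2048 _).mul (polyDom_parE.mul polyDom_parE)).mul
    (((PolyDom.const 24 _).mul polyDom_parN).add (.const 2 _))).mono fun x => by
    unfold proverPulls
    have := size_nat_le (12 * parN x)
    gcongr
    linarith

namespace IsPoly

variable {α : Type} [Enc α] {f : α → Data} {g : α → ℕ}

theorem polyDom_comp {h : Data → ℕ} (hh : PolyDom h Data.size) (hf : IsPoly f) :
    PolyDom (fun x => h (f x)) esize :=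
  (hh.comp f).trans hf.polyDom_esize

theorem two_pow_fracBits (hf : IsPoly f) : IsPoly (fun x => 2 ^ SmoothBandit.fracBits (f x)) :=
  two_pow (by fun_prop) (polyDom_comp polyDom_fracBits hf)

theorem two_pow_parK (hf : IsPoly f) : IsPoly (fun x => 2 ^ SmoothBandit.parK (f x)) :=
  two_pow (by fun_prop) (polyDom_comp polyDom_parK hf)

theorem two_pow_fracBits_sub (hf : IsPoly f) :
    IsPoly (fun x => 2 ^ (SmoothBandit.fracBits (f x) - 1)) :=
  two_pow (by fun_prop) ((polyDom_comp polyDom_fracBits hf).mono fun _ => Nat.sub_le _ _)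

@[fun_prop]
theorem numer (hf : IsPoly f) : IsPoly (fun x => numer (f x)) := by
  unfold SmoothBandit.numer
  have h1 := two_pow_fracBits_sub hf
  have h2 := two_pow_parK hf
  exact ite_eq (by fun_prop) (by fun_prop) (by fun_prop) (by fun_prop)

@[fun_prop]
theorem denom (hf : IsPoly f) : IsPoly (fun x => denom (f x)) := by
  unfold SmoothBandit.denom
  have h1 := two_pow_fracBits hf
  exact ite_eq (by fun_prop) (by fun_prop) (by fun_prop) (by fun_prop)

@[fun_prop]
theorem scale (hf : IsPoly f) : IsPoly (fun x => scale (f x)) := by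
  unfold SmoothBandit.scale; fun_prop

@[fun_prop]
theorem rounds (hf : IsPoly f) : IsPoly (fun x => rounds (f x)) := by
  unfold SmoothBandit.rounds; fun_prop

@[fun_prop]
theorem pullCount (hf : IsPoly f) (hg : IsPoly g) : IsPoly (fun x => pullCount (f x) (g x)) := by
  unfold SmoothBandit.pullCount; fun_prop

@[fun_prop]
theorem proverPulls (hf : IsPoly f) : IsPoly (fun x => proverPulls (f x)) := by
  unfold SmoothBandit.proverPulls; fun_prop

end IsPoly
end SmoothBandit

namespace SmoothBandit
open Enc

/-! ## The protocol -/

/-- A p.p.t. algorithm that is run only if it needs at most `W` coins. -/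
def PPT.guarded (A : PPT) (W : ℕ) (x : Data) (r : ℕ) : Data :=
  if A.coins.eval x.size ≤ W then A.runNat x r else .nat 0

section protocol

variable (VC : VectorCommitment) (SN : Snark) (Q : Polynomial ℕ)

/-- The number of coins that every use of a subroutine gets. -/
def width (x : Data) : ℕ := Q.eval x.size

def ppOf (x : Data) (r : ℕ) : Data := VC.keyGen.runNat (.pair x.fst x.snd.fst) r

/-- The relation of the argument system. -/
def relOf (x pp : Data) : Data :=
  .pair pp (.pair x.snd.fst
    (.pair (.pair (.nat (numer x)) (.nat (denom x))) (.unary (fracBits x))))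

def argOf (x pp : Data) (r : ℕ) : Data :=
  (SN.setup.runNat (.pair x.fst (relOf x pp)) r).fst

def setupFn (x : Data) (r : ℕ) : Data :=
  .pair (ppOf VC x (dig (width Q x) 0 r))
    (argOf SN x (ppOf VC x (dig (width Q x) 0 r)) (dig (width Q x) 1 r))

/-! ### The prover -/

/-- The sum of the rewards of arm `i`. -/
def proverSum (x xs : Data) (i : ℕ) : ℕ :=
  ∑ l ∈ Finset.range (proverPulls x), (xs.nth (i * proverPulls x + l)).toNat

/-- The empirical means in fixed-point notation. -/
def estimates (x xs : Data) : List ℕ :=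
  (List.range (parN x)).map fun i =>
    proverSum x xs i * 2 ^ fracBits x / (proverPulls x * 2 ^ parK x)

/-- The value of the dual objective at the threshold `v j`. -/
def dualValue (x v : Data) (j : ℕ) : ℕ :=
  denom x * (v.nth j).toNat +
    numer x * ∑ i ∈ Finset.range (parN x), ((v.nth i).toNat - (v.nth j).toNat)

/-- By duality, the minimum over the entries of the vector as thresholds is the optimal value. The
range is written so as to be nonempty even if `parN x = 0`. -/
def optValue (x v : Data) : ℕ := (Finset.range (parN x - 1 + 1)).inf' (by simp) (dualValue x v)

/-- The remainder makes the entry of every row an arm; on the rows that occur it is the identity. -/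
def proverArmTable (x : Data) : List Data :=
  armTable (parN x) (parN x) (proverPulls x) (fun _ => proverPulls x) (fun j => j % parN x)

/-- The statement that the prover proves. -/
def claim (x pp v : Data) : Data :=
  .pair (VC.commit.code.eval (.pair pp v)).fst (.nat (optValue x v))

def messageOne (x crs v : Data) (r : ℕ) : Data :=
  .pair (claim VC x crs.fst v)
    (SN.prove.runNat (.pair (relOf x crs.fst) (.pair crs.snd (.pair (claim VC x crs.fst v) v)))
      (dig (width Q x) 0 r))

def openingOf (x pp v : Data) (r i j : ℕ) : Data :=
  .pair (.nat (v.nth i).toNat)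
    (VC.opening.runNat (.pair pp (.pair (.nat (v.nth i).toNat)
      (.pair (.nat i) (VC.commit.code.eval (.pair pp v)).snd))) (dig (width Q x) (1 + j) r))

def messageThree (x crs v : Data) (r : ℕ) (m₂ : Data) : Data :=
  .ofList ((List.range (rounds x)).map fun j => openingOf VC Q x crs.fst v r (m₂.nth j).toNat j)

/-! ### The verifier -/

def position (x : Data) (r j : ℕ) : ℕ := dig (width Q x) j r % parN x

def verifierArmTable (x : Data) (r : ℕ) : List Data :=
  armTable (parN x) (rounds x) (pullCount x 0) (pullCount x) (position Q x r)

def positions (x : Data) (r : ℕ) : List ℕ := (List.range (rounds x)).map (position Q x r)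

/-- The sum of the rewards of round `j`. -/
def verifierSum (x ys : Data) (j : ℕ) : ℕ :=
  ∑ l ∈ Finset.range (pullCount x j),
    (ys.nth (∑ i ∈ Finset.range (min j (rounds x)), pullCount x i + l)).toNat

/-- The claimed mean `a / 2 ^ fracBits x` is not close to the empirical mean in round `j`. -/
def Far (x : Data) (S a j : ℕ) : Prop :=
  (j + 1 + scale x) * (pullCount x j * 2 ^ parK x * 2 ^ fracBits x) <
    4 * rounds x * ((a * (pullCount x j * 2 ^ parK x) - S * 2 ^ fracBits x) +
      (S * 2 ^ fracBits x - a * (pullCount x j * 2 ^ parK x)))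

instance (x : Data) (S a j : ℕ) : Decidable (Far x S a j) := by unfold Far; infer_instance

/-- The opening of round `j` is accepted. -/
def openingCheck (x pp c : Data) (i : ℕ) (m : Data) (r : ℕ) : Data :=
  VC.verify.guarded (width Q x)
    (.pair pp (.pair c (.pair (.nat m.fst.toNat) (.pair (.nat i) m.snd)))) r

/-- Blocks of coins with index below `width` are reserved for the positions, block `width` for
checking the argument, and block `width + 1 + j` for checking opening `j`. The checks are thus
independent of the positions. -/
def roundFails (x pp c m ys : Data) (r j : ℕ) : ℕ :=
  if openingCheck VC Q x pp c (position Q x r j) m (dig (width Q x) (width Q x + (1 + j)) r) = .nat 1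
  then if Far x (verifierSum x ys j) m.fst.toNat j then 1 else 0
  else 1

def argCheck (x crs m₁ : Data) (r : ℕ) : Data :=
  SN.verify.guarded (width Q x)
    (.pair (relOf x crs.fst) (.pair crs.snd (.pair m₁.fst m₁.snd))) (dig (width Q x) (width Q x) r)

def outputFn (x crs ys : Data) (r : ℕ) (m₁ m₃ : Data) : Data :=
  if argCheck SN Q x crs m₁ r = .nat 1 then
    if ∑ j ∈ Finset.range (rounds x), roundFails VC Q x crs.fst m₁.fst.fst (m₃.nth j) ys r j = 0 then
      .pair (.nat m₁.fst.snd.toNat) (.nat (denom x * 2 ^ fracBits x))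
    else .nat 0
  else .nat 0

end protocol

/-! ### Poly-time computability -/

namespace IsPoly

variable {α : Type} [Enc α] {x y z u v w : α → Data} {f g h : α → ℕ}
variable (VC : VectorCommitment) (SN : Snark) (Q : Polynomial ℕ)

@[fun_prop]
theorem guarded (A : PPT) (hf : IsPoly f) (hx : IsPoly x) (hg : IsPoly g) :
    IsPoly (fun a => A.guarded (f a) (x a) (g a)) :=
  ite_le (by fun_prop) hf (by fun_prop) (by fun_prop)

@[fun_prop]
theorem width (hx : IsPoly x) : IsPoly (fun a => width Q (x a)) := by
  unfold SmoothBandit.width; fun_prop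

@[fun_prop]
theorem ppOf (hx : IsPoly x) (hf : IsPoly f) : IsPoly (fun a => ppOf VC (x a) (f a)) := by
  unfold SmoothBandit.ppOf; fun_prop

@[fun_prop]
theorem relOf (hx : IsPoly x) (hy : IsPoly y) : IsPoly (fun a => relOf (x a) (y a)) := by
  unfold SmoothBandit.relOf
  have := unary (f := fun a => SmoothBandit.fracBits (x a)) (by fun_prop)
    (polyDom_comp polyDom_fracBits hx)
  fun_prop

@[fun_prop]
theorem argOf (hx : IsPoly x) (hy : IsPoly y) (hf : IsPoly f) :
    IsPoly (fun a => argOf SN (x a) (y a) (f a)) := by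
  unfold SmoothBandit.argOf; fun_prop

@[fun_prop]
theorem setupFn (hx : IsPoly x) (hf : IsPoly f) :
    IsPoly (fun a => setupFn VC SN Q (x a) (f a)) := by
  unfold SmoothBandit.setupFn; fun_prop

@[fun_prop]
theorem proverSum (hx : IsPoly x) (hy : IsPoly y) (hf : IsPoly f) :
    IsPoly (fun a => proverSum (x a) (y a) (f a)) :=
  sum_range (F := fun a l => ((y a).nth (f a * SmoothBandit.proverPulls (x a) + l)).toNat)
    (by fun_prop) (by fun_prop) (polyDom_comp polyDom_proverPulls hx)

@[fun_prop]
theorem estimates (hx : IsPoly x) (hy : IsPoly y) : IsPoly (fun a => estimates (x a) (y a)) := by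
  have h1 : IsPoly (fun a : α × ℕ => 2 ^ SmoothBandit.fracBits (x a.1)) :=
    two_pow_fracBits (by fun_prop)
  have h2 : IsPoly (fun a : α × ℕ => 2 ^ SmoothBandit.parK (x a.1)) := two_pow_parK (by fun_prop)
  exact tabulate (F := fun a i => SmoothBandit.proverSum (x a) (y a) i *
    2 ^ SmoothBandit.fracBits (x a) / (SmoothBandit.proverPulls (x a) * 2 ^ SmoothBandit.parK (x a)))
    (by fun_prop) (by fun_prop) (polyDom_comp polyDom_parN hx)

@[fun_prop]
theorem dualValue (hx : IsPoly x) (hy : IsPoly y) (hf : IsPoly f) :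
    IsPoly (fun a => dualValue (x a) (y a) (f a)) := by
  have := sum_range (K := fun a => SmoothBandit.parN (x a))
    (F := fun a i => ((y a).nth i).toNat - ((y a).nth (f a)).toNat)
    (by fun_prop) (by fun_prop) (polyDom_comp polyDom_parN hx)
  unfold SmoothBandit.dualValue
  fun_prop

@[fun_prop]
theorem optValue (hx : IsPoly x) (hy : IsPoly y) : IsPoly (fun a => optValue (x a) (y a)) :=
  inf_range (F := fun a => SmoothBandit.dualValue (x a) (y a)) (by fun_prop) (by fun_prop)
    ((polyDom_comp polyDom_parN hx).mono fun _ => Nat.sub_le _ _)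

theorem armTable {n G M : α → ℕ} {m p : α → ℕ → ℕ} (hn : IsPoly n) (hG : IsPoly G) (hM : IsPoly M)
    (hGd : PolyDom G esize) (hMd : PolyDom M esize)
    (hm : IsPoly (fun z : α × ℕ => m z.1 z.2)) (hp : IsPoly (fun z : α × ℕ => p z.1 z.2)) :
    IsPoly (fun a => armTable (n a) (G a) (M a) (m a) (p a)) := by
  have hm' := comp (f := fun z : α × ℕ => (z.1, z.2 / M z.1)) hm (by fun_prop)
  have hp' := comp (f := fun z : α × ℕ => (z.1, z.2 / M z.1)) hp (by fun_prop)
  exact tabulate (F := fun a t => Data.nat (if t % M a < m a (t / M a) then p a (t / M a) else n a))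
    (data_nat (ite_lt (mod (by fun_prop) (by fun_prop)) hm' hp' (by fun_prop))) (by fun_prop)
    (hGd.mul hMd)

@[fun_prop]
theorem proverArmTable (hx : IsPoly x) : IsPoly (fun a => proverArmTable (x a)) :=
  armTable (by fun_prop) (by fun_prop) (by fun_prop) (polyDom_comp polyDom_parN hx)
    (polyDom_comp polyDom_proverPulls hx) (by fun_prop) (mod (by fun_prop) (by fun_prop))

@[fun_prop]
theorem claim (hx : IsPoly x) (hy : IsPoly y) (hv : IsPoly v) :
    IsPoly (fun a => claim VC (x a) (y a) (v a)) := by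
  unfold SmoothBandit.claim; fun_prop

@[fun_prop]
theorem messageOne (hx : IsPoly x) (hy : IsPoly y) (hv : IsPoly v) (hf : IsPoly f) :
    IsPoly (fun a => messageOne VC SN Q (x a) (y a) (v a) (f a)) := by
  unfold SmoothBandit.messageOne; fun_prop

@[fun_prop]
theorem openingOf (hx : IsPoly x) (hy : IsPoly y) (hv : IsPoly v) (hf : IsPoly f) (hg : IsPoly g)
    (hh : IsPoly h) : IsPoly (fun a => openingOf VC Q (x a) (y a) (v a) (f a) (g a) (h a)) := by
  unfold SmoothBandit.openingOf; fun_prop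

@[fun_prop]
theorem messageThree (hx : IsPoly x) (hy : IsPoly y) (hv : IsPoly v) (hf : IsPoly f)
    (hw : IsPoly w) : IsPoly (fun a => messageThree VC Q (x a) (y a) (v a) (f a) (w a)) :=
  ofList (tabulate (F := fun a j => SmoothBandit.openingOf VC Q (x a) (y a).fst (v a) (f a)
    ((w a).nth j).toNat j) (by fun_prop) (by fun_prop) (polyDom_comp polyDom_rounds hx))

@[fun_prop]
theorem position (hx : IsPoly x) (hf : IsPoly f) (hg : IsPoly g) :
    IsPoly (fun a => position Q (x a) (f a) (g a)) :=
  mod (by fun_prop) (by fun_prop)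

@[fun_prop]
theorem verifierArmTable (hx : IsPoly x) (hf : IsPoly f) :
    IsPoly (fun a => verifierArmTable Q (x a) (f a)) :=
  armTable (by fun_prop) (by fun_prop) (by fun_prop) (polyDom_comp polyDom_rounds hx)
    (polyDom_comp polyDom_pullCount hx) (by fun_prop) (by fun_prop)

@[fun_prop]
theorem positions (hx : IsPoly x) (hf : IsPoly f) : IsPoly (fun a => positions Q (x a) (f a)) :=
  tabulate (F := fun a => SmoothBandit.position Q (x a) (f a)) (by fun_prop) (by fun_prop)
    (polyDom_comp polyDom_rounds hx)

@[fun_prop]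
theorem verifierSum (hx : IsPoly x) (hy : IsPoly y) (hf : IsPoly f) :
    IsPoly (fun a => verifierSum (x a) (y a) (f a)) := by
  have h1 : IsPoly (fun a => ∑ i ∈ Finset.range (Min.min (f a) (SmoothBandit.rounds (x a))),
      SmoothBandit.pullCount (x a) i) :=
    sum_range (F := fun a i => SmoothBandit.pullCount (x a) i) (by fun_prop) (by fun_prop)
      ((polyDom_comp polyDom_rounds hx).mono fun a => min_le_right _ _)
  have h2 := comp (f := fun a : α × ℕ => a.1) h1 (by fun_prop)
  exact sum_range (F := fun a l => ((y a).nth (∑ i ∈ Finset.range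
      (Min.min (f a) (SmoothBandit.rounds (x a))), SmoothBandit.pullCount (x a) i + l)).toNat)
    (by fun_prop) (by fun_prop) ((polyDom_comp polyDom_pullCount hx).mono fun a => pullCount_le _ _)

@[fun_prop]
theorem openingCheck (hx : IsPoly x) (hy : IsPoly y) (hz : IsPoly z) (hf : IsPoly f)
    (hw : IsPoly w) (hg : IsPoly g) :
    IsPoly (fun a => openingCheck VC Q (x a) (y a) (z a) (f a) (w a) (g a)) := by
  unfold SmoothBandit.openingCheck; fun_prop

@[fun_prop]
theorem roundFails (hx : IsPoly x) (hy : IsPoly y) (hz : IsPoly z) (hw : IsPoly w) (hu : IsPoly u)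
    (hf : IsPoly f) (hg : IsPoly g) :
    IsPoly (fun a => roundFails VC Q (x a) (y a) (z a) (w a) (u a) (f a) (g a)) := by
  unfold SmoothBandit.roundFails Far
  have h1 := two_pow_fracBits hx
  have h2 := two_pow_parK hx
  exact ite_data_eq (by fun_prop) (by fun_prop) (ite_lt (by fun_prop) (by fun_prop) (by fun_prop)
    (by fun_prop)) (by fun_prop)

@[fun_prop]
theorem argCheck (hx : IsPoly x) (hy : IsPoly y) (hz : IsPoly z) (hf : IsPoly f) :
    IsPoly (fun a => argCheck SN Q (x a) (y a) (z a) (f a)) := by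
  unfold SmoothBandit.argCheck; fun_prop

@[fun_prop]
theorem outputFn (hx : IsPoly x) (hy : IsPoly y) (hz : IsPoly z) (hf : IsPoly f) (hu : IsPoly u)
    (hw : IsPoly w) : IsPoly (fun a => outputFn VC SN Q (x a) (y a) (z a) (f a) (u a) (w a)) := by
  unfold SmoothBandit.outputFn
  have h1 := two_pow_fracBits hx
  have h2 := sum_range (K := fun a => SmoothBandit.rounds (x a))
    (F := fun a j => SmoothBandit.roundFails VC Q (x a) (y a).fst (u a).fst.fst ((w a).nth j) (z a) (f a) j)
    (by fun_prop) (by fun_prop) (polyDom_comp polyDom_rounds hx)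
  exact ite_data_eq (by fun_prop) (by fun_prop) (ite_eq (by fun_prop) (by fun_prop) (by fun_prop)
    (by fun_prop)) (by fun_prop)

end IsPoly
end SmoothBandit

/-! ### Programs for the protocol and their supply of coins -/

namespace SmoothBandit
open Enc

/-- The protocol `P` consists of programs for the algorithms above. -/
structure Implements (P : Protocol) (VC : VectorCommitment) (SN : Snark) (Q : Polynomial ℕ) :
    Prop where
  setup_coins : ∀ m, P.setup.coins.eval m = Q.eval m * 2
  setup_eval : ∀ x r, P.setup.code.eval (.pair x (.nat r)) = setupFn VC SN Q x r
  proverCoins : ∀ m, P.proverCoins.eval m = Q.eval m * (Q.eval m + 1)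
  verifierCoins : ∀ m, P.verifierCoins.eval m = Q.eval m * (Q.eval m + (Q.eval m + 1))
  proverQuery : ∀ x r, P.proverQuery.eval (.pair x (.nat r)) = .ofList (proverArmTable x)
  proverFirst : ∀ x r crs xs, P.proverFirst.eval (.pair (.pair x (.nat r)) (.pair crs xs))
    = messageOne VC SN Q x crs (.ofVec (estimates x xs)) r
  proverSecond : ∀ x r crs xs m₂,
    P.proverSecond.eval (.pair (.pair (.pair x (.nat r)) (.pair crs xs)) m₂)
      = messageThree VC Q x crs (.ofVec (estimates x xs)) r m₂
  verifierQuery : ∀ x r, P.verifierQuery.eval (.pair x (.nat r)) = .ofList (verifierArmTable Q x r)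
  verifierChallenge : ∀ x r y m₁, P.verifierChallenge.eval (.pair (.pair (.pair x (.nat r)) y) m₁)
    = .ofVec (positions Q x r)
  verifierOutput : ∀ x r crs ys m₁ m₃, P.verifierOutput.eval
    (.pair (.pair (.pair x (.nat r)) (.pair crs ys)) (.pair m₁ m₃))
      = outputFn VC SN Q x crs ys r m₁ m₃
  proverQuery_cost : PolyDom P.proverQuery.cost Data.size
  proverFirst_cost : PolyDom P.proverFirst.cost Data.size
  proverSecond_cost : PolyDom P.proverSecond.cost Data.size
  verifierQuery_cost : PolyDom P.verifierQuery.cost Data.size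
  verifierChallenge_cost : PolyDom P.verifierChallenge.cost Data.size
  verifierOutput_cost : PolyDom P.verifierOutput.cost Data.size

theorem size_nat_le_of_lt {r m : ℕ} (h : r < 2 ^ m) : (Data.nat r).size ≤ 2 * m + 2 := by
  rw [Data.size_nat]
  have := Nat.size_le.2 h
  omega

/-- Each algorithm, as a function of the whole view of its party, is polynomial by the closure
properties above, so a program for it exists. -/
theorem exists_implements (VC : VectorCommitment) (SN : Snark) (Q : Polynomial ℕ) :
    ∃ P, Implements P VC SN Q := by
  have h0 : IsPoly (fun z : Data => setupFn VC SN Q z.fst z.snd.toNat) := by fun_prop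
  have h1 : IsPoly (fun z : Data => Data.ofList (proverArmTable z.fst)) := by fun_prop
  have h2 : IsPoly (fun z : Data => messageOne VC SN Q z.fst.fst z.snd.fst
    (.ofVec (estimates z.fst.fst z.snd.snd)) z.fst.snd.toNat) := by fun_prop
  have h3 : IsPoly (fun z : Data => messageThree VC Q z.fst.fst.fst z.fst.snd.fst
    (.ofVec (estimates z.fst.fst.fst z.fst.snd.snd)) z.fst.fst.snd.toNat z.snd) := by fun_prop
  have h4 : IsPoly (fun z : Data => Data.ofList (verifierArmTable Q z.fst z.snd.toNat)) := by
    fun_prop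
  have h5 : IsPoly (fun z : Data => Data.ofVec (positions Q z.fst.fst.fst z.fst.fst.snd.toNat)) := by
    fun_prop
  have h6 : IsPoly (fun z : Data => outputFn VC SN Q z.fst.fst.fst z.fst.snd.fst z.fst.snd.snd
    z.fst.fst.snd.toNat z.snd.fst z.snd.snd) := by fun_prop
  obtain ⟨c0, e0, p0, hp0⟩ := h0
  obtain ⟨c1, e1, p1⟩ := h1
  obtain ⟨c2, e2, p2⟩ := h2
  obtain ⟨c3, e3, p3⟩ := h3
  obtain ⟨c4, e4, p4⟩ := h4
  obtain ⟨c5, e5, p5⟩ := h5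
  obtain ⟨c6, e6, p6⟩ := h6
  -- In blocks of `Q` coins: two for the setup; one for the argument and at most `Q` for the
  -- openings of the prover; at most `Q` for the positions of the verifier, then one for the
  -- argument and at most `Q` for the opening checks.
  refine ⟨⟨⟨c0, Q * 2, p0.comp (Polynomial.X + 4 * Q + 3), fun x r hr => ?_⟩, Q * (Q + 1),
    c1, c2, c3, Q * (Q + (Q + 1)), c4, c5, c6⟩, ?_⟩
  · refine (hp0 _).trans ?_
    rw [Polynomial.eval_comp]
    refine eval_mono_nat _ ?_
    have h := size_nat_le_of_lt hr
    have e4 : Polynomial.eval x.size (4 : Polynomial ℕ) = 4 := by simp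
    have e3 : Polynomial.eval x.size (3 : Polynomial ℕ) = 3 := by simp
    have e2 : Polynomial.eval x.size (2 : Polynomial ℕ) = 2 := by simp
    simp only [esize, enc_data, Data.size_pair, Polynomial.eval_add, Polynomial.eval_mul,
      Polynomial.eval_X, e4, e3, e2] at h ⊢
    omega
  · constructor
    · intro m; simp
    · intro x r; exact e0 _
    · intro m; simp
    · intro m; simp
    · intro x r; exact e1 _
    · intro x r crs xs; exact e2 _
    · intro x r crs xs m; exact e3 _
    · intro x r; exact e4 _
    · intro x r y m; exact e5 _
    · intro x r crs ys m m'; exact e6 _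
    · exact p1
    · exact p2
    · exact p3
    · exact p4
    · exact p5
    · exact p6

/-- The polynomial `Q` is large enough for all subroutines of the protocol. -/
structure Suitable (VC : VectorCommitment) (SN : Snark) (Q : Polynomial ℕ) : Prop where
  parN_le : ∀ x, parN x ≤ width Q x
  rounds_le : ∀ x, rounds x ≤ width Q x
  keyGen : ∀ x : Data, VC.keyGen.coins.eval (Data.pair x.fst x.snd.fst).size ≤ width Q x
  setup : ∀ x r, SN.setup.coins.eval (Data.pair x.fst (relOf x (ppOf VC x r))).size ≤ width Q x
  argVerify : ∀ x r r' r'' (v : List ℕ), v.length = parN x → (∀ a ∈ v, a ≤ 2 ^ fracBits x) →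
    SN.verify.coins.eval (Data.pair (relOf x (ppOf VC x r)) (.pair (argOf SN x (ppOf VC x r) r')
      (.pair (claim VC x (ppOf VC x r) (.ofVec v))
        (SN.prove.runNat (.pair (relOf x (ppOf VC x r)) (.pair (argOf SN x (ppOf VC x r) r')
          (.pair (claim VC x (ppOf VC x r) (.ofVec v)) (.ofVec v)))) r'')))).size ≤ width Q x
  opening : ∀ x r (v : List ℕ), v.length = parN x → (∀ a ∈ v, a ≤ 2 ^ fracBits x) →
    ∀ i < parN x, VC.opening.coins.eval (Data.pair (ppOf VC x r) (.pair (.nat (v.getD i 0))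
      (.pair (.nat i) (VC.Aux (ppOf VC x r) v)))).size ≤ width Q x
  verify : ∀ x r r' (v : List ℕ), v.length = parN x → (∀ a ∈ v, a ≤ 2 ^ fracBits x) →
    ∀ i < parN x, VC.verify.coins.eval (Data.pair (ppOf VC x r) (.pair (VC.Com (ppOf VC x r) v)
      (.pair (.nat (v.getD i 0)) (.pair (.nat i) (VC.opening.runNat (.pair (ppOf VC x r)
        (.pair (.nat (v.getD i 0)) (.pair (.nat i) (VC.Aux (ppOf VC x r) v)))) r'))))).size
      ≤ width Q x

theorem size_ofVec_le {v : List ℕ} {h : ℕ} (hv : ∀ a ∈ v, a ≤ 2 ^ h) :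
    (Data.ofVec v).size ≤ 2 + v.length * (2 * h + 5) := by
  have := Data.size_ofList_le (l := v.map Data.nat) (B := 2 * h + 4) (by
    intro d hd
    obtain ⟨a, ha, rfl⟩ := List.mem_map.1 hd
    have := size_nat_le_of_lt (r := a) (m := h + 1) (by
      have := hv a ha; rw [pow_succ]; have : 0 < 2 ^ h := by positivity
      omega)
    omega)
  rw [List.length_map] at this
  unfold Data.ofVec
  refine this.trans (le_of_eq ?_)
  ring

section sizes

variable {ι : Type*} {sz : ι → ℕ}

theorem polyDom_pair {D E : ι → Data} (hD : PolyDom (fun i => (D i).size) sz)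
    (hE : PolyDom (fun i => (E i).size) sz) :
    PolyDom (fun i => (Data.pair (D i) (E i)).size) sz :=
  (((PolyDom.const 1 _).add hD).add hE).mono fun i => by rw [Data.size_pair]

theorem polyDom_fst {D : ι → Data} (hD : PolyDom (fun i => (D i).size) sz) :
    PolyDom (fun i => (D i).fst.size) sz := hD.mono fun _ => Data.size_fst_le _

theorem polyDom_snd {D : ι → Data} (hD : PolyDom (fun i => (D i).size) sz) :
    PolyDom (fun i => (D i).snd.size) sz := hD.mono fun _ => Data.size_snd_le _

theorem polyDom_runNat (A : PPT) {D : ι → Data} (r : ι → ℕ) (hD : PolyDom (fun i => (D i).size) sz) :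
    PolyDom (fun i => (A.runNat (D i) (r i)).size) sz :=
  (hD.eval A.time).mono fun _ => A.size_runNat_le _ _

theorem polyDom_of_isPoly {F : Data × Data → Data} (hF : IsPoly F) {D E : ι → Data}
    (hD : PolyDom (fun i => (D i).size) sz) (hE : PolyDom (fun i => (E i).size) sz) :
    PolyDom (fun i => (F (D i, E i)).size) sz :=
  (hF.polyDom_esize.comp (fun i => (D i, E i))).trans (polyDom_pair hD hE)

theorem polyDom_ppOf (VC : VectorCommitment) {D : ι → Data} (r : ι → ℕ)
    (hD : PolyDom (fun i => (D i).size) sz) : PolyDom (fun i => (ppOf VC (D i) (r i)).size) sz :=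
  polyDom_runNat _ _ (polyDom_pair (polyDom_fst hD) (polyDom_fst (polyDom_snd hD)))

theorem polyDom_relOf {D E : ι → Data} (hD : PolyDom (fun i => (D i).size) sz)
    (hE : PolyDom (fun i => (E i).size) sz) : PolyDom (fun i => (relOf (D i) (E i)).size) sz :=
  polyDom_of_isPoly (F := fun z => relOf z.1 z.2) (by fun_prop) hD hE

theorem polyDom_argOf (SN : Snark) {D E : ι → Data} (r : ι → ℕ)
    (hD : PolyDom (fun i => (D i).size) sz) (hE : PolyDom (fun i => (E i).size) sz) :
    PolyDom (fun i => (argOf SN (D i) (E i) (r i)).size) sz :=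
  polyDom_fst (polyDom_runNat _ _ (polyDom_pair (polyDom_fst hD) (polyDom_relOf hD hE)))

theorem polyDom_commit (VC : VectorCommitment) {D E : ι → Data}
    (hD : PolyDom (fun i => (D i).size) sz) (hE : PolyDom (fun i => (E i).size) sz) :
    PolyDom (fun i => (VC.commit.code.eval (.pair (D i) (E i))).size) sz :=
  polyDom_of_isPoly (F := fun z => VC.commit.code.eval (.pair z.1 z.2)) (by fun_prop) hD hE

theorem polyDom_claim (VC : VectorCommitment) {C D E : ι → Data}
    (hC : PolyDom (fun i => (C i).size) sz)
    (hD : PolyDom (fun i => (D i).size) sz) (hE : PolyDom (fun i => (E i).size) sz) :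
    PolyDom (fun i => (claim VC (C i) (D i) (E i)).size) sz :=
  polyDom_of_isPoly (F := fun z => claim VC z.1 z.2.fst z.2.snd) (by fun_prop) hC
    (polyDom_pair hD hE)

end sizes

/-- Everything an honest party computes has length polynomial in that of `x`, hence so have the coin
demands of the subroutines run on it. The sum of these polynomials serves all of them. -/
theorem exists_suitable (VC : VectorCommitment) (SN : Snark) : ∃ Q, Suitable VC SN Q := by
  -- The index types collect all choices on which honest messages depend (coins, vector and, in `κ`,
  -- a position), so that one polynomial is uniform in them.
  let ι := {z : Data × (ℕ × ℕ × ℕ) × List ℕ // z.2.2.length = parN z.1 ∧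
    ∀ a ∈ z.2.2, a ≤ 2 ^ fracBits z.1}
  let sz : ι → ℕ := fun z => z.1.1.size
  let X : ι → Data := fun z => z.1.1
  let V : ι → Data := fun z => .ofVec z.1.2.2
  let κ := {z : ι × ℕ // z.2 < parN (X z.1)}
  let sz' : κ → ℕ := fun z => sz z.1.1
  have hX : PolyDom (fun i => (X i).size) sz := .refl _
  have hV : PolyDom (fun i => (V i).size) sz :=
    ((PolyDom.const 2 _).add ((polyDom_parN.comp X).mul (((PolyDom.const 2 _).mul
      (polyDom_fracBits.comp X)).add (.const 5 _)))).mono fun i => by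
      have := size_ofVec_le i.2.2
      rw [i.2.1] at this
      exact this
  have hpp := polyDom_ppOf VC (fun i : ι => i.1.2.1.1) hX
  have hrel := polyDom_relOf hX hpp
  have harg := polyDom_argOf SN (fun i : ι => i.1.2.1.2.1) hX hpp
  have hcl := polyDom_claim VC hX hpp hV
  have hpf := polyDom_runNat SN.prove (fun i : ι => i.1.2.1.2.2)
    (polyDom_pair hrel (polyDom_pair harg (polyDom_pair hcl hV)))
  obtain ⟨q1, hq1⟩ := (polyDom_pair hrel (polyDom_pair harg (polyDom_pair hcl hpf))).eval
    SN.verify.coins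
  have hi : PolyDom (fun i : κ => (Data.nat i.1.2).size) sz' :=
    (((PolyDom.const 2 _).mul (polyDom_parN.comp (fun i : κ => X i.1.1))).add (.const 2 _)).mono
      fun i => by
      have := size_nat_le i.1.2
      have := i.2
      omega
  have hc : PolyDom (fun i : κ => (VC.commit.code.eval (.pair (ppOf VC (X i.1.1) i.1.1.1.2.1.1)
      (V i.1.1))).size) sz' := (polyDom_commit VC hpp hV).comp (fun i : κ => i.1.1)
  have ha : PolyDom (fun i : κ => (Data.nat (i.1.1.1.2.2.getD i.1.2 0)).size) sz' :=
    (hV.comp (fun i : κ => i.1.1)).mono fun i => by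
      rw [← Data.nth_ofVec]
      have : ∀ (m : ℕ) (y : Data), (Data.snd^[m] y).size ≤ y.size := by
        intro m
        induction m with
        | zero => intro y; exact le_rfl
        | succ m ih =>
          intro y; rw [Function.iterate_succ_apply]; exact (ih _).trans (Data.size_snd_le y)
      exact (Data.size_fst_le _).trans (this _ _)
  have hpp' := hpp.comp (fun i : κ => i.1.1)
  have hop := polyDom_pair hpp' (polyDom_pair ha (polyDom_pair hi (polyDom_snd hc)))
  obtain ⟨q2, hq2⟩ := hop.eval VC.opening.coins
  have hopf := polyDom_runNat VC.opening (fun i : κ => i.1.1.1.2.1.2.1) hop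
  obtain ⟨q3, hq3⟩ := (polyDom_pair hpp' (polyDom_pair (polyDom_fst hc) (polyDom_pair ha
    (polyDom_pair hi hopf)))).eval VC.verify.coins
  obtain ⟨q4, hq4⟩ := polyDom_parN
  obtain ⟨q5, hq5⟩ := polyDom_rounds
  have hid : PolyDom (fun x : Data => x.size) Data.size := .refl _
  obtain ⟨q6, hq6⟩ := (polyDom_pair (polyDom_fst hid) (polyDom_fst (polyDom_snd hid))).eval
    VC.keyGen.coins
  have hid' : PolyDom (fun x : Data × ℕ => x.1.size) (fun x => x.1.size) := .refl _
  obtain ⟨q7, hq7⟩ := (polyDom_pair (polyDom_fst hid') (polyDom_relOf hid'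
    (polyDom_ppOf VC (fun x : Data × ℕ => x.2) hid'))).eval SN.setup.coins
  refine ⟨q1 + q2 + q3 + q4 + q5 + q6 + q7, ?_⟩
  constructor
  · intro x
    have := hq4 x
    simp only [width, Polynomial.eval_add]; omega
  · intro x
    have := hq5 x
    simp only [width, Polynomial.eval_add]; omega
  · intro x
    refine (hq6 x).trans ?_
    simp only [width, Polynomial.eval_add]; omega
  · intro x r
    refine (hq7 (x, r)).trans ?_
    simp only [width, Polynomial.eval_add]; omega
  · intro x r r' r'' v hv hv'
    have h : _ ≤ q1.eval x.size := hq1 ⟨(x, (r, r', r''), v), hv, hv'⟩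
    refine h.trans ?_
    simp only [width, Polynomial.eval_add]; omega
  · intro x r v hv hv' i hi
    have h : _ ≤ q2.eval x.size := hq2 ⟨(⟨(x, (r, 0, 0), v), hv, hv'⟩, i), hi⟩
    refine h.trans ?_
    simp only [width, Polynomial.eval_add]; omega
  · intro x r r' v hv hv' i hi
    have h : _ ≤ q3.eval x.size := hq3 ⟨(⟨(x, (r, r', 0), v), hv, hv'⟩, i), hi⟩
    refine h.trans ?_
    simp only [width, Polynomial.eval_add]; omega

theorem polyDom_size_params {ι : Type*} (lam n : ι → ℕ) (ε σ : ι → ℝ)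
    (hε : ∀ i, 0 < ε i ∧ ε i < 1) (hσ : ∀ i, 0 ≤ σ i ∧ σ i ≤ 1) :
    PolyDom (fun i => (params (lam i) (n i) (ε i) (σ i)).size)
      (fun i => lam i + n i + ⌈1 / ε i⌉₊) := by
  refine (((PolyDom.const 8 _).mul (.refl _)).add (.const 30 _)).mono fun i => ?_
  have hd : ∀ y : ℝ, 0 ≤ y → y ≤ 1 →
      (Data.nat (digits (precision (lam i) (n i) (ε i)) y)).size
        ≤ 2 * (lam i + n i + ⌈1 / ε i⌉₊) + 4 := by
    intro y h0 h1
    have := size_nat_le_of_lt (r := digits (precision (lam i) (n i) (ε i)) y)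
      (m := precision (lam i) (n i) (ε i) + 1) (by
        rw [digits, Nat.floor_lt (by positivity)]
        push_cast
        have : (0 : ℝ) < 2 ^ precision (lam i) (n i) (ε i) := by positivity
        rw [pow_succ]
        nlinarith)
    unfold precision at this ⊢
    omega
  have h1 := hd _ (hε i).1.le (hε i).2.le
  have h2 := hd _ (hσ i).1 (hσ i).2
  simp only [params, Data.size_pair, Data.size_unary] at h1 h2 ⊢
  omega

/-! ### The distribution of the setup and the arms that are pulled -/

section facts

variable {P : Protocol} {VC : VectorCommitment} {SN : Snark} {Q : Polynomial ℕ}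
  (hP : Implements P VC SN Q) (lam n : ℕ) (ε σ : ℝ)

theorem relOf_params (pp : Data) : relOf (params lam n ε σ) pp
    = relCode pp n (smoothRat (params lam n ε σ)) (fracBits (params lam n ε σ)) := by
  rw [relCode, smoothRat_num, smoothRat_den]; rfl

theorem ppOf_mem (r : ℕ) : ppOf VC (params lam n ε σ) r ∈ (VC.KeyGen lam n).support :=
  runNat_mem_support _ _ _

variable {n} in
theorem position_lt (hn : 1 ≤ n) (r j : ℕ) : position Q (params lam n ε σ) r j < n := by
  rw [position, parN_params]; exact Nat.mod_lt _ hn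

include hP

/-- The trusted setup. -/
theorem Implements.ex_crs (hQ : Suitable VC SN Q) (f : Data → ENNReal) :
    ex (P.crs lam n ε σ) f = ex (VC.KeyGen lam n) fun pp =>
      ex (SN.Setup lam (relCode pp n (smoothRat (params lam n ε σ)) (fracBits (params lam n ε σ))))
        fun o => f (.pair pp o.fst) := by
  set x := params lam n ε σ with hx
  have h1 : ex (P.crs lam n ε σ) f
      = ex (coinFlips (width Q x * 2)) (fun r => f (setupFn VC SN Q x r)) := by
    unfold Protocol.crs PPT.run
    rw [ex_map, hP.setup_coins]
    simp only [hP.setup_eval]; rfl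
  have h2 : width Q x * 2 = width Q x + width Q x := by ring
  rw [h1, h2, ex_coinFlips_add]
  have h3 : ∀ f, ex (VC.KeyGen lam n) f
      = ex (coinFlips (width Q x)) (fun r => f (ppOf VC x (dig (width Q x) 0 r))) := by
    intro f
    have := ex_runNat_dig VC.keyGen (.pair x.fst x.snd.fst) f (j := 0) (J := 1) one_pos (hQ.keyGen x)
    rw [mul_one] at this
    exact this.symm
  rw [h3]
  refine ex_congr_support _ fun r hr => ?_
  have hr := lt_of_mem_coinFlips hr
  have h4 := ex_runNat_dig SN.setup (.pair x.fst (relOf x (ppOf VC x (dig (width Q x) 0 r))))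
    (fun o => f (.pair (ppOf VC x (dig (width Q x) 0 r)) o.fst)) (j := 0) (J := 1) one_pos
    (hQ.setup x _)
  rw [mul_one] at h4
  rw [← relOf_params]
  refine Eq.trans ?_ h4
  congr 1; funext y
  have h5 : dig (width Q x) 0 (r + 2 ^ width Q x * y) = dig (width Q x) 0 r := by
    have := dig_add_low (W := width Q x) (i := 0) (j := 1) (x := r) (y := y) one_pos
    rwa [mul_one] at this
  have h6 : dig (width Q x) 1 (r + 2 ^ width Q x * y) = dig (width Q x) 0 y := by
    have := dig_add_high (W := width Q x) (j := 1) (x := r) (y := y) (by rwa [mul_one]) 0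
    rwa [mul_one] at this
  rw [setupFn, h5, h6]; rfl

theorem Implements.mem_crs {crs : Data} (h : crs ∈ (P.crs lam n ε σ).support) :
    ∃ r r', crs = .pair (ppOf VC (params lam n ε σ) r)
      (argOf SN (params lam n ε σ) (ppOf VC (params lam n ε σ) r) r') := by
  unfold Protocol.crs PPT.run at h
  rw [PMF.support_map] at h
  obtain ⟨r, -, rfl⟩ := h
  exact ⟨_, _, hP.setup_eval _ _⟩

variable (hn : 1 ≤ n)

theorem Implements.proverArms_eq (he : 0 < ε) (r : ℕ) : P.proverArms lam n ε σ r
    = blocks n (fun _ => proverPulls (params lam n ε σ))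
      (fun j => ⟨j % n, Nat.mod_lt _ hn⟩) := by
  unfold Protocol.proverArms
  rw [hP.proverQuery, proverArmTable, parN_params]
  refine armsOf_armTable ?_ (fun _ _ => le_rfl) (fun j => Nat.mod_lt _ hn)
  unfold proverPulls
  rw [parE_params]
  have := Data.two_le_size (Data.nat (12 * parN (params lam n ε σ)))
  have : 0 < ⌈1 / ε⌉₊ := Nat.ceil_pos.2 (by positivity)
  positivity

theorem Implements.verifierArms_eq (r : ℕ) : P.verifierArms lam n ε σ r
    = blocks (rounds (params lam n ε σ)) (pullCount (params lam n ε σ))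
      (fun j => ⟨position Q (params lam n ε σ) r j, position_lt lam ε σ hn r j⟩) := by
  unfold Protocol.verifierArms
  rw [hP.verifierQuery, verifierArmTable, parN_params]
  exact armsOf_armTable (pullCount_pos _ _) (fun _ _ => pullCount_le _ _) _

end facts

theorem proverSum_eq (x : Data) (xs : List ℕ) (i : ℕ) :
    proverSum x (.ofVec xs) i = blockSum (fun _ => proverPulls x) xs i := by
  simp [proverSum, blockSum, Data.nth_ofVec, Data.toNat]

/-- The cap `min j (rounds x)` in `verifierSum` only bounds the inner sum for arbitrary `j`; it has
no effect in an actual round. -/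
theorem verifierSum_eq (x : Data) (ys : List ℕ) {j : ℕ} (hj : j < rounds x) :
    verifierSum x (.ofVec ys) j = blockSum (pullCount x) ys j := by
  simp [verifierSum, blockSum, Data.nth_ofVec, Data.toNat, min_eq_left hj.le]

end SmoothBandit

/-! ### The honest statement, communication and queries -/

namespace SmoothBandit
open Enc

theorem blockSum_const_le {m : ℕ} {xs : List ℕ} {B : ℕ} (h : ∀ a ∈ xs, a ≤ B) (i : ℕ) :
    blockSum (fun _ => m) xs i ≤ m * B := by
  unfold blockSum
  have : ∀ l ∈ Finset.range m, xs.getD (∑ _i ∈ Finset.range i, m + l) 0 ≤ B := by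
    intro l _
    rw [List.getD_eq_getElem?_getD]
    cases hx : xs[∑ _i ∈ Finset.range i, m + l]? with
    | none => exact Nat.zero_le _
    | some a => exact h a (List.mem_of_getElem? hx)
  simpa using Finset.sum_le_card_nsmul _ _ B this

theorem length_estimates (x xs : Data) : (estimates x xs).length = parN x := by
  simp [estimates]

theorem getD_estimates (x : Data) (xs : List ℕ) {i : ℕ} (hi : i < parN x) :
    (estimates x (.ofVec xs)).getD i 0 = blockSum (fun _ => proverPulls x) xs i *
      2 ^ fracBits x / (proverPulls x * 2 ^ parK x) := by
  rw [List.getD_eq_getElem _ _ (by simpa [estimates] using hi)]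
  simp [estimates, proverSum_eq]

theorem estimates_le (x : Data) {xs : List ℕ} (h : ∀ a ∈ xs, a ≤ 2 ^ parK x) :
    ∀ a ∈ estimates x (.ofVec xs), a ≤ 2 ^ fracBits x := by
  intro a ha
  simp only [estimates, List.mem_map, proverSum_eq] at ha
  obtain ⟨i, -, rfl⟩ := ha
  refine Nat.div_le_of_le_mul ?_
  have := blockSum_const_le (m := proverPulls x) h i
  exact Nat.mul_le_mul_right _ this

theorem ofFn_getD {n : ℕ} {v : List ℕ} (hv : v.length = n) :
    List.ofFn (fun i : Fin n => v.getD i 0) = v := by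
  refine List.ext_getElem (by simpa using hv.symm) fun i h1 h2 => ?_
  simp [List.getElem_ofFn, List.getD_eq_getElem?_getD, h2]

section

variable {VC : VectorCommitment} {SN : Snark} {lam n : ℕ} {ε σ : ℝ}

/-- The honest prover proves a true statement. -/
theorem rel_claim (hn : 1 ≤ n) (pp : Data) {v : List ℕ} (hv : v.length = n)
    (hv' : ∀ a ∈ v, a ≤ 2 ^ fracBits (params lam n ε σ)) :
    Rel VC pp n (smoothRat (params lam n ε σ)) (fracBits (params lam n ε σ))
      (claim VC (params lam n ε σ) pp (.ofVec v)) (.ofVec v) := by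
  set x := params lam n ε σ with hx
  have hnx : parN x = n := parN_params _ _ _ _
  have hF : ∀ j, dualValue x (.ofVec v) j = denom x * v.getD j 0 +
      numer x * ∑ i : Fin n, (v.getD i 0 - v.getD j 0) := by
    intro j
    unfold dualValue
    simp only [Data.nth_ofVec, Data.toNat, hnx]
    rw [← Fin.sum_univ_eq_sum_range (fun i => v.getD i 0 - v.getD j 0)]
  have hrange : parN x - 1 + 1 = n := by omega
  have hT : ∀ j : Fin n, optValue x (.ofVec v) ≤ denom x * v.getD j 0 +
      numer x * ∑ i : Fin n, (v.getD i 0 - v.getD j 0) := by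
    intro j
    rw [← hF]
    exact Finset.inf'_le _ (by simp [hrange])
  have hT' : ∃ j : Fin n, optValue x (.ofVec v) = denom x * v.getD j 0 +
      numer x * ∑ i : Fin n, (v.getD i 0 - v.getD j 0) := by
    obtain ⟨j, hj, hj'⟩ := Finset.exists_mem_eq_inf' (s := Finset.range (parN x - 1 + 1))
      (by simp) (dualValue x (.ofVec v))
    refine ⟨⟨j, by simpa [hrange] using hj⟩, ?_⟩
    rw [← hF]; exact hj'
  obtain ⟨π, hπ, hval⟩ := exists_isOptimalSmooth_value hn (denom_pos x)
    (by have := denom_le_mul (x := x) (by omega); rwa [hnx] at this) (2 ^ fracBits x)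
    (by positivity) (fun i : Fin n => v.getD i 0) _ hT hT'
  refine ⟨fun i => v.getD i 0, optValue x (.ofVec v), π, by rw [ofFn_getD hv],
    by rw [ofFn_getD hv]; rfl, fun i => ?_, ?_, ?_⟩
  · refine ⟨by positivity, ?_⟩
    rw [div_le_one (by positivity)]
    have : v.getD i 0 ≤ 2 ^ fracBits x := by
      rw [List.getD_eq_getElem _ _ (by rw [hv]; exact i.2)]
      exact hv' _ (List.getElem_mem _)
    exact_mod_cast this
  · rw [smoothRat_cast]
    simpa using hπ
  · rw [smoothRat_den]
    simpa using hval

/-- At the largest entry as threshold all positive parts vanish, and denominator and entry are each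
at most `2 ^ fracBits`. This bounds the length of the claimed value. -/
theorem optValue_le (hn : 1 ≤ n) {v : List ℕ} (hv : v.length = n)
    (hv' : ∀ a ∈ v, a ≤ 2 ^ fracBits (params lam n ε σ)) :
    optValue (params lam n ε σ) (.ofVec v) ≤ 2 ^ (2 * fracBits (params lam n ε σ)) := by
  set x := params lam n ε σ with hx
  obtain ⟨j, hj, hmax⟩ := Finset.exists_max_image (Finset.range n) (fun i => v.getD i 0)
    ⟨0, Finset.mem_range.2 hn⟩
  have hnx : parN x = n := parN_params _ _ _ _
  have hj := Finset.mem_range.1 hj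
  have h1 : optValue x (.ofVec v) ≤ dualValue x (.ofVec v) j :=
    Finset.inf'_le _ (by rw [Finset.mem_range]; omega)
  have h2 : dualValue x (.ofVec v) j = denom x * v.getD j 0 := by
    unfold dualValue
    simp only [Data.nth_ofVec, Data.toNat, hnx]
    rw [Finset.sum_eq_zero fun i hi => Nat.sub_eq_zero_of_le (hmax i hi), mul_zero, add_zero]
  rw [h2] at h1
  refine h1.trans ?_
  rw [two_mul, pow_add]
  refine Nat.mul_le_mul ?_ ?_
  · unfold denom; split
    · exact Nat.one_le_two_pow
    · exact le_rfl
  · rw [List.getD_eq_getElem _ _ (by omega)]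
    exact hv' _ (List.getElem_mem _)

/-- Every summand is a multiple of a product of some of `κ`, `h` and `G`; the missing factors are
inserted at the cost of constants. -/
theorem message_sizes_le {κ h G : ℕ} (hκ : 2 ≤ κ) (hh : 2 ≤ h) (hG : 1 ≤ G) :
    1 + (1 + κ + (4 * h + 4)) + κ + (2 + G * (1 + h)) + (2 + G * (1 + (1 + (2 * h + 4) + κ)))
      ≤ 27 * (κ * h * G) := by
  have a1 := Nat.mul_le_mul (Nat.mul_le_mul (le_refl κ) hh) hG
  have a2 := Nat.mul_le_mul (Nat.mul_le_mul hκ (le_refl h)) hG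
  have a3 := Nat.mul_le_mul (Nat.mul_le_mul hκ hh) (le_refl G)
  have a4 := Nat.mul_le_mul (Nat.mul_le_mul hκ (le_refl h)) (le_refl G)
  have a5 := Nat.mul_le_mul (Nat.mul_le_mul (le_refl κ) hh) (le_refl G)
  have e1 : G * (1 + h) = G + h * G := by ring
  have e2 : G * (1 + (1 + (2 * h + 4) + κ)) = 6 * G + 2 * (h * G) + κ * G := by ring
  rw [e1, e2]
  rw [mul_assoc] at a4
  rw [mul_right_comm] at a5
  omega

variable {P : Protocol} {Q : Polynomial ℕ} (hP : Implements P VC SN Q)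

include hP

theorem Implements.communication_le {K : ℕ} (hVC : VC.LinearSize K) (hSN : SN.LinearSize VC K)
    (hlam : 1 ≤ lam) (hn : 1 ≤ n) (hε : 0 < ε) (hε1 : ε < 1) (hσ : 1 / (n : ℝ) ≤ σ)
    (e : Execution P lam n ε σ) :
    (e.communication : ℝ) ≤
      10000000 * K * (lam * (σ * n * Real.log (2 * n) * Real.log (2 / ε) ^ 2 / ε)) := by
  set x := params lam n ε σ with hx
  have hnx : parN x = n := parN_params _ _ _ _
  obtain ⟨r, r', hcrs⟩ := hP.mem_crs lam n ε σ e.crs_mem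
  rw [← hx] at hcrs
  set pp := ppOf VC x r with hpp
  set v := estimates x (.ofVec e.proverRewards) with hv
  have hvl : v.length = n := by rw [hv, length_estimates, hnx]
  have hvle : ∀ a ∈ v, a ≤ 2 ^ fracBits x := estimates_le x fun a ha => by
    rw [hx, parK_params]; exact e.proverRewards_le a ha
  have hppm : pp ∈ (VC.KeyGen lam n).support := ppOf_mem lam n ε σ r
  obtain ⟨hcom, hopen⟩ := hVC lam n hlam hn pp hppm v hvl
  have hT := optValue_le hn hvl hvle
  set κ := K * lam with hκ
  set h := fracBits x with hh
  set G := rounds x with hG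
  have hs := smoothRat_mem (x := x) (by omega)
  rw [hnx] at hs
  have hm1 : e.m₁.size ≤ 1 + (1 + κ + (4 * h + 4)) + κ := by
    have e1 : e.m₁ = messageOne VC SN Q x e.crs (.ofVec v) e.proverCoins := hP.proverFirst _ _ _ _
    rw [e1, hcrs, messageOne, Data.size_pair]
    refine Nat.add_le_add (Nat.add_le_add_left ?_ 1) ?_
    · rw [claim, Data.size_pair]
      refine Nat.add_le_add (Nat.add_le_add_left hcom 1) ?_
      have := size_nat_le_of_lt (r := optValue x (.ofVec v)) (m := 2 * h + 1)
        (hT.trans_lt (Nat.pow_lt_pow_right (by norm_num) (by omega)))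
      omega
    · have hrel := rel_claim (VC := VC) (lam := lam) (ε := ε) (σ := σ) hn pp hvl hvle
      refine hSN lam n (smoothRat x) h hlam hn hs.1 hs.2 pp hppm
        (SN.setup.runNat (.pair x.fst (relOf x pp)) r') ?_ _ _ hrel _ ?_
      · rw [← relOf_params]; exact runNat_mem_support _ _ _
      · rw [← relOf_params]; exact runNat_mem_support _ _ _
  have hpos : ∀ j, position Q x e.verifierCoins j < n := position_lt lam ε σ hn _
  have hm2e : e.m₂ = .ofVec (positions Q x e.verifierCoins) := hP.verifierChallenge _ _ _ _
  have hm2 : e.m₂.size ≤ 2 + G * (1 + h) := by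
    rw [hm2e]
    refine (Data.size_ofList_le (B := h) ?_).trans (by simp [positions, hG])
    intro d hd
    simp only [positions, List.map_map, List.mem_map] at hd
    obtain ⟨j, -, rfl⟩ := hd
    simp only [Function.comp, Data.size_nat, hh, fracBits]
    have h1 := hpos j
    -- The number whose length defines `fracBits` exceeds every position, so `h` bits suffice to
    -- send one.
    have h2 : position Q x e.verifierCoins j ≤ 16 * parN x * parE x := by
      rw [hnx, hx, parE_params]
      have := two_le_ceil hε hε1
      nlinarith
    have := Nat.size_le_size h2
    omega
  have hm3 : e.m₃.size ≤ 2 + G * (1 + (1 + (2 * h + 4) + κ)) := by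
    have e3 : e.m₃ = messageThree VC Q x e.crs (.ofVec v) e.proverCoins e.m₂ :=
      hP.proverSecond _ _ _ _ _
    rw [e3, messageThree]
    refine (Data.size_ofList_le (B := 1 + (2 * h + 4) + κ) ?_).trans (by simp [hG])
    intro d hd
    obtain ⟨j, hj, rfl⟩ := List.mem_map.1 hd
    have hi : (e.m₂.nth j).toNat < n := by
      rw [hm2e, Data.nth_ofVec, List.getD_eq_getElem _ _ (by simpa [positions] using hj)]
      simpa [positions, Data.toNat] using hpos j
    set i := (e.m₂.nth j).toNat
    have hgd : v.getD i 0 = v[i]'(by omega) := List.getD_eq_getElem _ _ _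
    rw [openingOf, Data.size_pair, hcrs, Data.nth_ofVec]
    simp only [Data.toNat, Data.fst]
    refine Nat.add_le_add (Nat.add_le_add_left ?_ 1) ?_
    · have := size_nat_le_of_lt (r := v.getD i 0) (m := h + 1) (by
        rw [hgd]
        exact (hvle _ (List.getElem_mem _)).trans_lt (Nat.pow_lt_pow_right (by norm_num) (by omega)))
      omega
    · rw [hgd]
      exact hopen i (by omega) _ (runNat_mem_support _ _ _)
  -- Every object has at least two bits, so the hypothesis on the commitments forces `2 ≤ K * lam`.
  have hκ2 : 2 ≤ κ := (Data.two_le_size _).trans hcom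
  have hh2 : 2 ≤ h := two_le_fracBits x
  have hG1 : 1 ≤ G := rounds_pos (by
    rw [hx, parE_params]; exact (two_le_ceil hε hε1).trans' one_le_two)
  have htot : e.communication ≤ 27 * (κ * h * G) := by
    exact (Nat.add_le_add (Nat.add_le_add hm1 hm2) hm3).trans (message_sizes_le hκ2 hh2 hG1)
  have hfb := fracBits_le (lam := lam) (σ := σ) hn hε hε1
  have hGr := rounds_le_real (lam := lam) hn hε hε1 hσ
  rw [← hx, ← hh] at hfb
  rw [← hx, ← hG] at hGr
  have htot' : (e.communication : ℝ) ≤ 27 * ((κ : ℝ) * h * G) := by exact_mod_cast htot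
  have hn0 : (0 : ℝ) < n := by exact_mod_cast hn
  have hσ0 : 0 < σ := lt_of_lt_of_le (by positivity) hσ
  set A := Real.log (2 * n) * Real.log (2 / ε) ^ 2 with hA
  have hA0 : 0 ≤ A := by
    have : (0 : ℝ) ≤ h := Nat.cast_nonneg _
    linarith
  calc (e.communication : ℝ) ≤ 27 * ((κ : ℝ) * h * G) := htot'
    _ ≤ 27 * ((κ : ℝ) * (50 * A) * (72 * (n * σ / ε))) := by gcongr
    _ = 97200 * ((K : ℝ) * (lam * (n * σ * A / ε))) := by rw [hκ]; push_cast; ring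
    _ ≤ 10000000 * ((K : ℝ) * (lam * (n * σ * A / ε))) := by gcongr; norm_num
    _ = _ := by rw [hA]; ring

theorem Implements.proverQueries_le (hn : 1 ≤ n) (hε : 0 < ε) (hε1 : ε < 1)
    (e : Execution P lam n ε σ) :
    (e.proverQueries : ℝ) ≤ 10000000 * (n * Real.log (2 * n / ε) / ε ^ 2) := by
  unfold Execution.proverQueries
  rw [hP.proverArms_eq lam n ε σ hn hε, length_blocks]
  simpa using prover_queries_le (lam := lam) (σ := σ) hn hε hε1

theorem Implements.verifierQueries_le (hn : 1 ≤ n) (hε : 0 < ε) (hε1 : ε < 1)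
    (hσ : 1 / (n : ℝ) ≤ σ) (e : Execution P lam n ε σ) :
    (e.verifierQueries : ℝ) ≤
      10000000 * (n * σ / ε ^ 2 * Real.log (2 * n * σ / ε) * Real.log (2 / ε)) := by
  unfold Execution.verifierQueries
  rw [hP.verifierArms_eq lam n ε σ hn, length_blocks]
  push_cast
  exact verifier_queries_le hn hε hε1 hσ

end
end SmoothBandit

/-! ### Running times -/

namespace SmoothBandit
open Enc

/-- An execution of a protocol, together with the parameters. -/
structure Run (P : Protocol) where
  lam : ℕ
  n : ℕ
  ε : ℝ
  σ : ℝ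
  hn : 1 ≤ n
  hε : 0 < ε ∧ ε < 1
  hσ : 0 ≤ σ ∧ σ ≤ 1
  e : Execution P lam n ε σ

namespace Run

variable {P : Protocol} {VC : VectorCommitment} {SN : Snark} {Q : Polynomial ℕ}

/-- The quantity in which running times are measured. -/
noncomputable def sz (i : Run P) : ℕ := i.lam + i.n + ⌈1 / i.ε⌉₊

noncomputable def x (i : Run P) : Data := params i.lam i.n i.ε i.σ

theorem polyDom_x : PolyDom (fun i : Run P => i.x.size) sz :=
  polyDom_size_params _ _ _ _ (fun i => i.hε) (fun i => i.hσ)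

theorem polyDom_nat {r c : Run P → ℕ} (hc : PolyDom c sz) (h : ∀ i, r i < 2 ^ c i) :
    PolyDom (fun i => (Data.nat (r i)).size) sz :=
  (((PolyDom.const 2 _).mul hc).add (.const 2 _)).mono fun i => size_nat_le_of_lt (h i)

theorem polyDom_rewards {xs : Run P → List ℕ} (hl : PolyDom (fun i => (xs i).length) sz)
    (h : ∀ i, ∀ a ∈ xs i, a ≤ 2 ^ precision i.lam i.n i.ε) :
    PolyDom (fun i => (Data.ofVec (xs i)).size) sz := by
  have hk : PolyDom (fun i : Run P => precision i.lam i.n i.ε) sz := .refl _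
  exact ((PolyDom.const 2 _).add (hl.mul (((PolyDom.const 2 _).mul hk).add (.const 5 _)))).mono
    fun i => size_ofVec_le (h i)

theorem polyDom_eval {c : Code} (hc : PolyDom c.cost Data.size) {ι : Type*} {s : ι → ℕ}
    {D : ι → Data} (hD : PolyDom (fun i => (D i).size) s) :
    PolyDom (fun i => (c.eval (D i)).size) s :=
  ((hc.comp D).trans hD).mono fun _ => Code.size_eval_le _ _

variable (hP : Implements P VC SN Q)
include hP

theorem polyDom_crs : PolyDom (fun i : Run P => i.e.crs.size) sz := by
  choose r r' h using fun i : Run P => hP.mem_crs i.lam i.n i.ε i.σ i.e.crs_mem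
  have h1 := polyDom_ppOf VC r (polyDom_x (P := P))
  have h2 := polyDom_argOf SN r' (polyDom_x (P := P)) h1
  refine (polyDom_pair h1 h2).mono fun i => ?_
  rw [h i]; exact le_rfl

theorem polyDom_proverView : PolyDom (fun i : Run P =>
    (Protocol.view i.lam i.n i.ε i.σ i.e.crs i.e.proverRewards i.e.proverCoins).size) sz := by
  have hx := polyDom_x (P := P)
  have h1 : PolyDom (fun i : Run P => P.proverCoinCount i.lam i.n i.ε i.σ) sz :=
    hx.eval P.proverCoins
  refine polyDom_pair (polyDom_pair hx (polyDom_nat h1 fun i => i.e.proverCoins_lt))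
    (polyDom_pair (polyDom_crs hP) (polyDom_rewards ?_ fun i => i.e.proverRewards_le))
  refine (((polyDom_parN.comp x).trans hx).mul ((polyDom_proverPulls.comp x).trans hx)).mono
    fun i => ?_
  rw [i.e.proverRewards_length, hP.proverArms_eq _ _ _ _ i.hn i.hε.1, length_blocks]
  simp [x]

theorem polyDom_verifierView : PolyDom (fun i : Run P =>
    (Protocol.view i.lam i.n i.ε i.σ i.e.crs i.e.verifierRewards i.e.verifierCoins).size) sz := by
  have hx := polyDom_x (P := P)
  have h1 : PolyDom (fun i : Run P => P.verifierCoinCount i.lam i.n i.ε i.σ) sz :=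
    hx.eval P.verifierCoins
  refine polyDom_pair (polyDom_pair hx (polyDom_nat h1 fun i => i.e.verifierCoins_lt))
    (polyDom_pair (polyDom_crs hP) (polyDom_rewards ?_ fun i => i.e.verifierRewards_le))
  refine (((polyDom_rounds.comp x).trans hx).mul ((polyDom_pullCount.comp x).trans hx)).mono
    fun i => ?_
  rw [i.e.verifierRewards_length, hP.verifierArms_eq _ _ _ _ i.hn, length_blocks]
  have := Finset.sum_le_card_nsmul (Finset.range (rounds i.x)) (pullCount i.x) (pullCount i.x 0)
    fun j _ => pullCount_le _ _
  exact this.trans (le_of_eq (by simp))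

theorem polyDom_m₁ : PolyDom (fun i : Run P => i.e.m₁.size) sz :=
  polyDom_eval hP.proverFirst_cost (polyDom_proverView hP)

theorem polyDom_m₂ : PolyDom (fun i : Run P => i.e.m₂.size) sz :=
  polyDom_eval hP.verifierChallenge_cost
    (polyDom_pair (polyDom_verifierView hP) (polyDom_m₁ hP))

theorem polyDom_m₃ : PolyDom (fun i : Run P => i.e.m₃.size) sz :=
  polyDom_eval hP.proverSecond_cost (polyDom_pair (polyDom_proverView hP) (polyDom_m₂ hP))

theorem polyDom_proverTime : PolyDom (fun i : Run P => i.e.proverTime) sz := by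
  have hv := polyDom_proverView hP
  have h1 : PolyDom (fun i : Run P =>
      (Data.pair i.x (.nat i.e.proverCoins)).size) sz := polyDom_fst hv
  exact (((hP.proverQuery_cost.comp _).trans h1).add ((hP.proverFirst_cost.comp _).trans hv)).add
    ((hP.proverSecond_cost.comp _).trans (polyDom_pair hv (polyDom_m₂ hP)))

theorem polyDom_verifierTime : PolyDom
    (fun i : Run P × Data × Data => i.1.e.verifierTime i.2.1 i.2.2)
    (fun i => i.1.sz + i.2.1.size + i.2.2.size) := by
  have hs : PolyDom (fun i : Run P × Data × Data => i.1.sz)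
      (fun i => i.1.sz + i.2.1.size + i.2.2.size) := .of_le fun i => by omega
  have ha : PolyDom (fun i : Run P × Data × Data => i.2.1.size)
      (fun i => i.1.sz + i.2.1.size + i.2.2.size) := .of_le fun i => by omega
  have hb : PolyDom (fun i : Run P × Data × Data => i.2.2.size)
      (fun i => i.1.sz + i.2.1.size + i.2.2.size) := .of_le fun i => by omega
  have hv := ((polyDom_verifierView hP).comp (fun i : Run P × Data × Data => i.1)).trans hs
  have h1 : PolyDom (fun i : Run P × Data × Data =>
      (Data.pair i.1.x (.nat i.1.e.verifierCoins)).size)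
      (fun i => i.1.sz + i.2.1.size + i.2.2.size) := polyDom_fst hv
  exact (((hP.verifierQuery_cost.comp _).trans h1).add
    ((hP.verifierChallenge_cost.comp _).trans (polyDom_pair hv ha))).add
    ((hP.verifierOutput_cost.comp _).trans (polyDom_pair hv (polyDom_pair ha hb)))

end Run

/-- Lengths of views and messages are bounded over the family of all runs at once, which makes the
polynomial uniform in the parameters and the random choices. -/
theorem Implements.exists_time {P : Protocol} {VC : VectorCommitment} {SN : Snark}
    {Q : Polynomial ℕ} (hP : Implements P VC SN Q) :
    ∃ T : Polynomial ℕ, ∀ (lam n : ℕ) (ε σ : ℝ), 1 ≤ lam → 1 ≤ n → 0 < ε → ε < 1 →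
      1 / (n : ℝ) ≤ σ → σ ≤ 1 → ∀ e : Execution P lam n ε σ,
        e.proverTime ≤ T.eval (lam + n + ⌈1 / ε⌉₊) ∧
        e.verifierTime e.m₁ e.m₃ ≤ T.eval (lam + n + ⌈1 / ε⌉₊) ∧
        ∀ a₁ a₃ : Data,
          e.verifierTime a₁ a₃ ≤ T.eval (lam + n + ⌈1 / ε⌉₊ + a₁.size + a₃.size) := by
  obtain ⟨T₁, h₁⟩ := Run.polyDom_proverTime hP
  have hv := Run.polyDom_verifierTime hP
  obtain ⟨T₂, h₂⟩ := (hv.comp (fun i : Run P => (i, i.e.m₁, i.e.m₃))).trans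
    (((PolyDom.refl Run.sz).add (Run.polyDom_m₁ hP)).add (Run.polyDom_m₃ hP))
  obtain ⟨T₃, h₃⟩ := hv
  refine ⟨T₁ + T₂ + T₃, fun lam n ε σ _ hn hε hε1 hσ hσ1 e => ?_⟩
  let i : Run P := ⟨lam, n, ε, σ, hn, ⟨hε, hε1⟩, ⟨le_trans (by positivity) hσ, hσ1⟩, e⟩
  have g₁ : e.proverTime ≤ T₁.eval (lam + n + ⌈1 / ε⌉₊) := h₁ i
  have g₂ : e.verifierTime e.m₁ e.m₃ ≤ T₂.eval (lam + n + ⌈1 / ε⌉₊) := h₂ i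
  refine ⟨?_, ?_, fun a₁ a₃ => ?_⟩
  · rw [Polynomial.eval_add, Polynomial.eval_add]; omega
  · rw [Polynomial.eval_add, Polynomial.eval_add]; omega
  · have g₃ : e.verifierTime a₁ a₃ ≤ T₃.eval (lam + n + ⌈1 / ε⌉₊ + a₁.size + a₃.size) :=
      h₃ (i, a₁, a₃)
    rw [Polynomial.eval_add, Polynomial.eval_add]; omega

end SmoothBandit

namespace SmoothBandit
open scoped ENNReal

/-! ## Statistics of the protocol -/

/-- Since `N ≤ 2 ^ size ≤ exp size`, the encoded length of `N`, which programs can compute, replaces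
its logarithm in the numbers of pulls. -/
theorem two_mul_exp_neg_size_le {N : ℕ} (hN : 1 ≤ N) {y : ℝ} (hy : ((Data.nat N).size : ℝ) ≤ y) :
    2 * Real.exp (-y) ≤ 2 / N := by
  have h0 : (0 : ℝ) < N := by exact_mod_cast hN
  have h1 : (N : ℝ) ≤ Real.exp y := by
    have h2 : N ≤ 2 ^ (Data.nat N).size :=
      (lt_two_pow_size_nat N).le.trans (Nat.pow_le_pow_right (by norm_num) (Nat.sub_le _ _))
    calc (N : ℝ) ≤ 2 ^ (Data.nat N).size := by exact_mod_cast h2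
      _ ≤ Real.exp 1 ^ (Data.nat N).size := by
        gcongr
        have := Real.exp_one_gt_d9
        linarith
      _ = Real.exp (Data.nat N).size := by rw [← Real.exp_nat_mul, mul_one]
      _ ≤ _ := Real.exp_le_exp.2 hy
  rw [Real.exp_neg, ← div_eq_mul_inv]
  gcongr

/-- Simultaneous concentration of all blocks of pulls. -/
theorem Bandit.ex_exists_block {n : ℕ} (q : Bandit n) (k : ℕ) {G N : ℕ} (hN : 1 ≤ N) (m : ℕ → ℕ)
    (p : ℕ → Fin n) {δ : ℕ → ℝ} (hδ : ∀ j, 0 ≤ δ j)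
    (h : ∀ j < G, ((Data.nat N).size : ℝ) ≤ 2 * m j * δ j ^ 2) :
    ex (q.pulls k (blocks G m p)) (fun xs => ind (∃ j < G,
      m j * δ j < |(blockSum m xs j : ℝ) / 2 ^ k - m j * q.truncMean k (p j)|))
      ≤ ENNReal.ofReal (G * (2 / N)) := by
  refine (ex_mono _ fun xs => ind_exists_le G _).trans ?_
  rw [ex_sum]
  calc _ ≤ ∑ _j ∈ Finset.range G, ENNReal.ofReal (2 / N) := by
        refine Finset.sum_le_sum fun j hj => ?_
        rw [Finset.mem_range] at hj
        rw [q.ex_blockSum k hj m p (fun S => ind (m j * δ j <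
          |(S : ℝ) / 2 ^ k - m j * q.truncMean k (p j)|))]
        exact (q.hoeffding k (p j) (m j) (hδ j)).trans
          (ENNReal.ofReal_le_ofReal (two_mul_exp_neg_size_le hN (h j hj)))
    _ = _ := by
        rw [Finset.sum_const, Finset.card_range, nsmul_eq_mul,
          ENNReal.ofReal_mul (by positivity), ENNReal.ofReal_natCast]

/-- The tolerance of round `j`, up to a constant factor. -/
noncomputable def tol (x : Data) (j : ℕ) : ℝ := (j + 1 + scale x : ℝ) / rounds x

section

variable {x : Data} (he : 1 ≤ parE x)

include he

theorem tol_ge (j : ℕ) : 1 / (4 * parE x : ℝ) ≤ tol x j := by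
  have h1 : (0 : ℝ) < parE x := by exact_mod_cast he
  have h2 : (0 : ℝ) < scale x := by exact_mod_cast scale_pos x
  unfold tol rounds
  push_cast
  rw [div_le_div_iff₀ (by positivity) (by positivity)]
  have : (0 : ℝ) ≤ j := Nat.cast_nonneg j
  nlinarith

theorem tol_pos (j : ℕ) : 0 < tol x j := by
  have h1 : (0 : ℝ) < parE x := by exact_mod_cast he
  exact lt_of_lt_of_le (by positivity) (tol_ge he j)

/-- The test of the verifier is the inequality with denominators cleared; the sum of the two
truncated differences is the absolute value. -/
theorem far_iff (S a j : ℕ) : Far x S a j ↔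
    tol x j / 4 < |(a : ℝ) / 2 ^ fracBits x - S / (pullCount x j * 2 ^ parK x)| := by
  have hG : (0 : ℝ) < rounds x := by exact_mod_cast rounds_pos he
  have hm : (0 : ℝ) < pullCount x j := by exact_mod_cast pullCount_pos x j
  have habs : ∀ y z : ℕ, (((y - z) + (z - y) : ℕ) : ℝ) = |(y : ℝ) - z| := by
    intro y z
    rcases le_total y z with h | h
    · rw [Nat.sub_eq_zero_of_le h, zero_add, Nat.cast_sub h, abs_sub_comm, abs_of_nonneg]
      have : (y : ℝ) ≤ z := by exact_mod_cast h
      linarith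
    · rw [Nat.sub_eq_zero_of_le h, add_zero, Nat.cast_sub h, abs_of_nonneg]
      have : (z : ℝ) ≤ y := by exact_mod_cast h
      linarith
  unfold Far
  rw [← Nat.cast_lt (α := ℝ), Nat.cast_mul (4 * rounds x), habs]
  push_cast
  have e1 : (a : ℝ) / 2 ^ fracBits x - S / (pullCount x j * 2 ^ parK x)
      = (a * (pullCount x j * 2 ^ parK x) - S * 2 ^ fracBits x)
        / (pullCount x j * 2 ^ parK x * 2 ^ fracBits x) := by
    field_simp
  rw [e1, abs_div, abs_of_pos (by positivity : (0 : ℝ) < pullCount x j * 2 ^ parK x * 2 ^ fracBits x),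
    tol, div_div, div_lt_div_iff₀ (by positivity) (by positivity)]
  constructor <;> intro h <;> linarith

/-- The constant is `128 = 16 ^ 2 / 2`. Hoeffding's inequality with deviation `tol x j / 16` then
has error at most `2 / (24 * rounds x)` in each round, in total `1 / 12`. -/
theorem size_le_pullCount_mul (j : ℕ) :
    ((Data.nat (24 * rounds x)).size : ℝ) ≤ 2 * pullCount x j * (tol x j / 16) ^ 2 := by
  have hG : (0 : ℝ) < rounds x := by exact_mod_cast rounds_pos he
  have hD : 0 < (j + 1 + scale x) * (j + 1 + scale x) := by positivity
  have h1 : rounds x * rounds x ≤ (rounds x * rounds x / ((j + 1 + scale x) * (j + 1 + scale x)) + 1)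
      * ((j + 1 + scale x) * (j + 1 + scale x)) := by
    have := Nat.lt_div_mul_add (a := rounds x * rounds x) hD
    linarith
  have h1' : ((rounds x : ℝ) * rounds x) ≤
      ((rounds x * rounds x / ((j + 1 + scale x) * (j + 1 + scale x)) + 1 : ℕ) : ℝ)
      * ((j + 1 + scale x) * (j + 1 + scale x)) := by exact_mod_cast h1
  unfold pullCount tol
  rw [Nat.cast_mul, Nat.cast_mul]
  set M := ((rounds x * rounds x / ((j + 1 + scale x) * (j + 1 + scale x)) + 1 : ℕ) : ℝ)
  set L := ((Data.nat (24 * rounds x)).size : ℝ)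
  have e1 : 2 * (((128 : ℕ) : ℝ) * L * M) * (((j : ℝ) + 1 + scale x) / rounds x / 16) ^ 2
      = L * (M * ((j + 1 + scale x) * (j + 1 + scale x)) / (rounds x * rounds x)) := by
    field_simp; push_cast; ring
  rw [e1]
  refine le_mul_of_one_le_right (Nat.cast_nonneg _) ?_
  rw [le_div_iff₀ (by positivity), one_mul]
  exact h1'

-- The constant in `proverPulls` is `2048 = 64 ^ 2 / 2`, for the deviation `1 / (64 * parE x)`.
omit he in
theorem size_le_proverPulls_mul (he : 1 ≤ parE x) :
    ((Data.nat (12 * parN x)).size : ℝ) ≤ 2 * proverPulls x * (1 / (64 * parE x)) ^ 2 := by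
  have h1 : (0 : ℝ) < parE x := by exact_mod_cast he
  unfold proverPulls
  push_cast
  apply le_of_eq
  field_simp
  ring

end

/-- The factor `256` comes from `8 ≤ lam`; smaller security parameters are absorbed by the
negligible functions. -/
theorem le_two_pow_precision {lam : ℕ} (n : ℕ) (ε : ℝ) (hlam : 8 ≤ lam) :
    256 * (n * ⌈1 / ε⌉₊) ≤ 2 ^ precision lam n ε := by
  unfold precision
  rw [pow_add, pow_add, mul_assoc]
  exact Nat.mul_le_mul ((by norm_num : 256 ≤ 2 ^ 8).trans (Nat.pow_le_pow_right two_pos hlam))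
    (Nat.mul_le_mul (Nat.lt_two_pow_self).le (Nat.lt_two_pow_self).le)

section

variable {lam n : ℕ} {ε σ : ℝ} (hlam : 8 ≤ lam) (hn : 1 ≤ n) (hε : 0 < ε) (hε1 : ε < 1)
  (q : Bandit n)

include hlam hn hε hε1

theorem abs_truncMean_sub_le_tol (i : Fin n) (j : ℕ) :
    |q.truncMean (precision lam n ε) i - q.utility i| ≤ tol (params lam n ε σ) j / 16 := by
  set x := params lam n ε σ with hx
  have he2 := two_le_ceil hε hε1
  have heq : parE x = ⌈1 / ε⌉₊ := parE_params _ _ _ _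
  have h1 := tol_ge (x := x) (by omega) j
  have h0 : (0 : ℝ) < parE x := by exact_mod_cast (by omega : 0 < parE x)
  refine (q.abs_truncMean_sub_le _ i).trans ?_
  have h2 : 64 * parE x ≤ 2 ^ precision lam n ε := by
    refine le_trans ?_ (le_two_pow_precision n ε hlam)
    rw [heq]
    nlinarith
  have h2' : (64 * parE x : ℝ) ≤ 2 ^ precision lam n ε := by exact_mod_cast h2
  calc (1 : ℝ) / 2 ^ precision lam n ε ≤ 1 / (64 * parE x) := by gcongr
    _ = 1 / (4 * parE x) / 16 := by field_simp; norm_num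
    _ ≤ _ := by linarith

/-- The rounds of the verifier are accurate, except with small probability. -/
theorem ex_exists_round_le (p : ℕ → Fin n) :
    ex (q.pulls (precision lam n ε) (blocks (rounds (params lam n ε σ)) (pullCount (params lam n ε σ)) p))
      (fun ys => ind (∃ j < rounds (params lam n ε σ), tol (params lam n ε σ) j / 8 <
        |(blockSum (pullCount (params lam n ε σ)) ys j : ℝ) /
          (pullCount (params lam n ε σ) j * 2 ^ precision lam n ε) - q.utility (p j)|))
      ≤ ENNReal.ofReal (1 / 12) := by
  set x := params lam n ε σ with hx
  have he2 := two_le_ceil hε hε1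
  have heq : parE x = ⌈1 / ε⌉₊ := parE_params _ _ _ _
  have he : 1 ≤ parE x := by omega
  have hG := rounds_pos he
  have hG' : (0 : ℝ) < rounds x := by exact_mod_cast hG
  refine le_trans ?_ ((q.ex_exists_block (precision lam n ε) (G := rounds x) (N := 24 * rounds x)
    (by omega) (pullCount x) p (δ := fun j => tol x j / 16)
    (fun j => by have := tol_pos he j; positivity)
    (fun j _ => size_le_pullCount_mul he j)).trans (ENNReal.ofReal_le_ofReal ?_))
  · refine ex_mono _ fun ys => ind_mono ?_
    rintro ⟨j, hj, hlt⟩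
    refine ⟨j, hj, ?_⟩
    have hm : (0 : ℝ) < pullCount x j := by exact_mod_cast pullCount_pos x j
    -- Half of `tol / 8` is for the truncation of the rewards and half for the sampling error.
    have h1 := abs_truncMean_sub_le_tol (σ := σ) hlam hn hε hε1 q (p j) j
    rw [← hx] at h1
    set S := (blockSum (pullCount x) ys j : ℝ)
    have h2 : S / 2 ^ precision lam n ε - pullCount x j * q.truncMean (precision lam n ε) (p j)
        = pullCount x j * (S / (pullCount x j * 2 ^ precision lam n ε)
          - q.truncMean (precision lam n ε) (p j)) := by
      field_simp
    rw [h2, abs_mul, abs_of_pos hm]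
    refine mul_lt_mul_of_pos_left ?_ hm
    have h3 := abs_sub_le (S / (pullCount x j * 2 ^ precision lam n ε))
      (q.truncMean (precision lam n ε) (p j)) (q.utility (p j))
    linarith
  · push_cast
    apply le_of_eq
    field_simp; norm_num

/-- The left side is the effect of rounding `σ` on the optimal value, which may use a quarter of the
budget `1 / ⌈1 / ε⌉₊`. -/
theorem mul_abs_smooth_sub_le (hσ : 1 / (n : ℝ) ≤ σ) (hσ1 : σ ≤ 1) :
    n * |(numer (params lam n ε σ) : ℝ) / denom (params lam n ε σ) - σ| ≤ 1 / (4 * ⌈1 / ε⌉₊) := by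
  have he2 := two_le_ceil hε hε1
  have h1 := smooth_le_add (lam := lam) (ε := ε) hn hσ
  have h2 := sub_le_smooth (lam := lam) (ε := ε) hn hσ hσ1
  have h3 := two_pow_fracBits (x := params lam n ε σ) (by simpa using hn) (by simp; omega)
  rw [parN_params, parE_params] at h3
  have h4 := le_two_pow_precision n ε hlam
  set h := fracBits (params lam n ε σ)
  set k := precision lam n ε
  set e := ⌈1 / ε⌉₊
  have h0 : (0 : ℝ) < e := by exact_mod_cast (by omega : 0 < e)
  have hn0 : (0 : ℝ) < n := by exact_mod_cast hn
  have h3' : (1024 * n * e : ℝ) ≤ 2 ^ h := by exact_mod_cast h3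
  have h4' : (256 * (n * e) : ℝ) ≤ 2 ^ k := by exact_mod_cast h4
  have h5 : (1 : ℝ) / 2 ^ h ≤ 1 / (1024 * n * e) := by gcongr
  have h6 : (1 : ℝ) / 2 ^ k ≤ 1 / (256 * (n * e)) := by gcongr
  have h7 : |(numer (params lam n ε σ) : ℝ) / denom (params lam n ε σ) - σ|
      ≤ 1 / (4 * (n * e)) := by
    have e1 : (1 : ℝ) / (1024 * n * e) = 1 / (n * e) / 1024 := by field_simp
    have e2 : (1 : ℝ) / (256 * (n * e)) = 1 / (n * e) / 256 := by field_simp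
    have e3 : (1 : ℝ) / (4 * (n * e)) = 1 / (n * e) / 4 := by field_simp
    have e4 : (3 : ℝ) / 2 ^ h = 3 * (1 / 2 ^ h) := by ring
    have e5 : (0 : ℝ) < 1 / (n * e) := by positivity
    rw [e1] at h5
    rw [e2] at h6
    rw [e4] at h1
    rw [e3, abs_le]
    constructor <;> linarith
  calc _ ≤ (n : ℝ) * (1 / (4 * (n * e))) := by gcongr
    _ = _ := by field_simp

/-- A wrong value is the value of a vector that is far from the utilities. -/
theorem exists_far_of_not_within (hσ : 1 / (n : ℝ) ≤ σ) (hσ1 : σ ≤ 1) {v π : Fin n → ℝ}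
    (h : IsOptimalSmooth ((numer (params lam n ε σ) : ℝ) / denom (params lam n ε σ)) v π)
    (hw : ¬ WithinOfOptimal σ ε q.utility (π ⬝ᵥ v)) :
    ∃ w, IsSmooth ((numer (params lam n ε σ) : ℝ) / denom (params lam n ε σ)) w ∧
      3 / (4 * ⌈1 / ε⌉₊) < ∑ i, w i * |v i - q.utility i| := by
  obtain ⟨π', hπ'⟩ := exists_isOptimalSmooth hn hσ q.utility
  have hs := one_div_le_smooth (x := params lam n ε σ) (by simpa using hn)
  rw [parN_params] at hs
  obtain ⟨w, hw1, hw2⟩ := h.exists_abs_sub_le hn hs hσ q.utility_mem hπ'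
  refine ⟨w, hw1, ?_⟩
  -- Three quarters of `1 / ⌈1 / ε⌉₊` and the quarter for rounding `σ` add up to at most `ε`.
  by_contra! hle
  refine hw ⟨π', hπ', hw2.trans ?_⟩
  have h1 := mul_abs_smooth_sub_le hlam hn hε hε1 hσ hσ1
  have h2 := one_div_ceil_le hε
  have h0 : (0 : ℝ) < ⌈1 / ε⌉₊ := by exact_mod_cast (two_le_ceil hε hε1).trans' one_le_two
  have e1 : (3 : ℝ) / (4 * ⌈1 / ε⌉₊) = 1 / ⌈1 / ε⌉₊ * (3 / 4) := by field_simp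
  have e2 : (1 : ℝ) / (4 * ⌈1 / ε⌉₊) = 1 / ⌈1 / ε⌉₊ * (1 / 4) := by field_simp
  rw [e1] at hle
  rw [e2] at h1
  linarith

end

/-! ### Random positions -/

/-- Every residue occurs at least `2 ^ W / n` times, rounded down, which is at least `2 ^ W / (2 *
n)`. The bias of the remainder thus costs a factor of at most `2`. -/
theorem ex_coinFlips_mod_ge {n W : ℕ} (hn : 1 ≤ n) (hW : n ≤ 2 ^ W) (f : ℕ → ℝ≥0∞) :
    (2 * n : ℝ≥0∞)⁻¹ * ∑ i ∈ Finset.range n, f i ≤ ex (coinFlips W) (fun d => f (d % n)) := by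
  have hsum : ∀ B, ∑ d ∈ Finset.range (n * B), f (d % n) = B * ∑ i ∈ Finset.range n, f i := by
    intro B
    induction B with
    | zero => simp
    | succ B ih =>
      rw [Nat.mul_succ, Finset.sum_range_add, ih, Nat.cast_add, Nat.cast_one, add_mul, one_mul]
      congr 1
      refine Finset.sum_congr rfl fun i hi => ?_
      rw [Nat.mul_add_mod, Nat.mod_eq_of_lt (Finset.mem_range.1 hi)]
  set B := 2 ^ W / n with hB
  have h1 : 1 ≤ B := (Nat.one_le_div_iff hn).2 hW
  have h2 : 2 ^ W ≤ 2 * n * B := by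
    have := Nat.lt_div_mul_add (a := 2 ^ W) (b := n) hn
    rw [← hB] at this
    nlinarith
  rw [ex_coinFlips]
  calc (2 * n : ℝ≥0∞)⁻¹ * ∑ i ∈ Finset.range n, f i
      = ((2 * n : ℝ≥0∞)⁻¹ * (B : ℝ≥0∞)⁻¹) * (B * ∑ i ∈ Finset.range n, f i) := by
        rw [mul_assoc, ← mul_assoc (B : ℝ≥0∞)⁻¹, ENNReal.inv_mul_cancel, one_mul]
        · exact_mod_cast (by omega : B ≠ 0)
        · simp
    _ ≤ (2 ^ W : ℝ≥0∞)⁻¹ * ∑ d ∈ Finset.range (2 ^ W), f (d % n) := by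
        refine mul_le_mul' ?_ ?_
        · rw [← ENNReal.mul_inv (Or.inr (by simp))
            (Or.inl (ENNReal.mul_ne_top (by simp) (by simp))), ENNReal.inv_le_inv]
          exact_mod_cast h2
        · rw [← hsum]
          exact Finset.sum_le_sum_of_subset (Finset.range_subset_range.2 (Nat.mul_div_le _ _))

theorem card_le_ge {G : ℕ} {g D : ℝ} (hg : 0 ≤ g) (hD : D ≤ G) :
    D - g - 1 ≤ (((Finset.range G).filter fun j : ℕ => (j + 1 + g : ℝ) ≤ D).card : ℝ) := by
  rcases le_or_gt (D - g) 0 with h | h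
  · refine le_trans (by linarith) (Nat.cast_nonneg _)
  have h1 : Finset.range ⌊D - g⌋₊ ⊆ (Finset.range G).filter fun j : ℕ => (j + 1 + g : ℝ) ≤ D := by
    intro j hj
    have hj := Finset.mem_range.1 hj
    have h2 : ((j + 1 : ℕ) : ℝ) ≤ D - g := (Nat.le_floor_iff h.le).1 hj
    push_cast at h2
    rw [Finset.mem_filter, Finset.mem_range]
    refine ⟨?_, by linarith⟩
    have : (j : ℝ) < G := by linarith
    exact_mod_cast this
  have h3 := Finset.card_le_card h1
  rw [Finset.card_range] at h3
  have h4 := (Nat.lt_floor_add_one (D - g)).le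
  have h5 : (⌊D - g⌋₊ : ℝ) ≤ (((Finset.range G).filter fun j : ℕ => (j + 1 + g : ℝ) ≤ D).card : ℝ) := by
    exact_mod_cast h3
  linarith

/-- Enough pairs of a round and a position reveal that a vector is far from the utilities. -/
theorem le_sum_card {x : Data} (he : 1 ≤ parE x) {n : ℕ} (hn : parN x = n) {D w : Fin n → ℝ}
    (hD : ∀ i, 0 ≤ D i ∧ D i ≤ 1) (hw : IsSmooth ((numer x : ℝ) / denom x) w)
    (h : 3 / (4 * parE x : ℝ) < ∑ i, w i * D i) :
    (4 * n : ℝ) ≤ ∑ j ∈ Finset.range (rounds x),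
      ((Finset.univ.filter fun i : Fin n => tol x j ≤ D i).card : ℝ) := by
  have hg : (1 : ℝ) ≤ scale x := by exact_mod_cast scale_pos x
  have he0 : (0 : ℝ) < parE x := by exact_mod_cast he
  have hG : (0 : ℝ) < rounds x := by exact_mod_cast rounds_pos he
  have hs : (0 : ℝ) < (numer x : ℝ) / denom x := by
    have h1 : (0 : ℝ) < numer x := by exact_mod_cast numer_pos x
    have h2 : (0 : ℝ) < denom x := by exact_mod_cast denom_pos x
    positivity
  have hsc := mul_smooth_le_scale (x := x)
  rw [hn] at hsc
  set s := (numer x : ℝ) / denom x with hsdef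
  have hswap : ∑ j ∈ Finset.range (rounds x),
      ((Finset.univ.filter fun i : Fin n => tol x j ≤ D i).card : ℝ)
      = ∑ i, (((Finset.range (rounds x)).filter fun j : ℕ => tol x j ≤ D i).card : ℝ) := by
    simp only [Finset.card_filter, Nat.cast_sum]
    rw [Finset.sum_comm]
  rw [hswap]
  have hi : ∀ i, rounds x * D i - scale x - 1 ≤
      (((Finset.range (rounds x)).filter fun j : ℕ => tol x j ≤ D i).card : ℝ) := by
    intro i
    have := card_le_ge (G := rounds x) (g := scale x) (D := rounds x * D i) (by linarith)
      (by have := (hD i).2; nlinarith)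
    refine this.trans (le_of_eq ?_)
    congr 2
    ext j
    simp only [Finset.mem_filter, and_congr_right_iff]
    intro _
    rw [tol, div_le_iff₀ hG, mul_comm]
  set c : Fin n → ℝ := fun i =>
    (((Finset.range (rounds x)).filter fun j : ℕ => tol x j ≤ D i).card : ℝ) with hc
  -- The bound on the count of each position is averaged with `w`; then `w i ≤ s` passes to the
  -- unweighted count.
  have h1 : rounds x * ∑ i, w i * D i - scale x - 1 ≤ s * ∑ i, c i := by
    calc rounds x * ∑ i, w i * D i - scale x - 1
        = ∑ i, w i * (rounds x * D i - scale x - 1) := by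
          simp only [mul_sub, Finset.sum_sub_distrib, ← Finset.sum_mul, hw.2.1, one_mul, mul_one,
            Finset.mul_sum]
          congr 2
          exact Finset.sum_congr rfl fun i _ => by ring
      _ ≤ ∑ i, w i * c i := Finset.sum_le_sum fun i _ =>
          mul_le_mul_of_nonneg_left (hi i) (hw.1 i)
      _ ≤ ∑ i, s * c i := Finset.sum_le_sum fun i _ =>
          mul_le_mul_of_nonneg_right (hw.2.2 i) (Nat.cast_nonneg _)
      _ = _ := by rw [Finset.mul_sum]
  have h2 : (3 * scale x : ℝ) ≤ rounds x * ∑ i, w i * D i := by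
    have hr : (rounds x : ℝ) = 4 * parE x * scale x := by unfold rounds; push_cast; ring
    calc (3 * scale x : ℝ) = rounds x * (3 / (4 * parE x)) := by rw [hr]; field_simp
      _ ≤ _ := by gcongr
  -- Indeed `3 * scale - scale - 1 ≥ scale`, as `scale` is at least `1`.
  have h3 : (scale x : ℝ) ≤ s * ∑ i, c i := by linarith
  have h4 : s * (4 * n) ≤ s * ∑ i, c i := by linarith
  exact le_of_mul_le_mul_left h4 hs

/-- A vector that is far from the utilities is rarely close to them in all rounds. -/
theorem ex_forall_lt_tol_le {x : Data} {Q : Polynomial ℕ} (he : 1 ≤ parE x) {n : ℕ}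
    (hn : parN x = n) (hn1 : 1 ≤ n) (hW : parN x ≤ width Q x) (hG : rounds x ≤ width Q x)
    {D : ℕ → ℝ} {w : Fin n → ℝ}
    (hD : ∀ i, 0 ≤ D i ∧ D i ≤ 1) (hw : IsSmooth ((numer x : ℝ) / denom x) w)
    (h : 3 / (4 * parE x : ℝ) < ∑ i : Fin n, w i * D i) :
    ex (coinFlips (width Q x * width Q x))
      (fun r => ind (∀ j < rounds x, D (position Q x r j) < tol x j)) ≤ ENNReal.ofReal (1 / 6) := by
  have hn0 : (0 : ℝ) < n := by exact_mod_cast hn1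
  set c : ℕ → ℕ := fun j => (Finset.univ.filter fun i : Fin n => tol x j ≤ D i).card with hc
  -- In round `j` there are `c j` revealing positions, hit with probability at least `c j / (2 *
  -- n)`; then `1 - y ≤ exp (-y)`.
  have hround : ∀ j, ex (coinFlips (width Q x)) (fun d => ind (D (d % n) < tol x j))
      ≤ ENNReal.ofReal (Real.exp (-(c j / (2 * n)))) := by
    intro j
    have h1 := ex_add_ex_not (coinFlips (width Q x)) (fun d => tol x j ≤ D (d % n))
    have h2 := ex_coinFlips_mod_ge hn1 (W := width Q x)
      ((hn ▸ hW).trans (Nat.lt_two_pow_self).le) (fun i => ind (tol x j ≤ D i))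
    have h3 : ∑ i ∈ Finset.range n, ind (tol x j ≤ D i) = (c j : ℝ≥0∞) := by
      rw [← Fin.sum_univ_eq_sum_range (fun i => ind (tol x j ≤ D i)), hc]
      simp only [Finset.card_filter, Nat.cast_sum]
      refine Finset.sum_congr rfl fun i _ => ?_
      unfold ind
      split <;> simp
    have h4 : (2 * n : ℝ≥0∞)⁻¹ * (c j : ℝ≥0∞) = ENNReal.ofReal (c j / (2 * n)) := by
      rw [ENNReal.ofReal_div_of_pos (by positivity), ENNReal.ofReal_mul (by norm_num),
        ENNReal.ofReal_natCast, ENNReal.ofReal_natCast, ENNReal.div_eq_inv_mul]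
      simp
    rw [h3, h4] at h2
    simp only [not_le] at h1
    have h5 : ex (coinFlips (width Q x)) (fun d => ind (D (d % n) < tol x j)) ≠ ⊤ :=
      ne_top_of_le_ne_top ENNReal.one_ne_top (ex_le_one _ fun _ => ind_le_one _)
    rw [← ENNReal.ofReal_toReal h5]
    refine ENNReal.ofReal_le_ofReal ?_
    have h6 : ENNReal.ofReal ((ex (coinFlips (width Q x)) (fun d => ind (D (d % n) < tol x j))).toReal
        + c j / (2 * n)) ≤ ENNReal.ofReal 1 := by
      rw [ENNReal.ofReal_add (by positivity) (by positivity), ENNReal.ofReal_toReal h5,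
        ENNReal.ofReal_one, ← h1]
      gcongr
    rw [ENNReal.ofReal_le_ofReal_iff zero_le_one] at h6
    have := Real.add_one_le_exp (-(c j / (2 * n) : ℝ))
    linarith
  have hprod := ex_coinFlips_prod_dig (width Q x) (fun j d => ind (D (d % n) < tol x j)) hG
  have hcount := le_sum_card he hn (D := fun i : Fin n => D i) (fun i => hD i) hw h
  calc _ = ex (coinFlips (width Q x * width Q x)) (fun r => ∏ j ∈ Finset.range (rounds x),
          ind (D (dig (width Q x) j r % n) < tol x j)) := by
        simp only [ind_forall_eq_prod, position, hn]
    _ ≤ ∏ j ∈ Finset.range (rounds x), ENNReal.ofReal (Real.exp (-(c j / (2 * n)))) := by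
        rw [hprod]
        exact Finset.prod_le_prod' fun j _ => hround j
    _ = ENNReal.ofReal (Real.exp (-(∑ j ∈ Finset.range (rounds x), (c j : ℝ) / (2 * n)))) := by
        rw [← ENNReal.ofReal_prod_of_nonneg fun _ _ => (Real.exp_pos _).le, ← Real.exp_sum,
          Finset.sum_neg_distrib]
    _ ≤ _ := by
        refine ENNReal.ofReal_le_ofReal ?_
        -- The `4 * n` revealing pairs give an exponent of at least `2`, and `exp 2 > 6`.
        have h7 : (2 : ℝ) ≤ ∑ j ∈ Finset.range (rounds x), (c j : ℝ) / (2 * n) := by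
          rw [← Finset.sum_div, le_div_iff₀ (by positivity)]
          linarith
        calc Real.exp (-(∑ j ∈ Finset.range (rounds x), (c j : ℝ) / (2 * n))) ≤ Real.exp (-2) :=
              Real.exp_le_exp.2 (by linarith)
          _ ≤ 1 / 6 := by
            rw [Real.exp_neg, one_div]
            refine inv_anti₀ (by norm_num) ?_
            have := Real.exp_one_gt_d9
            have e2 : Real.exp 2 = Real.exp 1 * Real.exp 1 := by rw [← Real.exp_add]; norm_num
            rw [e2]; nlinarith

end SmoothBandit

/-! ### Honest executions and the meaning of acceptance -/

namespace SmoothBandit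
open scoped ENNReal

theorem ex_not_le_of_prob {e : PMF Prop} {ν : ℝ} (h : 1 - ν ≤ prob e) :
    ex e (fun P => ind (¬ P)) ≤ ENNReal.ofReal ν := by
  have h1 := ex_add_ex_not e (fun P => P)
  have h2 : ex e (fun P => ind P) = ENNReal.ofReal (prob e) := (ofReal_prob e).symm
  rw [h2] at h1
  have h3 : ex e (fun P => ind (¬ P)) ≠ ⊤ :=
    ne_top_of_le_ne_top ENNReal.one_ne_top (ex_le_one _ fun _ => ind_le_one _)
  rw [← ENNReal.ofReal_toReal h3] at h1 ⊢
  rw [← ENNReal.ofReal_add ENNReal.toReal_nonneg (prob_nonneg e), ← ENNReal.ofReal_one,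
    ENNReal.ofReal_eq_ofReal_iff (add_nonneg ENNReal.toReal_nonneg (prob_nonneg e)) zero_le_one] at h1
  exact ENNReal.ofReal_le_ofReal (by linarith)

theorem of_mem_support_of_prob_eq_one {e : PMF Prop} (h : prob e = 1) {P : Prop}
    (hP : P ∈ e.support) : P := by
  have h1 := ex_not_le_of_prob (e := e) (ν := 0) (by rw [h]; norm_num)
  rw [ENNReal.ofReal_zero, nonpos_iff_eq_zero, ex, ENNReal.tsum_eq_zero] at h1
  by_contra hne
  have := h1 P
  rw [ind_true hne, mul_one] at this
  exact (e.mem_support_iff P).1 hP this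

theorem PPT.guarded_eq (A : PPT) {W : ℕ} {x : Data} {r : ℕ} (h : A.coins.eval x.size ≤ W) :
    A.guarded W x r = A.runNat x r := if_pos h

/-- Honest openings are accepted, except with probability `ν`. -/
def VectorCommitment.GoodParams (VC : VectorCommitment) (n : ℕ) (ν : ℝ) (pp : Data) : Prop :=
  ∀ v : List ℕ, v.length = n → ∀ (i : ℕ) (hi : i < v.length),
    1 - ν ≤ prob (do
      let pf ← VC.Open pp v[i] i (VC.Aux pp v)
      let b ← VC.Verify pp (VC.Com pp v) v[i] i pf
      pure (b = .nat 1))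

theorem VectorCommitment.Correct.exists_good {VC : VectorCommitment} {n : ℕ → ℕ}
    (h : VC.Correct n) : ∃ ν : ℕ → ℝ, Negligible ν ∧ ∀ lam,
      ex (VC.KeyGen lam (n lam)) (fun pp => ind (¬ VC.GoodParams (n lam) (ν lam) pp))
        ≤ ENNReal.ofReal (ν lam) := by
  obtain ⟨ν, hν, h⟩ := h
  refine ⟨ν, hν, fun lam => le_trans (le_of_eq ?_) (ex_not_le_of_prob (h lam))⟩
  rw [ex_bind]
  simp only [ex_pure, VectorCommitment.GoodParams]

theorem VectorCommitment.GoodParams.ex_open_le {VC : VectorCommitment} {n : ℕ} {ν : ℝ} {pp : Data}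
    (h : VC.GoodParams n ν pp) {v : List ℕ} (hv : v.length = n) {i : ℕ} (hi : i < n) :
    ex (VC.Open pp (v.getD i 0) i (VC.Aux pp v)) (fun pf =>
      ex (VC.Verify pp (VC.Com pp v) (v.getD i 0) i pf) fun b => ind (b ≠ .nat 1))
      ≤ ENNReal.ofReal ν := by
  have h1 := ex_not_le_of_prob (h v hv i (by omega))
  rw [ex_bind] at h1
  simp only [ex_bind, ex_pure] at h1
  rw [List.getD_eq_getElem _ _ (by omega : i < v.length)]
  exact h1

section coins

variable {Q : Polynomial ℕ} {x : Data} {a b : ℕ}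

theorem position_add {j : ℕ} (hj : j < width Q x) :
    position Q x (a + 2 ^ (width Q x * width Q x) * b) j = position Q x a j := by
  rw [position, dig_add_low hj, position]

theorem dig_width_add (ha : a < 2 ^ (width Q x * width Q x)) (i : ℕ) :
    dig (width Q x) (width Q x + i) (a + 2 ^ (width Q x * width Q x) * b) = dig (width Q x) i b :=
  dig_add_high ha i

end coins

section

variable {P : Protocol} {VC : VectorCommitment} {SN : Snark} {Q : Polynomial ℕ}
  (hP : Implements P VC SN Q) {lam n : ℕ} {ε σ : ℝ}

include hP

theorem Implements.ex_interact (hn : 1 ≤ n) (q : Bandit n) (S : Strategy) (f : Data → ℝ≥0∞) :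
    ex (P.interact lam n ε σ q S) f = ex (P.crs lam n ε σ) fun crs => ex (S crs) fun m =>
      ex (coinFlips (P.verifierCoinCount lam n ε σ)) fun r =>
      ex (q.pulls (precision lam n ε) (blocks (rounds (params lam n ε σ))
        (pullCount (params lam n ε σ))
        fun j => ⟨position Q (params lam n ε σ) r j, position_lt lam ε σ hn r j⟩)) fun ys =>
      f (outputFn VC SN Q (params lam n ε σ) crs (.ofVec ys) r m.1
        (m.2 (.ofVec (positions Q (params lam n ε σ) r)))) := by
  unfold Protocol.interact
  simp only [ex_bind, ex_pure]
  simp only [hP.verifierArms_eq lam n ε σ hn, Protocol.output, Protocol.challenge, Protocol.view,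
    hP.verifierOutput, hP.verifierChallenge]

theorem Implements.ex_verifierCoins (f : ℕ → ℝ≥0∞) :
    ex (coinFlips (P.verifierCoinCount lam n ε σ)) f
      = ex (coinFlips (width Q (params lam n ε σ) * width Q (params lam n ε σ))) fun a =>
        ex (coinFlips (width Q (params lam n ε σ) * (width Q (params lam n ε σ) + 1))) fun b =>
          f (a + 2 ^ (width Q (params lam n ε σ) * width Q (params lam n ε σ)) * b) := by
  rw [Protocol.verifierCoinCount, hP.verifierCoins, mul_add, ex_coinFlips_add]
  rfl

theorem Implements.ex_honest (hn : 1 ≤ n) (hε : 0 < ε) (q : Bandit n) (crs : Data)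
    (f : Data × (Data → Data) → ℝ≥0∞) :
    ex (P.honest lam n ε σ q crs) f =
      ex (coinFlips (width Q (params lam n ε σ) * (width Q (params lam n ε σ) + 1))) fun r =>
      ex (q.pulls (precision lam n ε) (blocks n (fun _ => proverPulls (params lam n ε σ))
        fun j => ⟨j % n, Nat.mod_lt _ hn⟩)) fun xs =>
      f (messageOne VC SN Q (params lam n ε σ) crs
          (.ofVec (estimates (params lam n ε σ) (.ofVec xs))) r,
        messageThree VC Q (params lam n ε σ) crs
          (.ofVec (estimates (params lam n ε σ) (.ofVec xs))) r) := by
  unfold Protocol.honest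
  simp only [ex_bind, ex_pure]
  have h2 : ∀ xs r, P.secondMessage lam n ε σ crs xs r = messageThree VC Q (params lam n ε σ) crs
      (.ofVec (estimates (params lam n ε σ) (.ofVec xs))) r :=
    fun xs r => funext fun m₂ => hP.proverSecond _ _ _ _ _
  simp only [hP.proverArms_eq lam n ε σ hn hε, Protocol.firstMessage, h2,
    Protocol.view, hP.proverFirst, Protocol.proverCoinCount, hP.proverCoins]
  rfl

end

section output

variable {VC : VectorCommitment} {SN : Snark} {Q : Polynomial ℕ}
  {x crs m₁ m₃ : Data} {ys : List ℕ} {r : ℕ}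

/-- Round `j` is accepted. -/
def RoundOk (VC : VectorCommitment) (Q : Polynomial ℕ) (x pp c m : Data) (ys : List ℕ) (r j : ℕ) :
    Prop :=
  openingCheck VC Q x pp c (position Q x r j) m (dig (width Q x) (width Q x + (1 + j)) r) = .nat 1 ∧
    ¬ Far x (blockSum (pullCount x) ys j) m.fst.toNat j

theorem sum_roundFails_eq_zero {pp c : Data} :
    ∑ j ∈ Finset.range (rounds x), roundFails VC Q x pp c (m₃.nth j) (.ofVec ys) r j = 0 ↔
      ∀ j < rounds x, RoundOk VC Q x pp c (m₃.nth j) ys r j := by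
  rw [Finset.sum_eq_zero_iff]
  refine ⟨fun h j hj => ?_, fun h j hj => ?_⟩
  · have := h j (Finset.mem_range.2 hj)
    unfold roundFails at this
    rw [verifierSum_eq x ys hj] at this
    split_ifs at this with h1 h2
    exact ⟨h1, h2⟩
  · have hj := Finset.mem_range.1 hj
    obtain ⟨h1, h2⟩ := h j hj
    unfold roundFails
    rw [verifierSum_eq x ys hj, if_pos h1, if_neg h2]

/-- A rejecting verifier returns a leaf, and only pairs denote numbers; so a denoted value means
that all checks were passed. -/
theorem denotes_outputFn {t : ℝ} (h : (outputFn VC SN Q x crs (.ofVec ys) r m₁ m₃).Denotes t) :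
    argCheck SN Q x crs m₁ r = .nat 1 ∧
      (∀ j < rounds x, RoundOk VC Q x crs.fst m₁.fst.fst (m₃.nth j) ys r j) ∧
      t = (m₁.fst.snd.toNat : ℝ) / ((denom x : ℝ) * 2 ^ fracBits x) := by
  obtain ⟨a, b, -, h, rfl⟩ := h
  unfold outputFn at h
  split_ifs at h with h1 h2
  refine ⟨h1, sum_roundFails_eq_zero.1 h2, ?_⟩
  simp only [Data.pair.injEq, Data.nat.injEq] at h
  rw [← h.1, ← h.2]
  push_cast; rfl

theorem outputFn_denotes (h1 : argCheck SN Q x crs m₁ r = .nat 1)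
    (h2 : ∀ j < rounds x, RoundOk VC Q x crs.fst m₁.fst.fst (m₃.nth j) ys r j) :
    (outputFn VC SN Q x crs (.ofVec ys) r m₁ m₃).Denotes
      ((m₁.fst.snd.toNat : ℝ) / ((denom x : ℝ) * 2 ^ fracBits x)) := by
  rw [outputFn, if_pos h1, if_pos (sum_roundFails_eq_zero.2 h2)]
  refine ⟨_, _, ?_, rfl, by push_cast; rfl⟩
  have := denom_pos x
  positivity

end output

section honest

variable {VC : VectorCommitment} {SN : Snark} {Q : Polynomial ℕ} (hQ : Suitable VC SN Q)
  {lam n : ℕ} {ε σ : ℝ} (hn : 1 ≤ n)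

include hQ

/-- Honest openings are accepted. -/
theorem ex_opening_le {ν : ℝ} (k : ℕ) {v : List ℕ} (hv : v.length = n)
    (hv' : ∀ a ∈ v, a ≤ 2 ^ fracBits (params lam n ε σ)) {i j : ℕ} (hi : i < n)
    (hj : j < rounds (params lam n ε σ)) :
    ex (coinFlips (width Q (params lam n ε σ) * (width Q (params lam n ε σ) + 1))) (fun r =>
      ex (coinFlips (width Q (params lam n ε σ) * (width Q (params lam n ε σ) + 1))) fun b =>
        ind (openingCheck VC Q (params lam n ε σ) (ppOf VC (params lam n ε σ) k)
          (VC.Com (ppOf VC (params lam n ε σ) k) v) i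
          (openingOf VC Q (params lam n ε σ) (ppOf VC (params lam n ε σ) k) (.ofVec v) r i j)
          (dig (width Q (params lam n ε σ)) (1 + j) b) ≠ .nat 1))
      ≤ ENNReal.ofReal ν + ind (¬ VC.GoodParams n ν (ppOf VC (params lam n ε σ) k)) := by
  set x := params lam n ε σ with hx
  set pp := ppOf VC x k with hpp
  have hnx : parN x = n := parN_params _ _ _ _
  -- For bad parameters the right side is at least `1`.
  by_cases hg : VC.GoodParams n ν pp
  swap
  · rw [ind_true hg]
    exact (ex_le_one _ fun _ => ex_le_one _ fun _ => ind_le_one _).trans le_add_self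
  rw [ind_false (not_not.2 hg), add_zero]
  refine le_trans (le_of_eq ?_) (hg.ex_open_le hv hi)
  have hjW : 1 + j < width Q x + 1 := by
    have := hQ.rounds_le x
    omega
  rw [VectorCommitment.Open, ← ex_runNat_dig VC.opening _ _ hjW
    (hQ.opening x k v (hv.trans hnx.symm) hv' i (by omega))]
  congr 1; funext r
  rw [VectorCommitment.Verify, ← ex_runNat_dig VC.verify _ _ hjW
    (hQ.verify x k (dig (width Q x) (1 + j) r) v (hv.trans hnx.symm) hv' i (by omega))]
  congr 1; funext b
  have hge := hQ.verify x k (dig (width Q x) (1 + j) r) v (hv.trans hnx.symm) hv' i (by omega)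
  have hnth : ((Data.ofVec v).nth i).toNat = v.getD i 0 := by rw [Data.nth_ofVec]; rfl
  rw [openingCheck, openingOf, hnth]
  congr 2
  exact VC.verify.guarded_eq hge

include hn

/-- Honest proofs are accepted. -/
theorem argCheck_messageOne (hc : SN.PerfectlyComplete VC) (k k' r r' : ℕ) {v : List ℕ}
    (hv : v.length = n) (hv' : ∀ a ∈ v, a ≤ 2 ^ fracBits (params lam n ε σ)) :
    argCheck SN Q (params lam n ε σ) (.pair (ppOf VC (params lam n ε σ) k)
      (argOf SN (params lam n ε σ) (ppOf VC (params lam n ε σ) k) k'))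
      (messageOne VC SN Q (params lam n ε σ) (.pair (ppOf VC (params lam n ε σ) k)
        (argOf SN (params lam n ε σ) (ppOf VC (params lam n ε σ) k) k')) (.ofVec v) r) r'
      = .nat 1 := by
  set x := params lam n ε σ with hx
  set pp := ppOf VC x k with hpp
  have hnx : parN x = n := parN_params _ _ _ _
  have hs := smoothRat_mem (x := x) (by omega)
  rw [hnx] at hs
  have h1 := hc lam n (smoothRat x) (fracBits x) hn hs.1 hs.2 pp (ppOf_mem lam n ε σ k) _ _
    (rel_claim (VC := VC) (lam := lam) (ε := ε) (σ := σ) hn pp hv hv')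
  rw [← relOf_params] at h1
  have hge := hQ.argVerify x k k' (dig (width Q x) 0 r) v (hv.trans hnx.symm) hv'
  refine (SN.verify.guarded_eq hge).trans ?_
  -- Acceptance with probability one means acceptance for every possible choice of coins, in
  -- particular for those at hand.
  refine of_mem_support_of_prob_eq_one h1 ?_
  refine mem_support_bind_iff'.2 ⟨SN.setup.runNat (.pair x.fst (relOf x pp)) k',
    runNat_mem_support _ _ _, mem_support_bind_iff'.2 ⟨_, runNat_mem_support _ _ (dig (width Q x) 0 r),
    mem_support_bind_iff'.2 ⟨_, runNat_mem_support _ _ (dig (width Q x) (width Q x) r'),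
      mem_support_pure_iff'.2 rfl⟩⟩⟩

end honest

end SmoothBandit

/-! ### Accuracy of the honest estimates -/

namespace SmoothBandit
open scoped ENNReal

section

variable {lam n : ℕ} {ε σ : ℝ} (hlam : 8 ≤ lam) (hn : 1 ≤ n) (hε : 0 < ε) (hε1 : ε < 1)
  (q : Bandit n)

include hlam hn hε hε1

/-- The estimates of the honest prover are accurate, except with small probability. -/
theorem ex_exists_estimate_le :
    ex (q.pulls (precision lam n ε) (blocks n (fun _ => proverPulls (params lam n ε σ))
        fun j => ⟨j % n, Nat.mod_lt _ hn⟩))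
      (fun xs => ind (∃ i : Fin n, 1 / (32 * ⌈1 / ε⌉₊ : ℝ) <
        |((estimates (params lam n ε σ) (.ofVec xs)).getD i 0 : ℝ) /
          2 ^ fracBits (params lam n ε σ) - q.utility i|))
      ≤ ENNReal.ofReal (1 / 6) := by
  set x := params lam n ε σ with hx
  have he2 := two_le_ceil hε hε1
  have hnx : parN x = n := parN_params _ _ _ _
  have hex : parE x = ⌈1 / ε⌉₊ := parE_params _ _ _ _
  have hkx : parK x = precision lam n ε := parK_params _ _ _ _
  have hn0 : (0 : ℝ) < n := by exact_mod_cast hn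
  have he0 : (0 : ℝ) < ⌈1 / ε⌉₊ := by exact_mod_cast (by omega : 0 < ⌈1 / ε⌉₊)
  have hm : 0 < proverPulls x := by
    unfold proverPulls
    rw [hex]
    have := Data.two_le_size (Data.nat (12 * parN x))
    have : 0 < ⌈1 / ε⌉₊ := by omega
    positivity
  have hm0 : (0 : ℝ) < proverPulls x := by exact_mod_cast hm
  refine le_trans ?_ ((q.ex_exists_block (precision lam n ε) (G := n) (N := 12 * n)
    (by omega) (fun _ => proverPulls x) (fun j => ⟨j % n, Nat.mod_lt _ hn⟩)
    (δ := fun _ => 1 / (64 * ⌈1 / ε⌉₊)) (fun j => by positivity)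
    (fun j _ => ?_)).trans (ENNReal.ofReal_le_ofReal ?_))
  · refine ex_mono _ fun xs => ind_mono ?_
    rintro ⟨i, hlt⟩
    refine ⟨i, i.2, ?_⟩
    have hi : (⟨i % n, Nat.mod_lt _ hn⟩ : Fin n) = i := Fin.ext (Nat.mod_eq_of_lt i.2)
    rw [hi]
    rw [getD_estimates x xs (by rw [hnx]; exact i.2), hkx] at hlt
    set S := blockSum (fun _ => proverPulls x) xs i
    set k := precision lam n ε
    set h := fracBits x
    set e := (⌈1 / ε⌉₊ : ℝ)
    have hfloor : |((S * 2 ^ h / (proverPulls x * 2 ^ k) : ℕ) : ℝ) / 2 ^ h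
        - S / (proverPulls x * 2 ^ k)| ≤ 1 / 2 ^ h := by
      have h1 := Nat.div_mul_le_self (S * 2 ^ h) (proverPulls x * 2 ^ k)
      have h2 := Nat.lt_div_mul_add (a := S * 2 ^ h) (b := proverPulls x * 2 ^ k) (by positivity)
      set v := S * 2 ^ h / (proverPulls x * 2 ^ k)
      have h1' : (v : ℝ) * (proverPulls x * 2 ^ k) ≤ S * 2 ^ h := by exact_mod_cast h1
      have h2' : (S : ℝ) * 2 ^ h < v * (proverPulls x * 2 ^ k) + proverPulls x * 2 ^ k := by
        exact_mod_cast h2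
      have e1 : (v : ℝ) / 2 ^ h - S / (proverPulls x * 2 ^ k)
          = (v * (proverPulls x * 2 ^ k) - S * 2 ^ h) / (proverPulls x * 2 ^ k) / 2 ^ h := by
        field_simp
      rw [e1, abs_div, abs_div, abs_of_pos (by positivity : (0 : ℝ) < 2 ^ h),
        abs_of_pos (by positivity : (0 : ℝ) < proverPulls x * 2 ^ k)]
      gcongr
      rw [div_le_one (by positivity), abs_le]
      constructor <;> linarith
    have h3 := two_pow_fracBits (x := x) (by omega) (by omega)
    rw [hnx, hex] at h3
    have h4 := le_two_pow_precision n ε hlam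
    have hne : ⌈1 / ε⌉₊ ≤ n * ⌈1 / ε⌉₊ := Nat.le_mul_of_pos_left _ hn
    have h3' : (1024 * e : ℝ) ≤ 2 ^ h := by
      have := Nat.cast_le (α := ℝ).2 (le_trans (by linarith) h3 : 1024 * ⌈1 / ε⌉₊ ≤ 2 ^ h)
      push_cast at this
      exact this
    have h4' : (256 * e : ℝ) ≤ 2 ^ k := by
      have := Nat.cast_le (α := ℝ).2 (le_trans (by linarith) h4 : 256 * ⌈1 / ε⌉₊ ≤ 2 ^ k)
      push_cast at this
      exact this
    -- The budget `1 / (32 * e)` covers rounding the estimate (`1 / (1024 * e)`), truncating the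
    -- rewards (`1 / (256 * e)`) and the sampling error (`1 / (64 * e)`).
    have h5 : (1 : ℝ) / 2 ^ h ≤ 1 / (1024 * e) := by gcongr
    have h6 : (1 : ℝ) / 2 ^ k ≤ 1 / (256 * e) := by gcongr
    have h7 := q.abs_truncMean_sub_le k i
    have e2 : (S : ℝ) / 2 ^ k - proverPulls x * q.truncMean k i
        = proverPulls x * (S / (proverPulls x * 2 ^ k) - q.truncMean k i) := by
      field_simp
    rw [e2, abs_mul, abs_of_pos hm0]
    refine mul_lt_mul_of_pos_left ?_ hm0
    have h8 := abs_sub_le (((S * 2 ^ h / (proverPulls x * 2 ^ k) : ℕ) : ℝ) / 2 ^ h)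
      (S / (proverPulls x * 2 ^ k)) (q.utility i)
    have h9 := abs_sub_le ((S : ℝ) / (proverPulls x * 2 ^ k)) (q.truncMean k i) (q.utility i)
    have e3 : (1 : ℝ) / (1024 * e) = 1 / e / 1024 := by field_simp
    have e4 : (1 : ℝ) / (256 * e) = 1 / e / 256 := by field_simp
    have e5 : (1 : ℝ) / (32 * e) = 1 / e / 32 := by field_simp
    have e6 : (1 : ℝ) / (64 * e) = 1 / e / 64 := by field_simp
    have e7 : 0 < 1 / e := by positivity
    rw [e3] at h5
    rw [e4] at h6
    rw [e5] at hlt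
    rw [e6]
    linarith
  · have := size_le_proverPulls_mul (x := x) (by omega)
    rwa [hnx, hex] at this
  · push_cast
    apply le_of_eq
    field_simp; norm_num

/-- A weighted average of the errors is at most their maximum, which is below the bound of
`exists_far_of_not_within`. -/
theorem within_of_close (hσ : 1 / (n : ℝ) ≤ σ) (hσ1 : σ ≤ 1) {v π : Fin n → ℝ}
    (h : IsOptimalSmooth ((numer (params lam n ε σ) : ℝ) / denom (params lam n ε σ)) v π)
    (hv : ∀ i, |v i - q.utility i| ≤ 1 / (32 * ⌈1 / ε⌉₊ : ℝ)) :
    WithinOfOptimal σ ε q.utility (π ⬝ᵥ v) := by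
  by_contra hw
  obtain ⟨w, hw1, hw2⟩ := exists_far_of_not_within hlam hn hε hε1 q hσ hσ1 h hw
  have he0 : (0 : ℝ) < ⌈1 / ε⌉₊ := by exact_mod_cast (two_le_ceil hε hε1).trans' one_le_two
  have h1 : ∑ i, w i * |v i - q.utility i| ≤ 1 / (32 * ⌈1 / ε⌉₊ : ℝ) := by
    calc ∑ i, w i * |v i - q.utility i| ≤ ∑ i, w i * (1 / (32 * ⌈1 / ε⌉₊ : ℝ)) :=
          Finset.sum_le_sum fun i _ => mul_le_mul_of_nonneg_left (hv i) (hw1.1 i)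
      _ = _ := by rw [← Finset.sum_mul, hw1.2.1, one_mul]
  have h2 : (1 : ℝ) / (32 * ⌈1 / ε⌉₊ : ℝ) ≤ 3 / (4 * ⌈1 / ε⌉₊) := by
    rw [div_le_div_iff₀ (by positivity) (by positivity)]
    linarith
  linarith

end

/-! ### Completeness -/

/-- The union bound over inaccurate estimates `A`, inaccurate rounds `B` and rejected openings `C`.
Openings are bounded for fixed rewards and positions, over the coins of the opening and of its check
alone; exchanging expectations reduces to that case. -/
theorem ex_union_le {pr pa pb : PMF ℕ} {px : PMF (List ℕ)} {py : ℕ → ℕ → PMF (List ℕ)} {G : ℕ}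
    {F : ℕ → List ℕ → ℕ → ℕ → List ℕ → ℝ≥0∞} {A : List ℕ → ℝ≥0∞} {B : ℕ → ℕ → List ℕ → ℝ≥0∞}
    {C : ℕ → ℕ → List ℕ → ℕ → ℕ → ℝ≥0∞} {α β γ : ℝ≥0∞}
    (hF : ∀ r, ∀ xs ∈ px.support, ∀ a ∈ pa.support, ∀ b ys, F r xs a b ys ≤
      A xs + (B a b ys + ∑ j ∈ Finset.range G, C j r xs a b))
    (hA : ex px A ≤ α) (hB : ∀ a b, ex (py a b) (B a b) ≤ β)
    (hC : ∀ j < G, ∀ xs ∈ px.support, ∀ a,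
      ex pr (fun r => ex pb fun b => C j r xs a b) ≤ γ) :
    ex pr (fun r => ex px fun xs => ex pa fun a => ex pb fun b => ex (py a b) (F r xs a b))
      ≤ α + (β + G * γ) := by
  calc _ ≤ ex pr (fun r => ex px fun xs => ex pa fun a => ex pb fun b =>
        A xs + (β + ∑ j ∈ Finset.range G, C j r xs a b)) := by
        refine ex_mono _ fun r => ex_mono_support _ fun xs hxs => ex_mono_support _ fun a ha =>
          ex_mono _ fun b => (ex_mono _ fun ys => hF r xs hxs a ha b ys).trans ?_
        rw [ex_add, ex_const, ex_add, ex_const]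
        gcongr
        exact hB a b
    _ = ex px A + (β + ∑ j ∈ Finset.range G, ex pr (fun r => ex px fun xs => ex pa fun a =>
        ex pb fun b => C j r xs a b)) := by
        simp only [ex_add, ex_const, ex_sum]
    _ ≤ α + (β + ∑ _j ∈ Finset.range G, γ) := by
        gcongr with j hj
        rw [ex_comm]
        refine ex_le _ fun xs hxs => ?_
        rw [ex_comm]
        exact ex_le _ fun a _ => hC j (Finset.mem_range.1 hj) xs hxs a
    _ = _ := by simp

section completeness

variable {P : Protocol} {VC : VectorCommitment} {SN : Snark} {Q : Polynomial ℕ}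
  (hP : Implements P VC SN Q) (hQ : Suitable VC SN Q)
  {lam n : ℕ} {ε σ : ℝ} (hlam : 8 ≤ lam) (hn : 1 ≤ n) (hε : 0 < ε) (hε1 : ε < 1)
  (hσ : 1 / (n : ℝ) ≤ σ) (hσ1 : σ ≤ 1) (q : Bandit n)

include hQ hlam hn hε hε1 hσ hσ1 in
/-- The honest prover succeeds if the estimates are accurate and the openings are accepted. -/
theorem ind_honest_le (hc : SN.PerfectlyComplete VC) (k k' r : ℕ) {a b : ℕ}
    (ha : a < 2 ^ (width Q (params lam n ε σ) * width Q (params lam n ε σ)))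
    {xs ys : List ℕ} (hxs : ∀ z ∈ xs, z ≤ 2 ^ precision lam n ε) :
    ind (¬ ∃ t, (outputFn VC SN Q (params lam n ε σ) (.pair (ppOf VC (params lam n ε σ) k)
      (argOf SN (params lam n ε σ) (ppOf VC (params lam n ε σ) k) k')) (.ofVec ys)
      (a + 2 ^ (width Q (params lam n ε σ) * width Q (params lam n ε σ)) * b)
      (messageOne VC SN Q (params lam n ε σ) (.pair (ppOf VC (params lam n ε σ) k)
        (argOf SN (params lam n ε σ) (ppOf VC (params lam n ε σ) k) k'))
        (.ofVec (estimates (params lam n ε σ) (.ofVec xs))) r)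
      (messageThree VC Q (params lam n ε σ) (.pair (ppOf VC (params lam n ε σ) k)
        (argOf SN (params lam n ε σ) (ppOf VC (params lam n ε σ) k) k'))
        (.ofVec (estimates (params lam n ε σ) (.ofVec xs))) r
        (.ofVec (positions Q (params lam n ε σ)
          (a + 2 ^ (width Q (params lam n ε σ) * width Q (params lam n ε σ)) * b))))).Denotes t ∧
        WithinOfOptimal σ ε q.utility t) ≤
    ind (∃ i : Fin n, 1 / (32 * ⌈1 / ε⌉₊ : ℝ) <
        |((estimates (params lam n ε σ) (.ofVec xs)).getD i 0 : ℝ) /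
          2 ^ fracBits (params lam n ε σ) - q.utility i|) +
    (ind (∃ j < rounds (params lam n ε σ), tol (params lam n ε σ) j / 8 <
        |(blockSum (pullCount (params lam n ε σ)) ys j : ℝ) /
          (pullCount (params lam n ε σ) j * 2 ^ precision lam n ε) -
            q.utility ⟨position Q (params lam n ε σ) (a + 2 ^ (width Q (params lam n ε σ) *
              width Q (params lam n ε σ)) * b) j, position_lt lam ε σ hn _ j⟩|) +
    ∑ j ∈ Finset.range (rounds (params lam n ε σ)),
      ind (openingCheck VC Q (params lam n ε σ) (ppOf VC (params lam n ε σ) k)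
          (VC.Com (ppOf VC (params lam n ε σ) k) (estimates (params lam n ε σ) (.ofVec xs)))
          (position Q (params lam n ε σ) a j)
          (openingOf VC Q (params lam n ε σ) (ppOf VC (params lam n ε σ) k)
            (.ofVec (estimates (params lam n ε σ) (.ofVec xs))) r
            (position Q (params lam n ε σ) a j) j)
          (dig (width Q (params lam n ε σ)) (1 + j) b) ≠ .nat 1)) := by
  set x := params lam n ε σ with hx
  set pp := ppOf VC x k with hpp
  set v := estimates x (.ofVec xs) with hv
  have hnx : parN x = n := parN_params _ _ _ _
  have hex : parE x = ⌈1 / ε⌉₊ := parE_params _ _ _ _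
  have hkx : parK x = precision lam n ε := parK_params _ _ _ _
  have he2 := two_le_ceil hε hε1
  have he : 1 ≤ parE x := by omega
  have hvl : v.length = n := by rw [hv, length_estimates, hnx]
  have hvle : ∀ a ∈ v, a ≤ 2 ^ fracBits x := estimates_le x fun a ha => by
    rw [hkx]; exact hxs a ha
  refine le_trans (ind_mono (Q := (∃ i : Fin n, 1 / (32 * ⌈1 / ε⌉₊ : ℝ) <
        |(v.getD i 0 : ℝ) / 2 ^ fracBits x - q.utility i|) ∨ ((∃ j < rounds x, tol x j / 8 <
        |(blockSum (pullCount x) ys j : ℝ) / (pullCount x j * 2 ^ precision lam n ε) -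
            q.utility ⟨position Q x (a + 2 ^ (width Q x * width Q x) * b) j,
              position_lt lam ε σ hn _ j⟩|) ∨
      ∃ j < rounds x, openingCheck VC Q x pp (VC.Com pp v) (position Q x a j)
          (openingOf VC Q x pp (.ofVec v) r (position Q x a j) j)
          (dig (width Q x) (1 + j) b) ≠ .nat 1)) ?_)
    ((ind_or_le _ _).trans (add_le_add le_rfl ((ind_or_le _ _).trans
      (add_le_add le_rfl (ind_exists_le _ _)))))
  contrapose!
  rintro ⟨h1, h2, h3⟩
  obtain ⟨v', T, π, hw, hφ, -, hopt, hval⟩ :=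
    rel_claim (VC := VC) (lam := lam) (ε := ε) (σ := σ) hn pp hvl hvle
  have hvv : v' = fun i : Fin n => v.getD i 0 := by
    funext i
    have e1 := congrArg (fun d => (d.nth i).toNat) hw
    simp only [Data.nth_ofVec, Data.toNat] at e1
    rw [e1]
    simp [List.getD_eq_getElem?_getD]
  subst hvv
  rw [smoothRat_cast] at hopt
  have hT : T = (claim VC x pp (.ofVec v)).snd.toNat := by rw [hφ]; rfl
  refine ⟨_, outputFn_denotes (argCheck_messageOne hQ hn hc k k' r _ hvl hvle) ?_, ?_⟩
  · intro j hj
    have hjW : j < width Q x := lt_of_lt_of_le hj (hQ.rounds_le x)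
    have hm3 : (messageThree VC Q x (.pair pp (argOf SN x pp k')) (.ofVec v) r
        (.ofVec (positions Q x (a + 2 ^ (width Q x * width Q x) * b)))).nth j
        = openingOf VC Q x pp (.ofVec v) r (position Q x a j) j := by
      rw [messageThree, Data.nth_ofList, List.getD_eq_getElem _ _ (by simpa using hj)]
      simp only [List.getElem_map, List.getElem_range, Data.nth_ofVec]
      rw [List.getD_eq_getElem _ _ (by simpa [positions] using hj)]
      simp [positions, Data.toNat, Data.fst, position_add hjW]
    rw [hm3]
    refine ⟨?_, ?_⟩
    · rw [position_add hjW, dig_width_add ha]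
      exact h3 j hj
    · rw [far_iff he, not_lt, hkx]
      have hnth : (openingOf VC Q x pp (.ofVec v) r (position Q x a j) j).fst.toNat
          = v.getD (position Q x a j) 0 := by
        simp [openingOf, Data.fst, Data.toNat, Data.nth_ofVec]
      rw [hnth]
      have g1 := h1 ⟨position Q x a j, position_lt lam ε σ hn a j⟩
      have g2 := h2 j hj
      rw [show (⟨position Q x (a + 2 ^ (width Q x * width Q x) * b) j, position_lt lam ε σ hn _ j⟩ :
        Fin n) = ⟨position Q x a j, position_lt lam ε σ hn a j⟩ from Fin.ext (position_add hjW)] at g2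
      -- The threshold `tol / 4` of the test is shared equally: the estimate is off by at most `1 /
      -- (32 * ⌈1 / ε⌉₊) ≤ tol / 8`, and the mean of the verifier by at most `tol / 8`.
      have g3 := tol_ge he j
      rw [hex] at g3
      rw [abs_sub_comm] at g2
      have g4 := abs_sub_le ((v.getD (position Q x a j) 0 : ℝ) / 2 ^ fracBits x)
        (q.utility ⟨position Q x a j, position_lt lam ε σ hn a j⟩)
        ((blockSum (pullCount x) ys j : ℝ) / (pullCount x j * 2 ^ precision lam n ε))
      have he0 : (0 : ℝ) < ⌈1 / ε⌉₊ := by exact_mod_cast (by omega : 0 < ⌈1 / ε⌉₊)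
      have e1 : (1 : ℝ) / (32 * ⌈1 / ε⌉₊) = 1 / (4 * ⌈1 / ε⌉₊) / 8 := by field_simp; norm_num
      rw [e1] at g1
      linarith
  · have e1 : ((messageOne VC SN Q x (.pair pp (argOf SN x pp k')) (.ofVec v) r).fst.snd.toNat : ℝ)
        / ((denom x : ℝ) * 2 ^ fracBits x)
        = π ⬝ᵥ (fun i : Fin n => (v.getD i 0 : ℝ) / 2 ^ fracBits x) := by
      rw [hval, smoothRat_den, hT]; rfl
    rw [e1]
    exact within_of_close hlam hn hε hε1 q hσ hσ1 hopt h1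

-- The constant is `1 / 6` for the estimates plus `1 / 12` for the rounds. Each opening can fail in
-- two ways: bad commitment parameters, or rejection under good ones.
include hP hQ hlam hn hε hε1 hσ hσ1 in
theorem Implements.ex_honest_le (hc : SN.PerfectlyComplete VC) {ν : ℝ}
    (hν : ex (VC.KeyGen lam n) (fun pp => ind (¬ VC.GoodParams n ν pp)) ≤ ENNReal.ofReal ν) :
    ex (P.interact lam n ε σ q (P.honest lam n ε σ q)) (fun o => ind (¬ ∃ t, o.Denotes t ∧
      WithinOfOptimal σ ε q.utility t)) ≤ ENNReal.ofReal (1 / 4) +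
        rounds (params lam n ε σ) * (ENNReal.ofReal ν + ENNReal.ofReal ν) := by
  rw [hP.ex_interact hn]
  simp only [hP.ex_honest hn hε, hP.ex_verifierCoins]
  refine (ex_mono_support (g := fun crs => ENNReal.ofReal (1 / 4) + rounds (params lam n ε σ) *
    (ENNReal.ofReal ν + ind (¬ VC.GoodParams n ν crs.fst))) _ fun crs hcrs => ?_).trans ?_
  · obtain ⟨k, k', rfl⟩ := hP.mem_crs lam n ε σ hcrs
    refine (ex_union_le
      (A := fun xs => ind (∃ i : Fin n, 1 / (32 * ⌈1 / ε⌉₊ : ℝ) <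
        |((estimates (params lam n ε σ) (.ofVec xs)).getD i 0 : ℝ) /
          2 ^ fracBits (params lam n ε σ) - q.utility i|))
      (B := fun a b ys => ind (∃ j < rounds (params lam n ε σ), tol (params lam n ε σ) j / 8 <
        |(blockSum (pullCount (params lam n ε σ)) ys j : ℝ) /
          (pullCount (params lam n ε σ) j * 2 ^ precision lam n ε) -
            q.utility ⟨position Q (params lam n ε σ) (a + 2 ^ (width Q (params lam n ε σ) *
              width Q (params lam n ε σ)) * b) j, position_lt lam ε σ hn _ j⟩|))
      (C := fun j r xs a b => ind (openingCheck VC Q (params lam n ε σ) (ppOf VC (params lam n ε σ) k)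
          (VC.Com (ppOf VC (params lam n ε σ) k) (estimates (params lam n ε σ) (.ofVec xs)))
          (position Q (params lam n ε σ) a j)
          (openingOf VC Q (params lam n ε σ) (ppOf VC (params lam n ε σ) k)
            (.ofVec (estimates (params lam n ε σ) (.ofVec xs))) r
            (position Q (params lam n ε σ) a j) j)
          (dig (width Q (params lam n ε σ)) (1 + j) b) ≠ .nat 1))
      (G := rounds (params lam n ε σ))
      (α := ENNReal.ofReal (1 / 6)) (β := ENNReal.ofReal (1 / 12))
      (γ := ENNReal.ofReal ν + ind (¬ VC.GoodParams n ν (ppOf VC (params lam n ε σ) k)))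
      ?_ ?_ ?_ ?_).trans ?_
    · intro r xs hxs a ha b ys
      exact ind_honest_le hQ hlam hn hε hε1 hσ hσ1 q hc k k' r
        (lt_of_mem_coinFlips ha) (q.pulls_le _ hxs)
    · exact ex_exists_estimate_le hlam hn hε hε1 q
    · intro a b
      exact ex_exists_round_le hlam hn hε hε1 q _
    · intro j hj xs hxs a
      exact ex_opening_le hQ k (by rw [length_estimates, parN_params])
        (estimates_le _ fun z hz => by rw [parK_params]; exact q.pulls_le _ hxs z hz)
        (position_lt lam ε σ hn a j) hj
    rw [← add_assoc, ← ENNReal.ofReal_add (by norm_num) (by norm_num)]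
    norm_num
    rfl
  · rw [hP.ex_crs lam n ε σ hQ]
    simp only [Data.fst, ex_const, ex_add, ex_const_mul]
    gcongr

end completeness

end SmoothBandit

namespace SmoothBandit
open scoped ENNReal

/-! ### Soundness -/

/-- The coins a check needs depend on the length of the prover's message. The guard refuses messages
that need too many, which only lowers acceptance; otherwise the block of coins is as good as fresh
ones. -/
theorem ex_guarded_le (A : PPT) (x : Data) (R : Prop) {W j J : ℕ} (hj : j < J) :
    ex (coinFlips (W * J)) (fun r => ind (A.guarded W x (dig W j r) = .nat 1 ∧ R))
      ≤ ex (A.run x) (fun b => ind (b = .nat 1 ∧ R)) := by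
  by_cases h : A.coins.eval x.size ≤ W
  · simp only [A.guarded_eq h]
    exact (ex_runNat_dig A x (fun b => ind (b = .nat 1 ∧ R)) hj h).le
  · refine (ex_le _ fun r _ => ?_).trans zero_le
    rw [PPT.guarded, if_neg h, ind_false]
    simp

theorem positions_add {Q : Polynomial ℕ} {x : Data} {a b : ℕ} (h : rounds x ≤ width Q x) :
    positions Q x (a + 2 ^ (width Q x * width Q x) * b) = positions Q x a := by
  unfold positions
  refine List.map_congr_left fun j hj => position_add ?_
  exact (List.mem_range.1 hj).trans_le h

section

variable {lam n : ℕ} {ε σ : ℝ} (hlam : 8 ≤ lam) (hn : 1 ≤ n) (hε : 0 < ε) (hε1 : ε < 1)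
  (hσ : 1 / (n : ℝ) ≤ σ) (hσ1 : σ ≤ 1) (q : Bandit n) {VC : VectorCommitment} {SN : Snark}
  {Q : Polynomial ℕ} (hQ : Suitable VC SN Q)

include hlam hn hε hε1 hσ hσ1 hQ

/-- A fixed vector with a wrong value is rarely consistent with the pulls of the verifier. -/
theorem ex_not_far_le {v : ℕ → ℕ} {π : Fin n → ℝ}
    (hv : ∀ i : Fin n, (v i : ℝ) / 2 ^ fracBits (params lam n ε σ) ∈ Set.Icc (0 : ℝ) 1)
    (hπ : IsOptimalSmooth ((numer (params lam n ε σ) : ℝ) / denom (params lam n ε σ))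
      (fun i : Fin n => (v i : ℝ) / 2 ^ fracBits (params lam n ε σ)) π)
    (hw : ¬ WithinOfOptimal σ ε q.utility
      (π ⬝ᵥ (fun i : Fin n => (v i : ℝ) / 2 ^ fracBits (params lam n ε σ)))) :
    ex (coinFlips (width Q (params lam n ε σ) * width Q (params lam n ε σ))) (fun a =>
      ex (coinFlips (width Q (params lam n ε σ) * (width Q (params lam n ε σ) + 1))) fun b =>
      ex (q.pulls (precision lam n ε) (blocks (rounds (params lam n ε σ))
        (pullCount (params lam n ε σ)) fun j => ⟨position Q (params lam n ε σ)
          (a + 2 ^ (width Q (params lam n ε σ) * width Q (params lam n ε σ)) * b) j,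
            position_lt lam ε σ hn _ j⟩)) fun ys =>
      ind (∀ j < rounds (params lam n ε σ),
        ¬ Far (params lam n ε σ) (blockSum (pullCount (params lam n ε σ)) ys j)
          (v (position Q (params lam n ε σ) a j)) j)) ≤ ENNReal.ofReal (1 / 4) := by
  set x := params lam n ε σ with hx
  have hnx : parN x = n := parN_params _ _ _ _
  have hex : parE x = ⌈1 / ε⌉₊ := parE_params _ _ _ _
  have hkx : parK x = precision lam n ε := parK_params _ _ _ _
  have he2 := two_le_ceil hε hε1
  have he : 1 ≤ parE x := by omega
  obtain ⟨w, hw1, hw2⟩ := exists_far_of_not_within hlam hn hε hε1 q hσ hσ1 hπ hw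
  set D : ℕ → ℝ := fun i => if h : i < n then |(v i : ℝ) / 2 ^ fracBits x - q.utility ⟨i, h⟩| else 0
    with hDdef
  have hDn : ∀ i : Fin n, D i = |(v i : ℝ) / 2 ^ fracBits x - q.utility i| := by
    intro i; simp [hDdef]
  have hD : ∀ i, 0 ≤ D i ∧ D i ≤ 1 := by
    intro i
    simp only [hDdef]
    split_ifs with h
    · refine ⟨abs_nonneg _, ?_⟩
      have h1 := hv ⟨i, h⟩
      have h2 := q.utility_mem ⟨i, h⟩
      rw [abs_le]
      constructor <;> linarith [h1.1, h1.2]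
    · norm_num
  have hfar := ex_forall_lt_tol_le (Q := Q) he hnx hn (hQ.parN_le x) (hQ.rounds_le x) hD hw1 (by
    rw [hex]; simpa only [hDn] using hw2)
  -- Unless some round is inaccurate, passing the test puts the error at every opened position below
  -- `tol / 4 + tol / 8 < tol`.
  calc _ ≤ ex (coinFlips (width Q x * width Q x)) (fun a =>
      ex (coinFlips (width Q x * (width Q x + 1))) fun b => ENNReal.ofReal (1 / 12) +
        ind (∀ j < rounds x, D (position Q x a j) < tol x j)) := by
        refine ex_mono _ fun a => ex_mono _ fun b => (ex_mono _ fun ys => ?_).trans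
          (((ex_add _ _ _).trans (congrArg _ (ex_const _ _))).le.trans
            (add_le_add (ex_exists_round_le hlam hn hε hε1 q _) le_rfl))
        refine (ind_mono fun h => ?_).trans (ind_or_le _ _)
        rw [or_iff_not_imp_left]
        intro hb j hj
        push Not at hb
        have h1 := hb j hj
        have hpos : position Q x (a + 2 ^ (width Q x * width Q x) * b) j = position Q x a j :=
          position_add (lt_of_lt_of_le hj (hQ.rounds_le x))
        rw [show (⟨position Q x (a + 2 ^ (width Q x * width Q x) * b) j,
          position_lt lam ε σ hn _ j⟩ : Fin n) = ⟨position Q x a j, position_lt lam ε σ hn a j⟩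
          from Fin.ext hpos] at h1
        have h2 := h j hj
        rw [far_iff he, not_lt, hkx] at h2
        have h3 := tol_pos he j
        have h4 := hDn ⟨position Q x a j, position_lt lam ε σ hn a j⟩
        rw [show D (position Q x a j) = _ from h4]
        have h5 := abs_sub_le ((v (position Q x a j) : ℝ) / 2 ^ fracBits x)
          ((blockSum (pullCount x) ys j : ℝ) / (pullCount x j * 2 ^ precision lam n ε))
          (q.utility ⟨position Q x a j, position_lt lam ε σ hn a j⟩)
        change |(v (position Q x a j) : ℝ) / 2 ^ fracBits x - _| < _
        linarith
    _ = ENNReal.ofReal (1 / 12) + ex (coinFlips (width Q x * width Q x)) (fun r =>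
        ind (∀ j < rounds x, D (position Q x r j) < tol x j)) := by
        simp only [ex_add, ex_const]
    _ ≤ ENNReal.ofReal (1 / 12) + ENNReal.ofReal (1 / 6) := by gcongr
    _ = _ := by rw [← ENNReal.ofReal_add (by norm_num) (by norm_num)]; norm_num

variable {P : Protocol} (hP : Implements P VC SN Q)

include hP

/-- A deterministic prover wins only if it fools the extractor, opens a position of an extracted
vector to a different value, or is lucky. -/
theorem Implements.ex_cheat_le (F₁ : Data → Data) (F₃ : Data → Data → Data) (m : ℕ)
    (E : Data → Data → ℕ → Data) :
    ex (P.interact lam n ε σ q (fun crs => pure (F₁ crs, F₃ crs)))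
      (fun o => ind (∃ t, o.Denotes t ∧ ¬ WithinOfOptimal σ ε q.utility t)) ≤
    ex (VC.KeyGen lam n) (fun pp =>
      ex (SN.Setup lam (relCode pp n (smoothRat (params lam n ε σ)) (fracBits (params lam n ε σ))))
      fun o => ex (coinFlips m) fun rX =>
      ex (SN.Verify (relCode pp n (smoothRat (params lam n ε σ)) (fracBits (params lam n ε σ)))
        o.fst (F₁ (.pair pp o.fst)).fst (F₁ (.pair pp o.fst)).snd) fun b =>
      ind (b = .nat 1 ∧ ¬ Rel VC pp n (smoothRat (params lam n ε σ)) (fracBits (params lam n ε σ))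
        (F₁ (.pair pp o.fst)).fst (E pp o.fst rX))) +
    (ENNReal.ofReal (1 / 4) + ∑ j ∈ Finset.range (rounds (params lam n ε σ)),
      ex (VC.KeyGen lam n) (fun pp =>
      ex (SN.Setup lam (relCode pp n (smoothRat (params lam n ε σ)) (fracBits (params lam n ε σ))))
      fun o => ex (coinFlips m) fun rX =>
      ex (coinFlips (width Q (params lam n ε σ) * width Q (params lam n ε σ))) fun a =>
      ex (coinFlips (width Q (params lam n ε σ) * (width Q (params lam n ε σ) + 1))) fun b =>
      ind (openingCheck VC Q (params lam n ε σ) pp (F₁ (.pair pp o.fst)).fst.fst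
          (position Q (params lam n ε σ) a j)
          ((F₃ (.pair pp o.fst) (.ofVec (positions Q (params lam n ε σ) a))).nth j)
          (dig (width Q (params lam n ε σ)) (1 + j) b) = .nat 1 ∧
        (((F₃ (.pair pp o.fst) (.ofVec (positions Q (params lam n ε σ) a))).nth j).fst.toNat ≠
          ((E pp o.fst rX).nth (position Q (params lam n ε σ) a j)).toNat ∧
        Rel VC pp n (smoothRat (params lam n ε σ)) (fracBits (params lam n ε σ))
          (F₁ (.pair pp o.fst)).fst (E pp o.fst rX))))) := by
  rw [hP.ex_interact hn]
  simp only [ex_pure]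
  rw [hP.ex_crs lam n ε σ hQ]
  simp only [hP.ex_verifierCoins]
  have hrel := relOf_params lam n ε σ
  rw [← ex_sum]
  simp only [← ex_sum]
  -- All terms become expectations over the same random choices and are then compared pointwise.
  rw [← ex_const (VC.KeyGen lam n) (ENNReal.ofReal (1 / 4)), ← ex_add, ← ex_add]
  refine ex_mono _ fun pp => ?_
  rw [← ex_const (SN.Setup lam _) (ENNReal.ofReal (1 / 4)), ← ex_add, ← ex_add]
  refine ex_mono _ fun o => ?_
  rw [← ex_const (coinFlips m) (ENNReal.ofReal (1 / 4)), ← ex_add, ← ex_add]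
  rw [← ex_const (coinFlips m) (ex (coinFlips (width Q (params lam n ε σ) * width Q (params lam n ε σ))) _)]
  refine ex_mono _ fun rX => ?_
  set x := params lam n ε σ with hx
  set W := width Q x with hW
  set w := E pp o.fst rX
  set crs := Data.pair pp o.fst with hcrs
  set R := Rel VC pp n (smoothRat x) (fracBits x) (F₁ crs).fst w with hR
  -- The extracted vector `w` is determined before the positions are drawn, so the bound for a fixed
  -- vector applies.
  have hlucky : ex (coinFlips (W * W)) (fun a => ex (coinFlips (W * (W + 1))) fun b =>
      ex (q.pulls (precision lam n ε) (blocks (rounds x) (pullCount x) fun j =>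
        ⟨position Q x (a + 2 ^ (W * W) * b) j, position_lt lam ε σ hn _ j⟩)) fun ys =>
      ind (R ∧ ¬ WithinOfOptimal σ ε q.utility
          (((F₁ crs).fst.snd.toNat : ℝ) / ((denom x : ℝ) * 2 ^ fracBits x)) ∧
        ∀ j < rounds x, ¬ Far x (blockSum (pullCount x) ys j) (w.nth (position Q x a j)).toNat j))
      ≤ ENNReal.ofReal (1 / 4) := by
    by_cases h : R ∧ ¬ WithinOfOptimal σ ε q.utility
          (((F₁ crs).fst.snd.toNat : ℝ) / ((denom x : ℝ) * 2 ^ fracBits x))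
    · obtain ⟨⟨v, T, π, h1, h2, h3, h4, h5⟩, h6⟩ := h
      have hv : ∀ i : Fin n, (w.nth i).toNat = v i := by
        intro i
        rw [h1, Data.nth_ofVec]
        simp [Data.toNat, List.getD_eq_getElem?_getD]
      rw [smoothRat_cast] at h4
      rw [smoothRat_den] at h5
      have hT : (F₁ crs).fst.snd.toNat = T := by rw [h2]; rfl
      rw [hT, ← h5] at h6
      simp only [← hv] at h3 h4 h6
      refine le_trans (ex_mono _ fun a => ex_mono _ fun b => ex_mono _ fun ys => ind_mono ?_)
        (ex_not_far_le (VC := VC) (SN := SN) (Q := Q) (v := fun i => (w.nth i).toNat)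
          hlam hn hε hε1 hσ hσ1 q hQ h3 h4 h6)
      exact fun h => h.2.2
    · refine le_trans (ex_le _ fun a _ => ex_le _ fun b _ => ex_le _ fun ys _ => ?_)
        zero_le
      rw [ind_false fun h' => h ⟨h'.1, h'.2.1⟩]
  -- The argument is checked with block `W`, the lowest block of `b`, whatever the positions are.
  have harg : ex (coinFlips (W * W)) (fun a => ex (coinFlips (W * (W + 1))) fun b =>
      ind (argCheck SN Q x crs (F₁ crs) (a + 2 ^ (W * W) * b) = .nat 1 ∧ ¬ R)) ≤
      ex (SN.Verify (relCode pp n (smoothRat x) (fracBits x)) o.fst (F₁ crs).fst (F₁ crs).snd)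
        fun b => ind (b = .nat 1 ∧ ¬ R) := by
    refine ex_le _ fun a ha => ?_
    have h1 : ∀ b, dig W W (a + 2 ^ (W * W) * b) = dig W 0 b := fun b =>
      dig_width_add (lt_of_mem_coinFlips ha) 0
    simp only [argCheck, ← hW, h1]
    rw [← hrel]
    exact ex_guarded_le SN.verify _ _ (Nat.succ_pos W)
  refine le_trans ?_ (add_le_add harg (add_le_add hlucky le_rfl))
  rw [← ex_add]
  rw [← ex_add]
  refine ex_mono_support _ fun a ha => ?_
  have ha := lt_of_mem_coinFlips ha
  rw [← ex_add, ← ex_add]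
  refine ex_mono _ fun b => ?_
  rw [← ex_const (q.pulls _ _) (ind (argCheck SN Q x crs (F₁ crs) (a + 2 ^ (W * W) * b) = .nat 1 ∧ ¬ R)),
    ← ex_const (q.pulls _ _) (∑ j ∈ Finset.range (rounds x), _), ← ex_add, ← ex_add]
  refine ex_mono _ fun ys => ?_
  refine le_trans (ind_mono ?_) ((ind_or_le _ _).trans (add_le_add le_rfl
    ((ind_or_le _ _).trans (add_le_add le_rfl (ind_exists_le _ _)))))
  rintro ⟨t, ht, hnot⟩
  obtain ⟨h1, h2, rfl⟩ := denotes_outputFn ht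
  by_cases hRel : R
  swap
  · exact Or.inl ⟨h1, hRel⟩
  right
  -- If no accepted opening deviates from the extracted vector, the rounds test that vector.
  rw [or_iff_not_imp_right]
  intro h3
  refine ⟨hRel, hnot, fun j hj => ?_⟩
  obtain ⟨h4, h5⟩ := h2 j hj
  have hpos : position Q x (a + 2 ^ (W * W) * b) j = position Q x a j :=
    position_add (lt_of_lt_of_le hj (hQ.rounds_le x))
  rw [hpos, dig_width_add ha] at h4
  rw [positions_add (hQ.rounds_le x)] at h4 h5
  have h6 : ¬ ((F₃ crs (.ofVec (positions Q x a))).nth j).fst.toNat ≠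
      (w.nth (position Q x a j)).toNat := fun h6 => h3 ⟨j, hj, h4, h6, hRel⟩
  rw [← not_not.1 h6]
  exact h5

end
end SmoothBandit

namespace SmoothBandit
open scoped ENNReal

/-! ### The reduction to position binding -/

theorem ex_runNat (A : PPT) (x : Data) (f : Data → ℝ≥0∞) {W : ℕ} (hW : A.coins.eval x.size ≤ W) :
    ex (coinFlips W) (fun r => f (A.runNat x r)) = ex (A.run x) f := by
  rw [ex_run, ← ex_coinFlips_mod hW (fun r => f (A.runNat x r))]
  simp [PPT.runNat]

theorem exists_runNat_of_mem {A : PPT} {x y : Data} (h : y ∈ (A.run x).support) :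
    ∃ r, y = A.runNat x r := by
  rw [PPT.run, PMF.support_map] at h
  obtain ⟨r, hr, rfl⟩ := h
  exact ⟨r, by rw [PPT.runNat, Nat.mod_eq_of_lt (lt_of_mem_coinFlips hr)]⟩

/-- The probability that two openings of the same position to different values are accepted. -/
noncomputable def winProb (VC : VectorCommitment) (n : ℕ) (pp o : Data) : ℝ≥0∞ :=
  ex (VC.Verify pp o.fst o.snd.snd.fst.toNat o.snd.fst.toNat o.snd.snd.snd.snd.fst) fun b =>
  ex (VC.Verify pp o.fst o.snd.snd.snd.fst.toNat o.snd.fst.toNat o.snd.snd.snd.snd.snd) fun b' =>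
    ind (o.snd.fst.toNat < n ∧ o.snd.snd.fst.toNat ≠ o.snd.snd.snd.fst.toNat ∧
      b = .nat 1 ∧ b' = .nat 1)

theorem winProb_le_one (VC : VectorCommitment) (n : ℕ) (pp o : Data) : winProb VC n pp o ≤ 1 :=
  ex_le_one _ fun _ => ex_le_one _ fun _ => ind_le_one _

/-- When the deviating opening is accepted, either the honest one is rejected or both are accepted,
which is a win. -/
theorem ex_and_le (p p' : PMF Data) {A B C : Prop} (hB : B) (hC : C) :
    ex p (fun b => ind (b = .nat 1 ∧ A)) ≤ ex p' (fun b' => ind (b' ≠ .nat 1)) +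
      ex p fun b => ex p' fun b' => ind (B ∧ C ∧ b = .nat 1 ∧ b' = .nat 1) := by
  rw [← ex_const p (ex p' fun b' => ind (b' ≠ .nat 1)), ← ex_add]
  refine ex_mono _ fun b => ?_
  rw [← ex_add, ← ex_const p' (ind (b = .nat 1 ∧ A))]
  refine ex_mono _ fun b' => (ind_mono ?_).trans (ind_or_le _ _)
  rintro ⟨hb, -⟩
  rw [or_iff_not_imp_left, not_not]
  exact fun hb' => ⟨hB, hC, hb, hb'⟩

/-- The opening `j` in the third message `m₃`, together with the honest opening of the extracted
vector `w`. -/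
def forgery (VC : VectorCommitment) (Q : Polynomial ℕ) (x pp m₁ m₃ w : Data) (a r j : ℕ) : Data :=
  .pair m₁.fst.fst (.pair (.nat (position Q x a j)) (.pair (.nat (m₃.nth j).fst.toNat)
    (.pair (.nat (w.nth (position Q x a j)).toNat) (.pair (m₃.nth j).snd
      (VC.opening.runNat (.pair pp (.pair (.nat (w.nth (position Q x a j)).toNat)
        (.pair (.nat (position Q x a j)) (VC.commit.code.eval (.pair pp w)).snd))) r)))))

section

variable {VC : VectorCommitment} {SN : Snark} {Q : Polynomial ℕ} (hQ : Suitable VC SN Q)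
  {lam n : ℕ} {ε σ : ℝ} (hn : 1 ≤ n)

include hQ hn

/-- Since the extracted vector is a witness, the commitment in the first message is its commitment.
It can be opened honestly at the same position, to a different value, and for good parameters that
opening is accepted except with probability `ν`. -/
theorem ex_wrong_opening_le_winProb {ν : ℝ} {pp m₁ m₃ w : Data} {a j : ℕ} (k : ℕ)
    (hpp : pp = ppOf VC (params lam n ε σ) k)
    (hj : j < rounds (params lam n ε σ)) :
    ex (coinFlips (width Q (params lam n ε σ) * (width Q (params lam n ε σ) + 1))) (fun b =>
      ind (openingCheck VC Q (params lam n ε σ) pp m₁.fst.fst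
          (position Q (params lam n ε σ) a j) (m₃.nth j)
          (dig (width Q (params lam n ε σ)) (1 + j) b) = .nat 1 ∧
        ((m₃.nth j).fst.toNat ≠ (w.nth (position Q (params lam n ε σ) a j)).toNat ∧
        Rel VC pp n (smoothRat (params lam n ε σ)) (fracBits (params lam n ε σ)) m₁.fst w)))
      ≤ ENNReal.ofReal ν + ind (¬ VC.GoodParams n ν pp) +
        ex (coinFlips (width Q (params lam n ε σ))) fun r =>
          winProb VC n pp (forgery VC Q (params lam n ε σ) pp m₁ m₃ w a r j) := by
  set x := params lam n ε σ with hx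
  set i := position Q x a j with hi
  have hnx : parN x = n := parN_params _ _ _ _
  have hin : i < n := position_lt lam ε σ hn a j
  refine (ex_guarded_le VC.verify _ _ (by have := hQ.rounds_le x; omega : 1 + j < width Q x + 1)).trans ?_
  by_cases h : (m₃.nth j).fst.toNat ≠ (w.nth i).toNat ∧
      Rel VC pp n (smoothRat x) (fracBits x) m₁.fst w
  swap
  · refine (ex_le _ fun b _ => ?_).trans zero_le
    rw [ind_false fun h' => h h'.2]
  by_cases hg : VC.GoodParams n ν pp
  swap
  · rw [ind_true hg]
    exact (ex_le_one _ fun _ => ind_le_one _).trans (le_add_self.trans le_self_add)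
  rw [ind_false (not_not.2 hg), add_zero]
  obtain ⟨hne, v, T, π, h1, h2, h3, -, -⟩ := id h
  set l := List.ofFn v with hl
  have hll : l.length = n := by simp [hl]
  have hle : ∀ a ∈ l, a ≤ 2 ^ fracBits x := by
    intro a ha
    obtain ⟨i, rfl⟩ := (List.mem_ofFn' _ _).1 ha
    have := (h3 i).2
    rw [div_le_one (by positivity)] at this
    exact_mod_cast this
  have hwi : (w.nth i).toNat = l.getD i 0 := by rw [h1, Data.nth_ofVec]; rfl
  have hcom : m₁.fst.fst = VC.Com pp l := by rw [h2]; rfl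
  have hopen := hg.ex_open_le hll hin
  have hwidth := hQ.opening x k l (hll.trans hnx.symm) hle i (by omega)
  rw [← hpp] at hwidth
  rw [VectorCommitment.Open, ← ex_runNat VC.opening _ _ hwidth] at hopen
  refine le_trans ?_ (add_le_add hopen le_rfl)
  rw [← ex_add, ← ex_const (coinFlips (width Q x)) (ex (VC.verify.run _) _)]
  refine ex_mono _ fun r => ?_
  have hf : forgery VC Q x pp m₁ m₃ w a r j = .pair (VC.Com pp l) (.pair (.nat i)
      (.pair (.nat (m₃.nth j).fst.toNat) (.pair (.nat (l.getD i 0)) (.pair (m₃.nth j).snd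
        (VC.opening.runNat (.pair pp (.pair (.nat (l.getD i 0))
          (.pair (.nat i) (VC.Aux pp l)))) r))))) := by
    rw [forgery, hcom, ← hi, hwi, h1]; rfl
  rw [hf, hcom]
  exact ex_and_le _ _ hin (hwi ▸ hne)

/-- Before the openings are verified, the binding game draws only `pp`. Coins of the argument setup,
of the extractor, of the positions and of the honest opening are fixed by averaging, so the forger
can be deterministic. -/
theorem ex_wrong_opening_le {ν : ℝ}
    (hν : ex (VC.KeyGen lam n) (fun pp => ind (¬ VC.GoodParams n ν pp)) ≤ ENNReal.ofReal ν)
    (F₁ : Data → Data) (F₃ : Data → Data → Data) (m : ℕ) (E : Data → Data → ℕ → Data)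
    {j : ℕ} (hj : j < rounds (params lam n ε σ)) :
    ∃ rS < 2 ^ width Q (params lam n ε σ), ∃ rX < 2 ^ m,
    ∃ a < 2 ^ (width Q (params lam n ε σ) * width Q (params lam n ε σ)),
    ∃ r < 2 ^ width Q (params lam n ε σ),
    ex (VC.KeyGen lam n) (fun pp =>
      ex (SN.Setup lam (relCode pp n (smoothRat (params lam n ε σ)) (fracBits (params lam n ε σ))))
      fun o => ex (coinFlips m) fun rX =>
      ex (coinFlips (width Q (params lam n ε σ) * width Q (params lam n ε σ))) fun a =>
      ex (coinFlips (width Q (params lam n ε σ) * (width Q (params lam n ε σ) + 1))) fun b =>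
      ind (openingCheck VC Q (params lam n ε σ) pp (F₁ (.pair pp o.fst)).fst.fst
          (position Q (params lam n ε σ) a j)
          ((F₃ (.pair pp o.fst) (.ofVec (positions Q (params lam n ε σ) a))).nth j)
          (dig (width Q (params lam n ε σ)) (1 + j) b) = .nat 1 ∧
        (((F₃ (.pair pp o.fst) (.ofVec (positions Q (params lam n ε σ) a))).nth j).fst.toNat ≠
          ((E pp o.fst rX).nth (position Q (params lam n ε σ) a j)).toNat ∧
        Rel VC pp n (smoothRat (params lam n ε σ)) (fracBits (params lam n ε σ))
          (F₁ (.pair pp o.fst)).fst (E pp o.fst rX)))) ≤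
    ENNReal.ofReal ν + ENNReal.ofReal ν + ex (VC.KeyGen lam n) fun pp => winProb VC n pp
      (forgery VC Q (params lam n ε σ) pp (F₁ (.pair pp (argOf SN (params lam n ε σ) pp rS)))
        (F₃ (.pair pp (argOf SN (params lam n ε σ) pp rS))
          (.ofVec (positions Q (params lam n ε σ) a)))
        (E pp (argOf SN (params lam n ε σ) pp rS) rX) a r j) := by
  set x := params lam n ε σ with hx
  set W := width Q x with hW
  -- Each expectation is moved outside the one over `pp` before its variable is fixed, so the choice
  -- does not depend on `pp`.
  have key : ∀ f : ℕ → ℕ → ℕ → ℕ → Data → ℝ≥0∞, (∀ rS rX a r pp, f rS rX a r pp ≤ 1) →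
      ∃ rS < 2 ^ W, ∃ rX < 2 ^ m, ∃ a < 2 ^ (W * W), ∃ r < 2 ^ W,
      ex (VC.KeyGen lam n) (fun pp => ex (coinFlips W) fun rS => ex (coinFlips m) fun rX =>
        ex (coinFlips (W * W)) fun a => ex (coinFlips W) fun r => f rS rX a r pp)
        ≤ ex (VC.KeyGen lam n) (f rS rX a r) := by
    intro f hf
    rw [ex_comm]
    obtain ⟨rS, h1, h1'⟩ := exists_ex_le (coinFlips W) (f := fun rS => ex (VC.KeyGen lam n)
      fun pp => ex (coinFlips m) fun rX => ex (coinFlips (W * W)) fun a => ex (coinFlips W)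
        fun r => f rS rX a r pp) fun rS => ex_le_one _ fun _ => ex_le_one _ fun _ =>
          ex_le_one _ fun _ => ex_le_one _ fun _ => hf _ _ _ _ _
    obtain ⟨rX, h2, h2'⟩ := exists_ex_le (coinFlips m) (f := fun rX => ex (VC.KeyGen lam n)
      fun pp => ex (coinFlips (W * W)) fun a => ex (coinFlips W) fun r => f rS rX a r pp)
        fun rS => ex_le_one _ fun _ => ex_le_one _ fun _ => ex_le_one _ fun _ => hf _ _ _ _ _
    obtain ⟨a, h3, h3'⟩ := exists_ex_le (coinFlips (W * W)) (f := fun a => ex (VC.KeyGen lam n)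
      fun pp => ex (coinFlips W) fun r => f rS rX a r pp)
        fun rS => ex_le_one _ fun _ => ex_le_one _ fun _ => hf _ _ _ _ _
    obtain ⟨r, h4, h4'⟩ := exists_ex_le (coinFlips W) (f := fun r => ex (VC.KeyGen lam n)
      fun pp => f rS rX a r pp) fun rS => ex_le_one _ fun _ => hf _ _ _ _ _
    refine ⟨rS, lt_of_mem_coinFlips h1, rX, lt_of_mem_coinFlips h2, a, lt_of_mem_coinFlips h3,
      r, lt_of_mem_coinFlips h4, h1'.trans ?_⟩
    rw [ex_comm]
    refine h2'.trans ?_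
    rw [ex_comm]
    refine h3'.trans ?_
    rw [ex_comm]
    exact h4'
  obtain ⟨rS, h1, rX, h2, a, h3, r, h4, h5⟩ := key (fun rS rX a r pp => winProb VC n pp
    (forgery VC Q x pp (F₁ (.pair pp (argOf SN x pp rS))) (F₃ (.pair pp (argOf SN x pp rS))
      (.ofVec (positions Q x a))) (E pp (argOf SN x pp rS) rX) a r j))
    fun _ _ _ _ _ => winProb_le_one _ _ _ _
  refine ⟨rS, h1, rX, h2, a, h3, r, h4, le_trans ?_ (add_le_add le_rfl h5)⟩
  refine le_trans ?_ (add_le_add (add_le_add le_rfl hν) le_rfl)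
  rw [← ex_const (VC.KeyGen lam n) (ENNReal.ofReal ν), ← ex_add, ← ex_add]
  refine ex_mono_support _ fun pp hpp => ?_
  obtain ⟨k, hk⟩ := exists_runNat_of_mem hpp
  have hk : pp = ppOf VC x k := hk
  have hsetup : SN.setup.coins.eval (Data.pair (.unary lam) (relOf x pp)).size ≤ W := by
    rw [hk]; exact hQ.setup x k
  rw [Snark.Setup, ← relOf_params, ← hx, ← ex_runNat SN.setup _ _ hsetup,
    ← ex_const (coinFlips W) (ENNReal.ofReal ν + _), ← ex_add]
  refine ex_mono _ fun rS => ?_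
  rw [← ex_const (coinFlips m) (ENNReal.ofReal ν + _), ← ex_add]
  refine ex_mono _ fun rX => ?_
  rw [← ex_const (coinFlips (W * W)) (ENNReal.ofReal ν + _), ← ex_add]
  refine ex_mono _ fun a => ?_
  exact ex_wrong_opening_le_winProb hQ hn k hk hj

end

end SmoothBandit

namespace SmoothBandit
open scoped ENNReal

/-! ### Non-uniform adversaries -/

theorem polyDom_id_comp {f : ℕ → ℕ} (hf : PolyDom f id) :
    PolyDom (fun i : ℕ × Data => f i.1) (fun i => i.1 + i.2.size) :=
  (hf.comp Prod.fst).trans (.of_le fun _ => Nat.le_add_right _ _)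

theorem polyDom_input {adv : ℕ → Data} (hadv : PolyDom (fun l => (adv l).size) id) :
    PolyDom (fun i : ℕ × Data =>
      (Data.pair (.unary i.1) (.pair (adv i.1) (.pair i.2 (.nat 0)))).size)
      (fun i => i.1 + i.2.size) := by
  have h1 : PolyDom (fun l => (Data.unary l).size) id :=
    (((PolyDom.const 3 _).mul (.refl _)).add (.const 2 _)).mono fun l => (Data.size_unary l).le
  refine polyDom_pair (polyDom_id_comp h1) (polyDom_pair (polyDom_id_comp hadv)
    (polyDom_pair (.of_le fun i => Nat.le_add_left _ _) ?_))
  exact (PolyDom.const (Data.nat 0).size _)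

/-- A poly-time function with advice of polynomial length is a deterministic adversary. -/
theorem exists_nonuniform {F : Data → Data} (hF : IsPoly F) {adv : ℕ → Data}
    (hadv : PolyDom (fun l => (adv l).size) id) :
    ∃ A : NonuniformPPT, A.coins = (fun _ => 0) ∧ ∀ lam x r, A.runWith lam x r
      = F (.pair (.unary lam) (.pair (adv lam) (.pair x (.nat r)))) := by
  obtain ⟨c, hc, hp⟩ := hF
  obtain ⟨p, hp⟩ := (hp.comp fun i : ℕ × Data =>
    Data.pair (.unary i.1) (.pair (adv i.1) (.pair i.2 (.nat 0)))).trans (polyDom_input hadv)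
  obtain ⟨a, ha⟩ := hadv
  refine ⟨⟨c, adv, fun _ => 0, p + a, fun lam => ?_, fun _ => Nat.zero_le _, fun lam x r hr => ?_⟩,
    rfl, fun lam x r => hc _⟩
  · rw [Polynomial.eval_add]
    exact (ha lam).trans (Nat.le_add_left _ _)
  · rw [Polynomial.eval_add]
    obtain rfl : r = 0 := by simpa using hr
    exact (hp (lam, x)).trans (Nat.le_add_right _ _)

/-- An adversary that runs another one with fixed coins. -/
theorem exists_nonuniform_comp (X : NonuniformPPT) {F G : Data → Data} (hF : IsPoly F)
    (hG : IsPoly G) {adv : ℕ → Data} (hadv : PolyDom (fun l => (adv l).size) id) {c : ℕ → ℕ}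
    (hc : ∀ lam, c lam < 2 ^ X.coins lam) :
    ∃ A : NonuniformPPT, A.coins = (fun _ => 0) ∧ ∀ lam x r, A.runWith lam x r
      = G (.pair (.pair (.unary lam) (.pair (adv lam) (.pair x (.nat r))))
          (X.runWith lam (F (.pair (.unary lam) (.pair (adv lam) (.pair x (.nat r))))) (c lam))) := by
  -- The advice of the composite adversary also holds the advice and the coins of `X`; `strip`
  -- restores the input that `F` and `G` expect.
  let strip : Data → Data := fun z => .pair z.fst (.pair z.snd.fst.snd z.snd.snd)
  have hs : IsPoly strip := by
    change IsPoly fun z : Data => Data.pair z.fst (.pair z.snd.fst.snd z.snd.snd)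
    fun_prop
  have hFs : IsPoly (fun z => F (strip z)) := hF.comp hs
  have h1 : IsPoly (fun z : Data => Data.pair z.fst (.pair z.snd.fst.fst.fst
    (.pair (F (strip z)) z.snd.fst.fst.snd))) := by fun_prop
  have h2 : IsPoly (fun z : Data => G (.pair (strip z.fst) z.snd)) :=
    hG.comp (g := G) (f := fun z : Data => Data.pair (strip z.fst) z.snd)
      (IsPoly.data_pair (hs.comp (by fun_prop)) (by fun_prop))
  let adv' : ℕ → Data := fun l => .pair (.pair (X.advice l) (.nat (c l))) (adv l)
  have hXadv : PolyDom (fun l => (X.advice l).size) id := ⟨X.bound, X.advice_le⟩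
  have hXcoins : PolyDom X.coins id := ⟨X.bound, X.coins_le⟩
  have hcsize : PolyDom (fun l => (Data.nat (c l)).size) id :=
    (((PolyDom.const 2 _).mul hXcoins).add (.const 2 _)).mono fun l => size_nat_le_of_lt (hc l)
  have hadv' : PolyDom (fun l => (adv' l).size) id :=
    polyDom_pair (polyDom_pair hXadv hcsize) hadv
  obtain ⟨f', ef, pf⟩ := h1
  obtain ⟨g', eg, pg⟩ := h2
  let inp : ℕ × Data → Data := fun i => .pair (.unary i.1) (.pair (adv' i.1) (.pair i.2 (.nat 0)))
  have hinp : PolyDom (fun i => (inp i).size) (fun i : ℕ × Data => i.1 + i.2.size) :=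
    polyDom_input hadv'
  have hFi : PolyDom (fun i => (F (strip (inp i))).size) (fun i : ℕ × Data => i.1 + i.2.size) :=
    (hFs.polyDom_esize.comp inp).trans hinp
  have hf'cost : PolyDom (fun i => f'.cost (inp i)) (fun i : ℕ × Data => i.1 + i.2.size) :=
    (pf.comp inp).trans hinp
  -- The clock of `X` is valid only for its own advice and coins in range, so the code of `X` is
  -- bounded on the inputs that occur instead of being treated as an `IsPoly` function.
  have hXcost : PolyDom (fun i => X.code.cost (f'.eval (inp i)))
      (fun i : ℕ × Data => i.1 + i.2.size) := by
    have h3 : PolyDom (fun i : ℕ × Data => i.1 + (F (strip (inp i))).size)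
      (fun i : ℕ × Data => i.1 + i.2.size) := (PolyDom.of_le fun _ => Nat.le_add_right _ _).add hFi
    refine (h3.eval X.bound).mono fun i => ?_
    rw [show f'.eval (inp i) = _ from ef _]
    exact X.time_le i.1 _ _ (hc i.1)
  have hXout : PolyDom (fun i => (X.code.eval (f'.eval (inp i))).size)
      (fun i : ℕ × Data => i.1 + i.2.size) := hXcost.mono fun _ => Code.size_eval_le _ _
  have hg'cost : PolyDom (fun i => g'.cost (.pair (inp i) (X.code.eval (f'.eval (inp i)))))
      (fun i : ℕ × Data => i.1 + i.2.size) :=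
    (pg.comp fun i => Data.pair (inp i) (X.code.eval (f'.eval (inp i)))).trans
      (polyDom_pair hinp hXout)
  have htot : PolyDom (fun i => (Code.comp g' (.pair .id (.comp X.code f'))).cost (inp i))
      (fun i : ℕ × Data => i.1 + i.2.size) := by
    refine (((PolyDom.const 4 _).add ((hinp.add hinp).add (hf'cost.add hXcost))).add hg'cost).mono
      fun i => ?_
    simp only [Code.cost, Code.eval]
    omega
  obtain ⟨p, hp⟩ := htot
  obtain ⟨a, ha⟩ := hadv'
  refine ⟨⟨.comp g' (.pair .id (.comp X.code f')), adv', fun _ => 0, p + a, fun lam => ?_, fun _ => Nat.zero_le _, fun lam x r hr => ?_⟩,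
    rfl, fun lam x r => ?_⟩
  · rw [Polynomial.eval_add]
    exact (ha lam).trans (Nat.le_add_left _ _)
  · rw [Polynomial.eval_add]
    obtain rfl : r = 0 := by simpa using hr
    exact (hp (lam, x)).trans (Nat.le_add_right _ _)
  · simp only [NonuniformPPT.runWith, Code.eval]
    rw [show f'.eval (.pair (.unary lam) (.pair (adv' lam) (.pair x (.nat r)))) = _ from ef _]
    exact eg (.pair _ _)

/-! ### Cheating provers with fixed coins -/

namespace CheatingProver

variable (A : CheatingProver)

/-- What the prover knows apart from the output of the setup. -/
def context (lam : ℕ) (xs : List ℕ) (r : ℕ) : Data :=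
  .pair (.pair (.unary lam) (.pair (A.advice lam) (.nat r))) (.ofVec xs)

def firstOn (ctx crs : Data) : Data := A.first.eval (.pair ctx.fst (.pair crs ctx.snd))

def secondOn (ctx crs m₂ : Data) : Data :=
  A.second.eval (.pair (.pair ctx.fst (.pair crs ctx.snd)) m₂)

end CheatingProver

@[fun_prop]
theorem IsPoly.firstOn {α : Type} [Enc α] (A : CheatingProver) {x y : α → Data} (hx : IsPoly x)
    (hy : IsPoly y) : IsPoly (fun a => A.firstOn (x a) (y a)) :=
  IsPoly.of_code A.first A.bound A.first_le (by fun_prop)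

@[fun_prop]
theorem IsPoly.secondOn {α : Type} [Enc α] (A : CheatingProver) {x y z : α → Data} (hx : IsPoly x)
    (hy : IsPoly y) (hz : IsPoly z) : IsPoly (fun a => A.secondOn (x a) (y a) (z a)) :=
  IsPoly.of_code A.second A.bound A.second_le (by fun_prop)

@[fun_prop]
theorem IsPoly.forgery {α : Type} [Enc α] (VC : VectorCommitment) (Q : Polynomial ℕ)
    {x pp m₁ m₃ w : α → Data} {f r j : α → ℕ} (hx : IsPoly x) (hpp : IsPoly pp) (hm₁ : IsPoly m₁)
    (hm₃ : IsPoly m₃) (hw : IsPoly w) (hf : IsPoly f) (hr : IsPoly r) (hj : IsPoly j) :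
    IsPoly (fun a => forgery VC Q (x a) (pp a) (m₁ a) (m₃ a) (w a) (f a) (r a) (j a)) := by
  unfold SmoothBandit.forgery
  fun_prop

section

variable {P : Protocol} {VC : VectorCommitment} {SN : Snark} {Q : Polynomial ℕ}
  (hP : Implements P VC SN Q) (A : CheatingProver)

include hP in
/-- Some coins and rewards of the prover are at least as good as random ones. -/
theorem Implements.exists_context_ge {n : ℕ} (hn : 1 ≤ n) (lam : ℕ) (ε σ : ℝ) (q : Bandit n)
    {f : Data → ℝ≥0∞} (hf : ∀ o, f o ≤ 1) :
    ∃ r < 2 ^ A.coins lam, ∃ xs : List ℕ, xs.length = n * A.pulls lam ∧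
      (∀ z ∈ xs, z ≤ 2 ^ A.prec lam) ∧
      ex (P.interact lam n ε σ q (A.strategy lam q)) f ≤
        ex (P.interact lam n ε σ q (fun crs => pure (A.firstOn (A.context lam xs r) crs,
          A.secondOn (A.context lam xs r) crs))) f := by
  simp only [hP.ex_interact hn, CheatingProver.strategy, ex_bind, ex_pure]
  -- The coins of the prover are independent of the setup, so they can be drawn before it and fixed.
  rw [ex_comm]
  obtain ⟨r, hr, h1⟩ := exists_ex_le (coinFlips (A.coins lam)) (f := fun r =>
    ex (P.crs lam n ε σ) fun crs =>
      ex (q.pulls (A.prec lam) ((List.finRange n).flatMap (List.replicate (A.pulls lam)))) fun xs =>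
      ex (coinFlips (P.verifierCoinCount lam n ε σ)) fun s =>
      ex (q.pulls (precision lam n ε) (blocks (rounds (params lam n ε σ))
        (pullCount (params lam n ε σ))
        fun j => ⟨position Q (params lam n ε σ) s j, position_lt lam ε σ hn s j⟩)) fun ys =>
      f (outputFn VC SN Q (params lam n ε σ) crs (.ofVec ys) s (A.first.eval (A.view lam crs xs r))
        (A.second.eval (.pair (A.view lam crs xs r) (.ofVec (positions Q (params lam n ε σ) s))))))
    fun r => ex_le_one _ fun _ => ex_le_one _ fun _ => ex_le_one _ fun _ => ex_le_one _ fun _ => hf _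
  refine ⟨r, lt_of_mem_coinFlips hr, ?_⟩
  obtain ⟨xs, hxs, h2⟩ := exists_ex_le
    (q.pulls (A.prec lam) ((List.finRange n).flatMap (List.replicate (A.pulls lam)))) (f := fun xs =>
    ex (P.crs lam n ε σ) fun crs =>
      ex (coinFlips (P.verifierCoinCount lam n ε σ)) fun s =>
      ex (q.pulls (precision lam n ε) (blocks (rounds (params lam n ε σ))
        (pullCount (params lam n ε σ))
        fun j => ⟨position Q (params lam n ε σ) s j, position_lt lam ε σ hn s j⟩)) fun ys =>
      f (outputFn VC SN Q (params lam n ε σ) crs (.ofVec ys) s (A.first.eval (A.view lam crs xs r))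
        (A.second.eval (.pair (A.view lam crs xs r) (.ofVec (positions Q (params lam n ε σ) s))))))
    fun r => ex_le_one _ fun _ => ex_le_one _ fun _ => ex_le_one _ fun _ => hf _
  refine ⟨xs, ?_, q.pulls_le _ hxs, h1.trans ((ex_comm _ _ _).le.trans h2)⟩
  rw [q.length_pulls _ hxs]
  simp [List.length_flatMap]

theorem polyDom_context {n : ℕ → ℕ} (hn : PolyDom n id) {r : ℕ → ℕ} {xs : ℕ → List ℕ}
    (hr : ∀ lam, r lam < 2 ^ A.coins lam) (hl : ∀ lam, (xs lam).length = n lam * A.pulls lam)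
    (hxs : ∀ lam, ∀ z ∈ xs lam, z ≤ 2 ^ A.prec lam) :
    PolyDom (fun lam => (A.context lam (xs lam) (r lam)).size) id := by
  have h1 : PolyDom (fun l => (Data.unary l).size) id :=
    (((PolyDom.const 3 _).mul (.refl _)).add (.const 2 _)).mono fun l => (Data.size_unary l).le
  have h2 : PolyDom (fun l => (A.advice l).size) id := ⟨A.bound, A.advice_le⟩
  have h3 : PolyDom A.coins id := ⟨A.bound, A.coins_le⟩
  have h4 : PolyDom A.pulls id := ⟨A.bound, A.pulls_le⟩
  have h5 : PolyDom A.prec id := ⟨A.bound, A.prec_le⟩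
  have h6 : PolyDom (fun l => (Data.nat (r l)).size) id :=
    (((PolyDom.const 2 _).mul h3).add (.const 2 _)).mono fun l => size_nat_le_of_lt (hr l)
  have h7 : PolyDom (fun l => (Data.ofVec (xs l)).size) id :=
    ((PolyDom.const 2 _).add ((hn.mul h4).mul (((PolyDom.const 2 _).mul h5).add (.const 5 _)))).mono
      fun l => by rw [← hl]; exact size_ofVec_le (hxs l)
  exact polyDom_pair (polyDom_pair h1 (polyDom_pair h2 h6)) h7

end

end SmoothBandit

namespace SmoothBandit
open scoped ENNReal

/-! ### Asymptotic security -/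

theorem toReal_le_of_le {a : ℝ≥0∞} {b : ℝ} (hb : 0 ≤ b) (h : a ≤ ENNReal.ofReal b) : a.toReal ≤ b :=
  ENNReal.toReal_le_of_le_ofReal hb h

/-- This accounts for the finitely many security parameters at which the precision is too low. -/
theorem negligible_small (L : ℕ) : Negligible (fun lam => if lam < L then 1 else 0) :=
  negligible_of_eventually_zero (by
    filter_upwards [Filter.eventually_ge_atTop L] with lam h
    rw [if_neg (not_lt.2 h)])

section

variable {P : Protocol} {VC : VectorCommitment} {SN : Snark} {Q : Polynomial ℕ}
  (hP : Implements P VC SN Q) (hQ : Suitable VC SN Q) {n : ℕ → ℕ} {ε σ : ℕ → ℝ}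
  (hn : ∀ lam, 1 ≤ n lam) (hε : ∀ lam, 0 < ε lam ∧ ε lam < 1)
  (hσ : ∀ lam, 1 / (n lam : ℝ) ≤ σ lam ∧ σ lam ≤ 1)
  (hnb : PolyBounded n) (heb : PolyBounded (fun lam => ⌈1 / ε lam⌉₊))

include hε hσ hnb heb in
theorem polyBounded_size_params :
    PolyDom (fun lam => (params lam (n lam) (ε lam) (σ lam)).size) id := by
  have h1 := polyDom_size_params (ι := ℕ) id n ε σ hε fun lam => ⟨le_trans (by positivity) (hσ lam).1,
    (hσ lam).2⟩
  exact h1.trans (((PolyDom.refl _).add hnb).add heb)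

include hε hσ hnb heb in
theorem polyBounded_rounds :
    PolyBounded (fun lam => rounds (params lam (n lam) (ε lam) (σ lam))) :=
  (polyDom_rounds.comp _).trans (polyBounded_size_params hε hσ hnb heb)

-- The failure probability is `1 / 4` plus a polynomial multiple of `|ν|`; absolute values appear
-- because `ν` need not be nonnegative.
include hP hQ hn hε hσ hnb heb in
theorem Implements.complete (hc : SN.PerfectlyComplete VC) (q : ∀ lam, Bandit (n lam))
    (hVC : VC.Correct n) : ∃ ν : ℕ → ℝ, Negligible ν ∧ ∀ lam,
      2 / 3 - ν lam ≤ prob ((P.interact lam (n lam) (ε lam) (σ lam) (q lam)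
        (P.honest lam (n lam) (ε lam) (σ lam) (q lam))).map
        (fun o => ∃ t, o.Denotes t ∧ WithinOfOptimal (σ lam) (ε lam) (q lam).utility t)) := by
  obtain ⟨ν, hν, hgood⟩ := hVC.exists_good
  refine ⟨fun lam => rounds (params lam (n lam) (ε lam) (σ lam)) * (|ν lam| + |ν lam|) +
    (if lam < 8 then 1 else 0), (Negligible.poly_mul ?_ (polyBounded_rounds hε hσ hnb heb)).add
      (negligible_small 8), fun lam => ?_⟩
  · have h1 : Negligible (fun lam => |ν lam|) := hν.mono (by simp)
    exact h1.add h1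
  have hab : (0 : ℝ) ≤ rounds (params lam (n lam) (ε lam) (σ lam)) * (|ν lam| + |ν lam|) := by
    positivity
  beta_reduce
  split_ifs with hlam
  · refine le_trans ?_ (prob_nonneg _)
    linarith
  rw [not_lt] at hlam
  have h2 := hP.ex_honest_le hQ hlam (hn lam) (hε lam).1 (hε lam).2 (hσ lam).1 (hσ lam).2 (q lam) hc
    (hgood lam)
  have h3 := ex_add_ex_not (P.interact lam (n lam) (ε lam) (σ lam) (q lam)
    (P.honest lam (n lam) (ε lam) (σ lam) (q lam)))
    (fun o => ∃ t, o.Denotes t ∧ WithinOfOptimal (σ lam) (ε lam) (q lam).utility t)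
  rw [prob_eq, ex_map]
  set a := ex (P.interact lam (n lam) (ε lam) (σ lam) (q lam)
    (P.honest lam (n lam) (ε lam) (σ lam) (q lam)))
    (fun o => ind (¬ ∃ t, o.Denotes t ∧ WithinOfOptimal (σ lam) (ε lam) (q lam).utility t))
  set b := ex (P.interact lam (n lam) (ε lam) (σ lam) (q lam)
    (P.honest lam (n lam) (ε lam) (σ lam) (q lam)))
    (fun o => ind (∃ t, o.Denotes t ∧ WithinOfOptimal (σ lam) (ε lam) (q lam).utility t))
  have ha : a ≠ ⊤ := ne_top_of_le_ne_top ENNReal.one_ne_top (h3 ▸ le_self_add)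
  have hb : b ≠ ⊤ := ne_top_of_le_ne_top ENNReal.one_ne_top (h3 ▸ le_add_self)
  have h4 : a.toReal + b.toReal = 1 := by
    rw [← ENNReal.toReal_add ha hb, h3, ENNReal.toReal_one]
  have h5 : a.toReal ≤ 1 / 4 + rounds (params lam (n lam) (ε lam) (σ lam)) * (|ν lam| + |ν lam|) := by
    refine toReal_le_of_le (by positivity) (h2.trans ?_)
    rw [ENNReal.ofReal_add (by norm_num) hab, ENNReal.ofReal_mul (by positivity),
      ENNReal.ofReal_natCast, ENNReal.ofReal_add (abs_nonneg _) (abs_nonneg _)]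
    gcongr <;> exact le_abs_self _
  linarith

-- The winning probability is at most `1 / 4`, plus the advantage `κ` against knowledge soundness,
-- plus for each round the advantage `β` against position binding and the two errors of correctness.
include hP hQ hn hε hσ hnb heb in
theorem Implements.sound (q : ∀ lam, Bandit (n lam))
    (hVC : VC.Correct n) (hbind : VC.PositionBinding n) (hSN : SN.KnowledgeSound VC n)
    (A : CheatingProver) : ∃ ν : ℕ → ℝ, Negligible ν ∧ ∀ lam,
      prob ((P.interact lam (n lam) (ε lam) (σ lam) (q lam) (A.strategy lam (q lam))).map
        (fun o => ∃ t, o.Denotes t ∧ ¬ WithinOfOptimal (σ lam) (ε lam) (q lam).utility t))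
        ≤ 1 / 3 + ν lam := by
  have hsz := polyBounded_size_params hε hσ hnb heb
  set x : ℕ → Data := fun lam => params lam (n lam) (ε lam) (σ lam) with hx
  have hnx : ∀ lam, parN (x lam) = n lam := fun lam => parN_params _ _ _ _
  have hs : ∀ lam, 1 / (n lam : ℚ) ≤ smoothRat (x lam) ∧ smoothRat (x lam) ≤ 1 := fun lam => by
    have := smoothRat_mem (x := x lam) (by rw [hnx]; exact hn lam)
    rwa [hnx] at this
  have hell : PolyDom (fun lam => fracBits (x lam)) id := (polyDom_fracBits.comp _).trans hsz
  have hden : PolyDom (fun lam => (smoothRat (x lam)).den.size) id := by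
    refine (hell.add (.const 1 _)).mono fun lam => ?_
    rw [smoothRat_den, Nat.size_le, pow_succ]
    have : denom (x lam) ≤ 2 ^ fracBits (x lam) := by
      unfold denom
      split
      · exact Nat.one_le_two_pow
      · exact le_rfl
    have : 0 < 2 ^ fracBits (x lam) := by positivity
    omega
  obtain ⟨ν, hν, hgood⟩ := hVC.exists_good
  -- fix the coins and the rewards of the prover
  choose rA hrA xs hxl hxs hA using fun lam => hP.exists_context_ge A (hn lam) lam (ε lam) (σ lam)
    (q lam) (f := fun o => ind (∃ t, o.Denotes t ∧
      ¬ WithinOfOptimal (σ lam) (ε lam) (q lam).utility t)) (fun _ => ind_le_one _)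
  set ctx : ℕ → Data := fun lam => A.context lam (xs lam) (rA lam) with hctx
  have hctxb : PolyDom (fun lam => (ctx lam).size) id := polyDom_context A hnb hrA hxl hxs
  -- the adversary against the argument system
  have hF : IsPoly (fun z : Data => A.firstOn z.snd.fst
      (.pair z.snd.snd.fst.fst.fst z.snd.snd.fst.snd)) := by fun_prop
  obtain ⟨A', hA'c, hA'⟩ := exists_nonuniform hF hctxb
  obtain ⟨X, hX⟩ := hSN (fun lam => smoothRat (x lam)) (fun lam => fracBits (x lam)) hs hden hell A'
  set κ : ℕ → ℝ := fun lam => prob (do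
      let pp ← VC.KeyGen lam (n lam)
      let R := relCode pp (n lam) (smoothRat (x lam)) (fracBits (x lam))
      let o ← SN.Setup lam R
      let r ← coinFlips (A'.coins lam)
      let φ := (A'.runWith lam (.pair R o.fst) r).fst
      let pf := (A'.runWith lam (.pair R o.fst) r).snd
      let w ← X.run lam (.pair (.pair R o.fst) (.nat r))
      let b ← SN.Verify R o.fst φ pf
      pure (b = .nat 1 ∧ ¬ Rel VC pp (n lam) (smoothRat (x lam)) (fracBits (x lam)) φ w)) with hκ
  -- The adversary `A'` tosses no coins, so the extractor is given the coins `0`.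
  let E : ℕ → Data → Data → ℕ → Data := fun lam pp c r => X.runWith lam
    (.pair (.pair (relCode pp (n lam) (smoothRat (x lam)) (fracBits (x lam))) c) (.nat 0)) r
  have hcheat := fun lam (hlam : 8 ≤ lam) => hP.ex_cheat_le hlam (hn lam) (hε lam).1 (hε lam).2
    (hσ lam).1 (hσ lam).2 (q lam) hQ (A.firstOn (ctx lam)) (A.secondOn (ctx lam)) (X.coins lam)
    (E lam)
  have hfool : ∀ lam, ex (VC.KeyGen lam (n lam)) (fun pp =>
      ex (SN.Setup lam (relCode pp (n lam) (smoothRat (x lam)) (fracBits (x lam)))) fun o =>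
      ex (coinFlips (X.coins lam)) fun rX =>
      ex (SN.Verify (relCode pp (n lam) (smoothRat (x lam)) (fracBits (x lam)))
        o.fst (A.firstOn (ctx lam) (.pair pp o.fst)).fst
          (A.firstOn (ctx lam) (.pair pp o.fst)).snd) fun b =>
      ind (b = .nat 1 ∧ ¬ Rel VC pp (n lam) (smoothRat (x lam)) (fracBits (x lam))
        (A.firstOn (ctx lam) (.pair pp o.fst)).fst (E lam pp o.fst rX)))
      = ENNReal.ofReal (κ lam) := by
    intro lam
    simp only [hκ, ofReal_prob, ex_bind, ex_pure, hA'c, ex_coinFlips_zero, NonuniformPPT.run, ex_map,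
      hA', relCode, Data.fst, Data.snd, E]
  -- the adversary against the commitment scheme
  have hforge : ∀ lam, ∃ j rS rX a r, rX < 2 ^ X.coins lam ∧ j < rounds (x lam) ∧
      rS < 2 ^ width Q (x lam) ∧ a < 2 ^ (width Q (x lam) * width Q (x lam)) ∧
      r < 2 ^ width Q (x lam) ∧ ∀ j' < rounds (x lam),
      ex (VC.KeyGen lam (n lam)) (fun pp =>
        ex (SN.Setup lam (relCode pp (n lam) (smoothRat (x lam)) (fracBits (x lam)))) fun o =>
        ex (coinFlips (X.coins lam)) fun rX =>
        ex (coinFlips (width Q (x lam) * width Q (x lam))) fun a =>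
        ex (coinFlips (width Q (x lam) * (width Q (x lam) + 1))) fun b =>
        ind (openingCheck VC Q (x lam) pp (A.firstOn (ctx lam) (.pair pp o.fst)).fst.fst
          (position Q (x lam) a j')
          ((A.secondOn (ctx lam) (.pair pp o.fst) (.ofVec (positions Q (x lam) a))).nth j')
          (dig (width Q (x lam)) (1 + j') b) = .nat 1 ∧
        (((A.secondOn (ctx lam) (.pair pp o.fst) (.ofVec (positions Q (x lam) a))).nth j').fst.toNat ≠
          ((E lam pp o.fst rX).nth (position Q (x lam) a j')).toNat ∧
        Rel VC pp (n lam) (smoothRat (x lam)) (fracBits (x lam))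
          (A.firstOn (ctx lam) (.pair pp o.fst)).fst (E lam pp o.fst rX)))) ≤
      ENNReal.ofReal (ν lam) + ENNReal.ofReal (ν lam) + ex (VC.KeyGen lam (n lam)) fun pp =>
        winProb VC (n lam) pp (forgery VC Q (x lam) pp
          (A.firstOn (ctx lam) (.pair pp (argOf SN (x lam) pp rS)))
          (A.secondOn (ctx lam) (.pair pp (argOf SN (x lam) pp rS)) (.ofVec (positions Q (x lam) a)))
          (E lam pp (argOf SN (x lam) pp rS) rX) a r j) := by
    intro lam
    have hG : 0 < rounds (x lam) := rounds_pos (by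
      rw [hx, parE_params]; exact (two_le_ceil (hε lam).1 (hε lam).2).trans' one_le_two)
    -- A single forger has to bound all rounds, so it attacks the round in which a deviating opening
    -- is most likely.
    obtain ⟨j, hj, hmax⟩ := Finset.exists_max_image (Finset.range (rounds (x lam))) (fun j' =>
      ex (VC.KeyGen lam (n lam)) (fun pp =>
        ex (SN.Setup lam (relCode pp (n lam) (smoothRat (x lam)) (fracBits (x lam)))) fun o =>
        ex (coinFlips (X.coins lam)) fun rX =>
        ex (coinFlips (width Q (x lam) * width Q (x lam))) fun a =>
        ex (coinFlips (width Q (x lam) * (width Q (x lam) + 1))) fun b =>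
        ind (openingCheck VC Q (x lam) pp (A.firstOn (ctx lam) (.pair pp o.fst)).fst.fst
          (position Q (x lam) a j')
          ((A.secondOn (ctx lam) (.pair pp o.fst) (.ofVec (positions Q (x lam) a))).nth j')
          (dig (width Q (x lam)) (1 + j') b) = .nat 1 ∧
        (((A.secondOn (ctx lam) (.pair pp o.fst) (.ofVec (positions Q (x lam) a))).nth j').fst.toNat ≠
          ((E lam pp o.fst rX).nth (position Q (x lam) a j')).toNat ∧
        Rel VC pp (n lam) (smoothRat (x lam)) (fracBits (x lam))
          (A.firstOn (ctx lam) (.pair pp o.fst)).fst (E lam pp o.fst rX)))))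
      ⟨0, Finset.mem_range.2 hG⟩
    have hj := Finset.mem_range.1 hj
    obtain ⟨rS, h1, rX, h2, a, h3, r, h4, h5⟩ := ex_wrong_opening_le (SN := SN) hQ (hn lam)
      (hgood lam) (A.firstOn (ctx lam)) (A.secondOn (ctx lam)) (X.coins lam) (E lam) hj
    exact ⟨j, rS, rX, a, r, h2, hj, h1, h3, h4,
      fun j' hj' => (hmax j' (Finset.mem_range.2 hj')).trans h5⟩
  choose j rS rX a r hrX hj hrS ha hr hwin using hforge
  have hW : PolyDom (fun lam => width Q (x lam)) id := hsz.eval Q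
  let adv : ℕ → Data := fun lam => .pair (x lam) (.pair (ctx lam) (.pair (.nat (j lam))
    (.pair (.nat (rS lam)) (.pair (.nat (a lam)) (.nat (r lam))))))
  have hnat : ∀ {y W : ℕ → ℕ}, PolyDom W id → (∀ lam, y lam < 2 ^ W lam) →
      PolyDom (fun lam => (Data.nat (y lam)).size) id := fun hW h =>
    (((PolyDom.const 2 _).mul hW).add (.const 2 _)).mono fun lam => size_nat_le_of_lt (h lam)
  have hadv : PolyDom (fun lam => (adv lam).size) id :=
    polyDom_pair hsz (polyDom_pair hctxb (polyDom_pair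
      (hnat hW fun lam => (hj lam).trans_le ((hQ.rounds_le _).trans Nat.lt_two_pow_self.le))
      (polyDom_pair (hnat hW hrS) (polyDom_pair (hnat (hW.mul hW) ha) (hnat hW hr)))))
  -- `z.snd.fst` is the advice and `z.snd.snd.fst.fst` are the parameters of the commitment scheme
  have hBF : IsPoly (fun z : Data => Data.pair (.pair (relOf z.snd.fst.fst z.snd.snd.fst.fst)
      (argOf SN z.snd.fst.fst z.snd.snd.fst.fst z.snd.fst.snd.snd.snd.fst.toNat)) (.nat 0)) := by
    fun_prop
  have hBG : IsPoly (fun z : Data => forgery VC Q z.fst.snd.fst.fst z.fst.snd.snd.fst.fst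
      (A.firstOn z.fst.snd.fst.snd.fst (.pair z.fst.snd.snd.fst.fst (argOf SN z.fst.snd.fst.fst
        z.fst.snd.snd.fst.fst z.fst.snd.fst.snd.snd.snd.fst.toNat)))
      (A.secondOn z.fst.snd.fst.snd.fst (.pair z.fst.snd.snd.fst.fst (argOf SN z.fst.snd.fst.fst
        z.fst.snd.snd.fst.fst z.fst.snd.fst.snd.snd.snd.fst.toNat))
        (.ofVec (positions Q z.fst.snd.fst.fst z.fst.snd.fst.snd.snd.snd.snd.fst.toNat)))
      z.snd z.fst.snd.fst.snd.snd.snd.snd.fst.toNat z.fst.snd.fst.snd.snd.snd.snd.snd.toNat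
      z.fst.snd.fst.snd.snd.fst.toNat) := by fun_prop
  obtain ⟨B, hBc, hB⟩ := exists_nonuniform_comp X hBF hBG hadv hrX
  set β : ℕ → ℝ := fun lam => prob (do
    let pp ← VC.KeyGen lam (n lam)
    let o ← B.run lam (.pair pp (.unary (n lam)))
    let c := o.fst
    let i := o.snd.fst.toNat
    let a := o.snd.snd.fst.toNat
    let a' := o.snd.snd.snd.fst.toNat
    let pf := o.snd.snd.snd.snd.fst
    let pf' := o.snd.snd.snd.snd.snd
    let b ← VC.Verify pp c a i pf
    let b' ← VC.Verify pp c a' i pf'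
    pure (i < n lam ∧ a ≠ a' ∧ b = .nat 1 ∧ b' = .nat 1)) with hβ
  have hβeq : ∀ lam, ex (VC.KeyGen lam (n lam)) (fun pp =>
        winProb VC (n lam) pp (forgery VC Q (x lam) pp
          (A.firstOn (ctx lam) (.pair pp (argOf SN (x lam) pp (rS lam))))
          (A.secondOn (ctx lam) (.pair pp (argOf SN (x lam) pp (rS lam)))
            (.ofVec (positions Q (x lam) (a lam))))
          (E lam pp (argOf SN (x lam) pp (rS lam)) (rX lam)) (a lam) (r lam) (j lam)))
      = ENNReal.ofReal (β lam) := by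
    intro lam
    have hrel : ∀ pp, relOf (x lam) pp
      = relCode pp (n lam) (smoothRat (x lam)) (fracBits (x lam)) := fun pp => relOf_params _ _ _ _ pp
    simp only [hβ, ofReal_prob, ex_bind, ex_pure, NonuniformPPT.run, ex_map, hBc, ex_coinFlips_zero,
      hB, Data.fst, Data.snd, Data.toNat, adv, hrel]
    rfl
  have hκn : Negligible κ := hX
  have hβn : Negligible β := hbind B
  -- In each round `ν` occurs twice, for bad parameters and for a rejected honest opening. The last
  -- summand makes the claim trivial for `lam < 8`.
  refine ⟨fun lam => κ lam + rounds (x lam) * (|ν lam| + |ν lam| + β lam) +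
    (if lam < 8 then 1 else 0), (hκn.add (Negligible.poly_mul ?_
      (polyBounded_rounds hε hσ hnb heb))).add (negligible_small 8), fun lam => ?_⟩
  · have h1 : Negligible (fun lam => |ν lam|) := hν.mono (by simp)
    exact (h1.add h1).add hβn
  have hκ0 : 0 ≤ κ lam := prob_nonneg _
  have hβ0 : 0 ≤ β lam := prob_nonneg _
  have hab : (0 : ℝ) ≤ rounds (x lam) * (|ν lam| + |ν lam| + β lam) := by positivity
  beta_reduce
  split_ifs with hlam
  · refine (prob_le_one _).trans ?_
    linarith
  rw [not_lt] at hlam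
  rw [prob_eq, ex_map]
  have htot : ex (P.interact lam (n lam) (ε lam) (σ lam) (q lam) (A.strategy lam (q lam)))
      (fun o => ind (∃ t, o.Denotes t ∧ ¬ WithinOfOptimal (σ lam) (ε lam) (q lam).utility t)) ≤
      ENNReal.ofReal (κ lam + (1 / 4 + rounds (x lam) * (|ν lam| + |ν lam| + β lam))) := by
    refine (hA lam).trans ((hcheat lam hlam).trans ?_)
    rw [hfool lam, ENNReal.ofReal_add hκ0 (by positivity), ENNReal.ofReal_add (by norm_num) hab]
    refine add_le_add le_rfl (add_le_add le_rfl ?_)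
    refine (Finset.sum_le_card_nsmul _ _ (ENNReal.ofReal (|ν lam| + |ν lam| + β lam))
      fun j' hj' => ?_).trans (le_of_eq ?_)
    · refine (hwin lam j' (Finset.mem_range.1 hj')).trans ?_
      rw [hβeq lam, ENNReal.ofReal_add (by positivity) hβ0,
        ENNReal.ofReal_add (abs_nonneg _) (abs_nonneg _)]
      gcongr <;> exact le_abs_self _
    · rw [Finset.card_range, nsmul_eq_mul, ENNReal.ofReal_mul (by positivity),
        ENNReal.ofReal_natCast]
  refine (toReal_le_of_le (by positivity) htot).trans ?_
  linarith

end

end SmoothBandit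

/-! ### The theorem -/

theorem mainTheorem7 :
    ∃ C : ℝ, ∀ (VC : VectorCommitment) (SN : Snark), SN.PerfectlyComplete VC →
    ∃ P : Protocol,
      -- completeness and soundness
      (∀ (n : ℕ → ℕ) (ε σ : ℕ → ℝ) (q : ∀ lam, Bandit (n lam)),
        (∀ lam, 1 ≤ n lam) → (∀ lam, 0 < ε lam ∧ ε lam < 1) →
        (∀ lam, 1 / (n lam : ℝ) ≤ σ lam ∧ σ lam ≤ 1) →
        PolyBounded n → PolyBounded (fun lam => ⌈1 / ε lam⌉₊) →
        VC.Correct n → VC.PositionBinding n → SN.KnowledgeSound VC n →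
        (∃ ν : ℕ → ℝ, Negligible ν ∧ ∀ lam,
          2 / 3 - ν lam ≤ prob
            ((P.interact lam (n lam) (ε lam) (σ lam) (q lam)
              (P.honest lam (n lam) (ε lam) (σ lam) (q lam))).map
              (fun o => ∃ t, o.Denotes t ∧
                WithinOfOptimal (σ lam) (ε lam) (q lam).utility t))) ∧
        (∀ A : CheatingProver, ∃ ν : ℕ → ℝ, Negligible ν ∧ ∀ lam,
          prob
            ((P.interact lam (n lam) (ε lam) (σ lam) (q lam) (A.strategy lam (q lam))).map
              (fun o => ∃ t, o.Denotes t ∧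
                ¬ WithinOfOptimal (σ lam) (ε lam) (q lam).utility t))
            ≤ 1 / 3 + ν lam)) ∧
      -- communication
      (∀ K : ℕ, VC.LinearSize K → SN.LinearSize VC K →
        ∀ (lam n : ℕ) (ε σ : ℝ), 1 ≤ lam → 1 ≤ n → 0 < ε → ε < 1 →
          1 / (n : ℝ) ≤ σ → σ ≤ 1 → ∀ e : Execution P lam n ε σ,
            (e.communication : ℝ) ≤
              C * K * (lam * (σ * n * Real.log (2 * n) * Real.log (2 / ε) ^ 2 / ε))) ∧
      -- queries to the bandit oracle
      (∀ (lam n : ℕ) (ε σ : ℝ), 1 ≤ lam → 1 ≤ n → 0 < ε → ε < 1 →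
        1 / (n : ℝ) ≤ σ → σ ≤ 1 → ∀ e : Execution P lam n ε σ,
          (e.proverQueries : ℝ) ≤ C * (n * Real.log (2 * n / ε) / ε ^ 2) ∧
          (e.verifierQueries : ℝ) ≤
            C * (n * σ / ε ^ 2 * Real.log (2 * n * σ / ε) * Real.log (2 / ε))) ∧
      -- running times
      (∃ T : Polynomial ℕ, ∀ (lam n : ℕ) (ε σ : ℝ), 1 ≤ lam → 1 ≤ n → 0 < ε → ε < 1 →
        1 / (n : ℝ) ≤ σ → σ ≤ 1 → ∀ e : Execution P lam n ε σ,
          e.proverTime ≤ T.eval (lam + n + ⌈1 / ε⌉₊) ∧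
          e.verifierTime e.m₁ e.m₃ ≤ T.eval (lam + n + ⌈1 / ε⌉₊) ∧
          ∀ a₁ a₃ : Data,
            e.verifierTime a₁ a₃ ≤ T.eval (lam + n + ⌈1 / ε⌉₊ + a₁.size + a₃.size)) := by
  -- One generous constant serves for the communication and for both numbers of queries; the largest
  -- actual one is `3686400 * (100 / 69)`.
  refine ⟨10000000, fun VC SN hc => ?_⟩
  obtain ⟨Q, hQ⟩ := exists_suitable VC SN
  obtain ⟨P, hP⟩ := exists_implements VC SN Q
  refine ⟨P, ?_, ?_, ?_, ?_⟩
  · intro n ε σ q hn hε hσ hnb heb hVC hbind hSN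
    exact ⟨hP.complete hQ hn hε hσ hnb heb hc q hVC,
      hP.sound hQ hn hε hσ hnb heb q hVC hbind hSN⟩
  · intro K hK hK' lam n ε σ hlam hn hε hε1 hσ _ e
    exact hP.communication_le hK hK' hlam hn hε hε1 hσ e
  · intro lam n ε σ _ hn hε hε1 hσ _ e
    exact ⟨hP.proverQueries_le hn hε hε1 e, hP.verifierQueries_le hn hε hε1 hσ e⟩
  · exact hP.exists_time
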